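/- **Setting.** Fix a smooth $\rho:\mathbb R\to[0,1]$ that is $0$ on $(-\infty,\delta]$ and $1$ on $[1-\delta,\infty)$ for some $\delta>0$. Let $P=P^m$, $m\ge 1$, be a finite all-right spherical simplicial complex of dimension $m$, in which two simplices intersect in at most one common face. Its infinite cone $\mathrm C P$, with points $tx$ ($t\ge 0$, $x\in P$), carries the piecewise hyperbolic metric $\sigma_{\mathrm CP}$, for which $t$ is the distance to the vertex. Let $\mathcal L_P=\{h_\Delta:\mathbb S^{m-k-1}\to \mathrm{Link}(\Delta^k,P)\}_{\Delta\in P}$ be a smooth set of link smoothings: the $h_\Delta$ are homeomorphisms and the normal charts $(\beta u,w)\mapsto \cos\beta\, w+\sin\beta\, h_\Delta(u)$ ($w\in\dot\Delta$, $u\in\mathbb S^{m-k-1}$, $0\le\beta<\pi/2$) form a smooth atlas of $P$. Let $\phi_P:P\to\mathbb S^m$ be a diffeomorphism for this smooth structure; through the cone of $\phi_P$ identify $\mathrm CP$ with $\mathbb R^{m+1}$. Links of simplices of $P$ carry the restricted link smoothings, and the global smoothing of $\mathrm{Link}(\Delta,P)$ is $h_\Delta^{-1}$. **The smoothed metric.**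 Let $\xi>0$, $\varsigma\in(0,1)$, $c>1$, $r>0$ and $\mathsf d=(d_2,d_3,\dots)$, and put $r_i=\sinh^{-1}(\sinh r/\varsigma^{i+1})$, so $r_{-1}=r$. For a metric $g=g_t+dt^2$ on $\mathbb R^{n}$ (with $t$ the norm) and a simplex $\Delta$, the hyperbolic extension $\mathcal E_{\mathrm C\Delta}(g)$ is the metric $\cosh^2 (t)\,\sigma_{\mathbb H}+g$ on $\mathrm C\dot\Delta\times\mathbb R^n$, where $\mathrm C\Delta$ lies in hyperbolic space. The hyperbolic forcing of $g$ is $$\mathcal H_{s,d}(g)=\Bigl(1-\rho\bigl(\tfrac{2(t-s+d)}d\bigr)\Bigr)\bigl(\sinh^2 t\,\sigma_{\mathbb S^{n-1}}+dt^2\bigr)+\rho\bigl(\tfrac{2(t-s+d)}d\bigr)\,g',$$ $$g'=\bigl(1-\rho(2t-2s)\bigr)\Bigl(\tfrac{\sinh^2t}{\sinh^2 s}\,g_s+dt^2\Bigr)+\rho(2t-2s)\,g .$$ For a simplex $\Delta^k$ of a complex $Q^j$ with $k\le j-2$, let $\mathcal Y(Q,\Delta,r)\subset\mathrm CQ$ be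 the open normal neighborhood of $\mathrm C\Delta$ of width $\sinh^{-1}(c\,\varsigma^{k+1}\sinh r_{j-2})$, minus the closed normal neighborhoods of $\mathrm C\Delta'$ of width $r_{j-i-3}$ for all simplices $\Delta'^{\,i}$ of $Q$ with $i<k$, and minus the open ball of radius $r_{j-2}-(4+2\xi)$ around the vertex. By induction on $j$ set $\mathcal G(Q)=\mathcal H_{r_{j-2},\,d_{j+1}}(\wp(Q))$ for $Q=P$ and for the links $Q$ of simplices of $P$, where the patched metric $\wp(Q)$ equals $\mathcal E_{\mathrm C\Delta}\bigl(\mathcal G(\mathrm{Link}(\Delta,Q))\bigr)$ on $\mathcal Y(Q,\Delta,r)$ for $k\le j-2$ (at a point of several of these sets, $\Delta$ is taken of least dimension), and $\wp(Q)=\sigma_{\mathrm CQ}$ elsewhere outside the ball of radius $r_{j-2}-(4+2\xi)$. All these metrics live on Euclidean spaces through the cones of $h_\Delta$ and $\phi_P$. The result is $\mathcal G=\mathcal G(P,\mathcal L_P,\phi_P,\xi,r,\mathsf d,(c,\varsigma))$ on $\mathrm CP=\mathbb R^{m+1}$. **Closeness to hyperbolic.** Let $g$ be a smooth Riemannian metric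 on $\mathbb R^{l}$ of the form $g_t+dt^2$, $t$ the norm. It is *$(B_a,\epsilon)$-close to hyperbolic, with charts of excess $\xi'$* if $g=\sinh^2t\,\sigma_{\mathbb S^{l-1}}+dt^2$ on the open ball of radius $a$ and each point $p$ with $\|p\|\ge a-1-\xi'$ is the center $\varphi(0,0)$ of a smooth chart $\varphi:\mathbb T=\mathbb B^{l-1}\times(-1-\xi',1+\xi')\to\mathbb R^l\setminus\{0\}$ of the form $\varphi(x,t)=(t+b)\,\varphi_1(x)$, with $\|\varphi_1\|=1$, $b\in\mathbb R$, such that the coefficients satisfy $\|\varphi^*g-(e^{2t}\sigma_{\mathbb R^{l-1}}+dt^2)\|_{C^2(\mathbb T)}<\epsilon$. **Proposition 8.4.2.** Let $\varsigma\in(0,1)$, $\xi>0$, $c>1$, and let $(P^m,\mathcal L_P,\phi_P)$ be as above. Assume (i) $c\,\varsigma<e^{-(8+\xi)}$, (ii) $c\ge e^{4+\xi}$, (iii) $m+1\le\xi$. Then for every $\epsilon>0$ the metric $\mathcal G(P,\mathcal L_P,\phi_P,\xi,r,\mathsf d,(c,\varsigma))$ is a smooth Riemannian metric on $\mathrm CP=\mathbb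 R^{m+1}$ of the form $g_t+dt^2$ and is $(B_a,\epsilon)$-close to hyperbolic, $a=r_{m-2}-d_{m+1}$, with charts of excess $\xi_m=\xi-m+\frac1m$, provided the $d_i$ and then the $r-d_i$, $i=2,\dots,m+1$, are sufficiently large. That is: there are $D_2,\dots,D_{m+1}$ such that for every $\mathsf d$ with $d_i\ge D_i$, $i=2,\dots,m+1$, there are $R_2,\dots,R_{m+1}$ (which may depend on $\mathsf d$) such that the assertion holds for every $r$ with $r-d_i\ge R_i$, $i=2,\dots,m+1$. -/

import Mathlib

open scoped ContDiff

noncomputable section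

namespace HypCone

/-- Euclidean `n`-space. -/
abbrev E (n : ℕ) : Type := EuclideanSpace ℝ (Fin n)

/-- Euclidean space with one coordinate for each vertex in the finite set `V`. -/
abbrev EV (V : Type*) [Fintype V] : Type _ := EuclideanSpace ℝ V

/-! ### Fields of bilinear forms on a normed space -/

/-- A field of bilinear forms: `g p a b` is the value at the point `p` on the vectors `a`, `b`. -/
abbrev Form (X : Type*) : Type _ := X → X → X → ℝ

/-- `g` is a smooth Riemannian metric on the whole of `E n`. -/
structure IsRiemannianMetric {n : ℕ} (g : Form (E n)) : Prop where
  bilinear : ∀ p, ∃ B : E n →ₗ[ℝ] E n →ₗ[ℝ] ℝ, ∀ a b, g p a b = B a b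
  symm : ∀ p a b, g p a b = g p b a
  pos : ∀ p a, a ≠ 0 → 0 < g p a a
  smooth : ∀ a b, ContDiff ℝ ∞ fun p => g p a b

/-- The pullback of a field of bilinear forms. -/
def pullback {X Y : Type*} [NormedAddCommGroup X] [NormedSpace ℝ X]
    [NormedAddCommGroup Y] [NormedSpace ℝ Y] (f : X → Y) (g : Form Y) : Form X :=
  fun p a b => g (f p) (fderiv ℝ f p a) (fderiv ℝ f p b)

/-! ### Hyperbolic metrics in two coordinate systems -/

/-- `dt²` on `E n`, with `t = ‖p‖`. -/
def radialForm {n : ℕ} : Form (E n) := fun p a b => inner ℝ p a * inner ℝ p b / ‖p‖ ^ 2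

/-- The hyperbolic metric of `ℍⁿ` in geodesic polar coordinates around the origin of `E n`, that is
`sinh² t · σ_{𝕊ⁿ⁻¹} + dt²`, with `t = ‖p‖`.  (The round metric of the unit sphere is
`(⟨a, b⟩ - dt²(a, b)) / t²` in these coordinates.) -/
def hypPolar {n : ℕ} : Form (E n) := fun p a b =>
  if p = 0 then inner ℝ a b
  else (Real.sinh ‖p‖ / ‖p‖) ^ 2 * (inner ℝ a b - radialForm p a b) + radialForm p a b

/-- The hyperbolic metric in hyperboloid coordinates: the metric induced by `-dX₀² + |dX|²` on the
graph `X₀ = √(1 + |X|²)`. -/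
def hypHyperboloid {X : Type*} [NormedAddCommGroup X] [InnerProductSpace ℝ X] : Form X :=
  fun y a b => inner ℝ a b - inner ℝ y a * inner ℝ y b / (1 + ‖y‖ ^ 2)

/-! ### Hyperbolic forcing -/

/-- The fixed cut-off functions `ρ : ℝ → [0, 1]`. -/
structure IsCutoff (ρ : ℝ → ℝ) : Prop where
  smooth : ContDiff ℝ ∞ ρ
  mem_Icc : ∀ t, ρ t ∈ Set.Icc (0 : ℝ) 1
  flat : ∃ δ : ℝ, 0 < δ ∧ (∀ t ≤ δ, ρ t = 0) ∧ ∀ t, 1 - δ ≤ t → ρ t = 1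

/-- The differential of `p ↦ (s / ‖p‖) p`, the radial projection to the sphere of radius `s`. -/
def projDeriv {n : ℕ} (s : ℝ) (p a : E n) : E n :=
  (s / ‖p‖) • (a - (inner ℝ p a / ‖p‖ ^ 2) • p)

/-- The warped-by-`sinh` metric `sinh² t · (1 / sinh² s) g_s + dt²` of a metric `g = g_t + dt²`:
`g_s` is the restriction of `g` to the sphere of radius `s`. -/
def warpedCut {n : ℕ} (s : ℝ) (g : Form (E n)) : Form (E n) := fun p a b =>
  Real.sinh ‖p‖ ^ 2 *
      ((1 / Real.sinh s ^ 2) * g ((s / ‖p‖) • p) (projDeriv s p a) (projDeriv s p b)) +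
    radialForm p a b

/-- Warp forcing: `g` becomes warped by `sinh` on the ball of radius `s`, and does not change
outside the ball of radius `s + 1/2`. -/
def warpForcing {n : ℕ} (ρ : ℝ → ℝ) (s : ℝ) (g : Form (E n)) : Form (E n) := fun p a b =>
  (1 - ρ (2 * ‖p‖ - 2 * s)) * warpedCut s g p a b + ρ (2 * ‖p‖ - 2 * s) * g p a b

/-- The two variable warping deformation.  Where `g = sinh² t · g' + dt²` this is
`sinh² t · ((1 - ρ_{a,d}(t)) σ_{𝕊ⁿ⁻¹} + ρ_{a,d}(t) g') + dt²`, with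
`ρ_{a,d}(t) = ρ (2 (t - a) / d)`; it is `g` outside the ball of radius `a + d/2`. -/
def twoVariable {n : ℕ} (ρ : ℝ → ℝ) (a d : ℝ) (g : Form (E n)) : Form (E n) := fun p u v =>
  (1 - ρ (2 * ((‖p‖ - a) / d))) * hypPolar p u v + ρ (2 * ((‖p‖ - a) / d)) * g p u v

/-- Hyperbolic forcing. -/
def hypForcing {n : ℕ} (ρ : ℝ → ℝ) (s d : ℝ) (g : Form (E n)) : Form (E n) :=
  twoVariable ρ (s - d) d (warpForcing ρ s g)

/-! ### Metrics close to hyperbolic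

The ambient space is `E (k + 1)`, of dimension `l = k + 1`, with center the origin. -/

/-- The model space `𝕋_ξ = 𝔹ˡ⁻¹ × (-(1 + ξ), 1 + ξ)`. -/
def modelSpace (k : ℕ) (ξ : ℝ) : Set (E k × ℝ) :=
  Metric.ball 0 1 ×ˢ Set.Ioo (-(1 + ξ)) (1 + ξ)

/-- The hyperbolic metric `e^{2t} σ_{ℝˡ⁻¹} + dt²` of the model space. -/
def modelMetric (k : ℕ) : Form (E k × ℝ) := fun q a b =>
  Real.exp (2 * q.2) * inner ℝ a.1 b.1 + a.2 * b.2

/-- The canonical basis of `ℝˡ = ℝˡ⁻¹ × ℝ`. -/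
def modelBasis (k : ℕ) : Fin k ⊕ Unit → E k × ℝ
  | Sum.inl i => (EuclideanSpace.single i 1, 0)
  | Sum.inr _ => (0, 1)

/-- The matrix-valued function of the coefficients of a field of bilinear forms. -/
def coeffs {k : ℕ} (g : Form (E k × ℝ)) (q : E k × ℝ) (i j : Fin k ⊕ Unit) : ℝ :=
  g q (modelBasis k i) (modelBasis k j)

/-- The uniform `C²` norm on an open set `U`. -/
def C2norm {X Y : Type*} [NormedAddCommGroup X] [NormedSpace ℝ X] [NormedAddCommGroup Y]
    [NormedSpace ℝ Y] (U : Set X) (f : X → Y) : ENNReal :=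
  ⨆ q ∈ U, ⨆ i ∈ Set.Iic (2 : ℕ), ‖iteratedFDeriv ℝ i f q‖ₑ

/-- `φ` is a radially `ε`-close to hyperbolic chart of excess `ξ` with center `p`, for the metric
`g = g_t + dt²` on `E (k + 1)`.  Points of `E (k + 1)` minus the origin are written as `t • u`,
with `t > 0` and `u` in the unit sphere. -/
structure IsRadialChart {k : ℕ} (g : Form (E (k + 1))) (ε ξ : ℝ) (p : E (k + 1))
    (φ : E k × ℝ → E (k + 1)) : Prop where
  smooth : ContDiffOn ℝ ∞ φ (modelSpace k ξ)
  injOn : Set.InjOn φ (modelSpace k ξ)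
  immersion : ∀ q ∈ modelSpace k ξ, Function.Injective (fderiv ℝ φ q)
  center : φ (0, 0) = p
  radial : ∃ (a : ℝ) (φ₁ : E k → E (k + 1)), ∀ q ∈ modelSpace k ξ,
    ‖φ₁ q.1‖ = 1 ∧ 0 < q.2 + a ∧ φ q = (q.2 + a) • φ₁ q.1
  close : C2norm (modelSpace k ξ) (fun q => coeffs (pullback φ g) q - coeffs (modelMetric k) q) <
    ENNReal.ofReal ε

/-- `g` is a Riemannian metric on `E (k + 1)` with center the origin and the standard ray structure
(it is of the form `g_t + dt²`, with `t = ‖p‖`), and it is `(B_a, ε)`-close to hyperbolic, with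
charts of excess `ξ`. -/
structure IsBallClose {k : ℕ} (g : Form (E (k + 1))) (a ε ξ : ℝ) : Prop where
  metric : IsRiemannianMetric g
  gauss : ∀ p b, g p p b = inner ℝ p b
  hyperbolic : ∀ p, ‖p‖ < a → g p = hypPolar p
  close : ∀ p, a - 1 - ξ ≤ ‖p‖ → ∃ φ, IsRadialChart g ε ξ p φ

/-! ### All-right spherical complexes and their cones

An all-right spherical complex with finitely many simplices, in which two simplices intersect in at
most one common face, is the geometric realization of an abstract simplicial complex `K`: the set of
unit vectors with nonnegative coordinates whose support is a simplex of `K`.  The point `s x` of its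
infinite cone, with `s ≥ 0` and `x` in the realization, is the vector `s • x`; the distance to the
vertex of the cone (for the piecewise hyperbolic metric) is the norm of the vector. -/

section Complex

variable {V : Type*} [Fintype V]

open Classical in
/-- The vertices at which a vector does not vanish. -/
def supp (x : EV V) : Finset V := Finset.univ.filter fun v => x v ≠ 0

/-- The realization of the all-right spherical complex. -/
def realization (K : PreAbstractSimplicialComplex V) : Set (EV V) :=
  {x | ‖x‖ = 1 ∧ (∀ v, 0 ≤ x v) ∧ supp x ∈ K}

/-- The infinite cone of the all-right spherical complex. -/
def cone (K : PreAbstractSimplicialComplex V) : Set (EV V) :=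
  {x | (∀ v, 0 ≤ x v) ∧ (x ≠ 0 → supp x ∈ K)}

variable [DecidableEq V]

/-- The simplicial link of `σ`; it is `K` for `σ = ∅`. -/
def link (K : PreAbstractSimplicialComplex V) (σ : Finset V) : PreAbstractSimplicialComplex V where
  faces := {τ | τ.Nonempty ∧ Disjoint τ σ ∧ τ ∪ σ ∈ K}
  isRelLowerSet_faces := by
    rintro τ ⟨h₁, h₂, h₃⟩
    refine ⟨h₁, fun τ' hle hne => ⟨hne, Finset.disjoint_of_subset_left hle h₂, ?_⟩⟩
    exact (K.isRelLowerSet_faces h₃).2 (Finset.union_subset_union_left hle)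
      (hne.mono Finset.subset_union_left)

/-- The simplices of `K`, together with the empty simplex. -/
def Face (K : PreAbstractSimplicialComplex V) : Type _ := {σ : Finset V // σ = ∅ ∨ σ ∈ K}

/-- The empty simplex. -/
def Face.empty (K : PreAbstractSimplicialComplex V) : Face K := ⟨∅, Or.inl rfl⟩

/-- The simplex spanned by a simplex `σ` and a simplex of the link of `σ`. -/
def Face.join {K : PreAbstractSimplicialComplex V} (σ : Face K) (Δ : Finset V)
    (hΔ : Δ ∈ link K σ.1) : Face K :=
  ⟨σ.1 ∪ Δ, Or.inr (Finset.union_comm Δ σ.1 ▸ hΔ.2.2)⟩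

/-- The part of a vector with coordinates off `σ`. -/
def off (σ : Finset V) (x : EV V) : EV V := WithLp.toLp 2 fun v => if v ∈ σ then 0 else x v

/-- The part of a vector with coordinates in `σ`. -/
def part (σ : Finset V) (x : EV V) : EV V := WithLp.toLp 2 fun v => if v ∈ σ then x v else 0

/-- `(sinh ‖x‖ / ‖x‖) x`: from geodesic polar coordinates to hyperboloid coordinates. -/
def sinhScale (x : EV V) : EV V := (Real.sinh ‖x‖ / ‖x‖) • x

/-- `(arsinh ‖x‖ / ‖x‖) x`: from hyperboloid coordinates to geodesic polar coordinates. -/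
def arsinhScale (x : EV V) : EV V := (Real.arsinh ‖x‖ / ‖x‖) • x

/-- For a point `x` in the cone of the star of a simplex `Δ` of a complex `Q`, the distance from
`x` to the cone of `Δ`: the `r` of the decomposition
`x = (t w, r u) ∈ C Star(Δ, Q) = C Δ × C Link(Δ, Q)`, with metric
`cosh² r σ_ℍ + σ_{C Link(Δ, Q)}`. -/
def coneDist (Δ : Finset V) (x : EV V) : ℝ := Real.arsinh ‖off Δ (sinhScale x)‖

/-- The cone of the simplicial star of a simplex `Δ` of `Q`. -/
def coneStar (Q : PreAbstractSimplicialComplex V) (Δ : Finset V) : Set (EV V) :=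
  {x | x ∈ cone Q ∧ supp x ∪ Δ ∈ Q}

/-- The closed normal neighborhood of width `s` of the cone of `Δ` in the cone of `Q`. -/
def closedNbhd (Q : PreAbstractSimplicialComplex V) (Δ : Finset V) (s : ℝ) : Set (EV V) :=
  {x | x ∈ coneStar Q Δ ∧ coneDist Δ x ≤ s}

/-- The open normal neighborhood of width `s` of the cone of `Δ` in the cone of `Q`. -/
def openNbhd (Q : PreAbstractSimplicialComplex V) (Δ : Finset V) (s : ℝ) : Set (EV V) :=
  {x | x ∈ coneStar Q Δ ∧ coneDist Δ x < s}

/-- The number `r_{i-1}(r) = arsinh (sinh r / ς ^ i)`, for `i ≥ 0`; in particular `r_{-1} = r`. -/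
def rad (ς r : ℝ) (i : ℕ) : ℝ := Real.arsinh (Real.sinh r / ς ^ i)

/-- The set `𝒴(Q, Δ, r, ξ, (c, ς))`, for a complex `Q` of dimension `m` and a simplex `Δ` of `Q` of
dimension `k ≤ m - 2`.  The widths are
`s_{m,k} = arsinh (sinh r_{m-2} · c ς ^ (k + 1))` and `r_{m,j} = r_{m-j-3}`. -/
def fundNbhd (Q : PreAbstractSimplicialComplex V) (m : ℕ) (ξ ς c r : ℝ) (Δ : Finset V) :
    Set (EV V) :=
  openNbhd Q Δ (Real.arsinh (Real.sinh (rad ς r (m - 1)) * (c * ς ^ Δ.card))) \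
    ((⋃ Δ' ∈ {Δ' : Finset V | Δ' ∈ Q ∧ Δ'.card < Δ.card},
        closedNbhd Q Δ' (rad ς r (m - 1 - Δ'.card))) ∪
      Metric.ball 0 (rad ς r (m - 1) - (4 + 2 * ξ)))

/-! ### Link smoothings -/

open Classical in
/-- The cone of a map `f` which is defined on a set `A` of unit vectors: `s u ↦ s f(u)`. -/
def coneMap {X Y : Type*} [NormedAddCommGroup X] [NormedSpace ℝ X] [NormedAddCommGroup Y]
    [NormedSpace ℝ Y] {A : Set X} {B : Set Y} (f : A → B) (x : X) : Y :=
  if h : ‖x‖⁻¹ • x ∈ A then ‖x‖ • (f ⟨‖x‖⁻¹ • x, h⟩ : Y) else 0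

/-- A family of homeomorphisms from the standard spheres to the links of the simplices of an
`m`-dimensional complex `K`, including the empty simplex, whose link is `K` itself. -/
abbrev SphereFamily (K : PreAbstractSimplicialComplex V) (m : ℕ) : Type _ :=
  ∀ σ : Face K, Metric.sphere (0 : E (m + 1 - σ.1.card)) 1 ≃ₜ realization (link K σ.1)

/-- The normal chart of the open star of `σ`, in the cone: in terms of the normal chart
`(β u', w) ↦ cos β · w + sin β · h_σ(u')`, with `w` in the interior of `σ`, `0 ≤ β < π/2`, of the
complex itself, and of the radial coordinate `s > 0`, the variables here are `y = s cos β · w`,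
a vector with positive coordinates, and `z = s sin β · u'`.  For `σ = ∅` there is no `y`, and the
chart is the cone of `h_∅`. -/
def normalChart {K : PreAbstractSimplicialComplex V} {m : ℕ} (h : SphereFamily K m) (σ : Face K)
    (q : EuclideanSpace ℝ σ.1 × E (m + 1 - σ.1.card)) : EV V :=
  (WithLp.toLp 2 fun v => if hv : v ∈ σ.1 then q.1 ⟨v, hv⟩ else 0) + coneMap (h σ) q.2

/-- The inverse of the normal chart. -/
def normalCoord {K : PreAbstractSimplicialComplex V} {m : ℕ} (h : SphereFamily K m) (σ : Face K)
    (x : EV V) : EuclideanSpace ℝ σ.1 × E (m + 1 - σ.1.card) :=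
  (WithLp.toLp 2 fun v => x v.1, coneMap (h σ).symm (off σ.1 x))

/-- The data `(P, ℒ_P, φ_P)`: `P` is the realization of a complex `K` of dimension `m`; the set of
link smoothings `ℒ_P` is given by the homeomorphisms `h σ`, for the simplices `σ` of `K`; and the
global smoothing `φ_P` is the inverse of `h ∅`.  All transition maps between the cones of the normal
charts of the simplices, and the cone of `φ_P⁻¹`, are smooth: this says that `ℒ_P` is smooth and
that `φ_P : (P, 𝒮_P(ℒ_P)) → 𝕊ᵐ` is a diffeomorphism. -/
structure SmoothSphere (K : PreAbstractSimplicialComplex V) (m : ℕ) where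
  card_le : ∀ σ ∈ K, σ.card ≤ m + 1
  exists_card : ∃ σ ∈ K, σ.card = m + 1
  h : SphereFamily K m
  smooth : ∀ σ τ : Face K, ContDiffOn ℝ ∞ (fun q => normalCoord h τ (normalChart h σ q))
    {q | (∀ v, 0 < q.1 v) ∧ ∀ v ∈ τ.1, 0 < normalChart h σ q v}

/-! ### The smoothed metric

The link of a simplex in the link of `σ` is the link of a simplex of `K`, with the restricted link
smoothings, and `h σ` is the inverse of the global smoothing of the link of `σ` that `ℒ_P`
determines.  So all metrics in the inductive construction are metrics on the cones of the links of
the simplices `σ` of `K` (for `σ = ∅`, on the cone of `P` itself).  They are written in the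
coordinates `C h_σ : E (m + 1 - |σ|) → C Link(σ, K)`. -/

/-- For a simplex `Δ` of the link `Q` of `σ`: the coordinates `(y, v)` of a point `p` in the cone of
the open star of `Δ` in `Q`, under the identification with `C Δ × C Link(Δ, Q)`.  Here `y` is a point
in `C Δ ⊂ ℍ`, in hyperboloid coordinates, and `v ∈ C Link(Δ, Q)` is written in the coordinates of
`Link(Δ, Q) = Link(τ, K)`, where `τ = σ ∪ Δ`. -/
def starCoord {K : PreAbstractSimplicialComplex V} {m : ℕ} (h : SphereFamily K m) (σ τ : Face K)
    (p : E (m + 1 - σ.1.card)) : EV V × E (m + 1 - τ.1.card) :=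
  let X : EV V := sinhScale (coneMap (h σ) p)
  ((Real.sqrt (1 + ‖off τ.1 X‖ ^ 2))⁻¹ • part τ.1 X,
    coneMap (h τ).symm (arsinhScale (off τ.1 X)))

/-- The hyperbolic extension `cosh² ‖v‖ · σ_ℍ + g` of a metric `g = g_t + dt²`, in coordinates
`(y, v)` with `y` in hyperboloid coordinates. -/
def hypExtension {n : ℕ} (g : Form (E n)) : Form (EV V × E n) := fun q a b =>
  Real.cosh ‖q.2‖ ^ 2 * hypHyperboloid q.1 a.1 b.1 + g q.2 a.2 b.2

open Classical in
/-- The piecewise hyperbolic metric of the cone of the link of `σ`, off the cone of its codimension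
two skeleton, in the coordinates `C h_σ`: near a point in the interior of the cone of a simplex
of codimension at most one, spanning `τ` with `σ`, the cone of the link of that simplex is `ℝ` or a
point, and the metric is the hyperbolic extension of the standard metric of `ℝ` or of a point. -/
def pwHyperbolic {K : PreAbstractSimplicialComplex V} {m : ℕ} (h : SphereFamily K m) (σ : Face K) :
    Form (E (m + 1 - σ.1.card)) := fun p =>
  if hp : supp (coneMap (h σ) p) ∈ link K σ.1 then
    pullback (starCoord h σ (σ.join _ hp)) (hypExtension fun _ a b => inner ℝ a b) p
  else 0

/-- `Δ` is a simplex of codimension at least two in the `m`-dimensional complex `Q`, with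
`x ∈ 𝒴(Q, Δ, r)`, and of least dimension among these. -/
def IsPatch (Q : PreAbstractSimplicialComplex V) (m : ℕ) (ξ ς c r : ℝ) (x : EV V) (Δ : Finset V) :
    Prop :=
  Δ ∈ Q ∧ Δ.card + 1 ≤ m ∧ x ∈ fundNbhd Q m ξ ς c r Δ ∧
    ∀ Δ' ∈ Q, Δ'.card + 1 ≤ m → x ∈ fundNbhd Q m ξ ς c r Δ' → Δ.card ≤ Δ'.card

open Classical in
/-- The smoothed metric on the cone of the link `Q` of `σ` (of dimension `m - |σ|`, which is at
least `1` in all uses), in the coordinates `C h_σ`.  The metric to which hyperbolic forcing applies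
is the patched metric: on `𝒴(Q, Δ, r)`, for `Δ` of codimension at least two in `Q`, it is the
hyperbolic extension of the smoothed metric of the link of `Δ` in `Q`; elsewhere it is the piecewise
hyperbolic metric.  The extensions for nested simplices `Δ' ⊂ Δ` agree on
`𝒴(Q, Δ', r) ∩ 𝒴(Q, Δ, r)` outside the shell of thickness `1/2` around the closed normal
neighborhood of `Δ'` in which warp forcing of the metric of the link of `Δ'` takes place; in this
shell the extension for the smaller simplex `Δ'` is the one that fits together smoothly. -/
def smoothedLink {K : PreAbstractSimplicialComplex V} {m : ℕ} (h : SphereFamily K m) (ρ : ℝ → ℝ)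
    (ξ ς c r : ℝ) (d : ℕ → ℝ) (σ : Face K) : Form (E (m + 1 - σ.1.card)) :=
  hypForcing ρ (rad ς r (m - σ.1.card - 1)) (d (m - σ.1.card + 1)) fun p =>
    if hp : ∃ Δ, IsPatch (link K σ.1) (m - σ.1.card) ξ ς c r (coneMap (h σ) p) Δ then
      pullback (starCoord h σ (σ.join hp.choose hp.choose_spec.1))
        (hypExtension (smoothedLink h ρ ξ ς c r d (σ.join hp.choose hp.choose_spec.1))) p
    else pwHyperbolic h σ p
termination_by m + 1 - σ.1.card
decreasing_by
  obtain ⟨h₁, h₂, -⟩ := hp.choose_spec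
  have h₃ := Finset.card_union_of_disjoint h₁.2.1
  have h₄ := Finset.card_pos.mpr h₁.1
  rw [Finset.union_comm] at h₃
  simp only [Face.join]
  omega

/-- The smoothed metric `𝒢(P, ℒ_P, φ_P, r, ξ, d, (c, ς))` on the cone of `P`, identified with
`E (m + 1)` by the cone of `φ_P`. -/
def smoothedMetric {K : PreAbstractSimplicialComplex V} {m : ℕ} (S : SmoothSphere K m) (ρ : ℝ → ℝ)
    (ξ ς c r : ℝ) (d : ℕ → ℝ) : Form (E (m + 1)) :=
  smoothedLink S.h ρ ξ ς c r d (Face.empty K)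

end Complex

end HypCone

end

/-!
Take hyperboloid coordinates on the cone of each link, and scale them by `κ = 1 / sinh r`.  The
normal neighborhoods in the construction then have widths that do not depend on `r` (`wt`), and the
smoothed metrics of all the links become the members with parameter `κ` of one family `model σ κ` of
Euclidean-like metrics (`smoothedLink_eq`).  In these coordinates hyperbolic extension along a
simplex `τ` is the product with a Euclidean metric, pulled back by the transition map `(T1, T2)`
between normal charts (`extB`, `pullback_starCoord`), and hyperbolic forcing is an interpolation
between bilinear forms whose cut-offs still make sense, and are smooth, at `κ = 0`
(`hypForcing_polarOf`, `cutArg`).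

Products with Euclidean spaces along nested simplices compose (`extB_extB`).  Because `c ς` is small,
two simplices that are both near a point are nested, or the point is near to their intersection
(`near_inter`).  Hence patches that overlap agree away from the shells in which forcing takes place
(`eq_extB`), and locally the patched metric is an extension along a fixed simplex.  By induction
over the links, `model` is smooth in `(κ, z)` jointly, for all small `κ ≥ 0` and all `z`, the origin
included (`contDiffAt_model`).  This gives a smooth Riemannian metric of the form `g_t + dt²`.  On
the ball of radius `a` it is hyperbolic since there the outer cut-off vanishes
(`smoothedMetric_eq_hypPolar`).

The closeness to hyperbolic comes from the limit `κ = 0`, which describes `r → ∞`.  For large `d_i`,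
the limit metric varies slowly along rays: the logarithmic rate of change of the first cut-off is of
the order `1 / d_i`, and the second cut-off interpolates between two metrics which, by induction, are
almost equal (`exists_slowModel`).  A point `p` far from the origin is the center of the chart that
maps `(x, t)` to the point at distance `‖p‖ + t` in the direction `q + μ (B x)`, for the direction
`q` of `p`, `μ = 1 / sinh ‖p‖`, and a frame `B` of tangent vectors of the sphere that is orthonormal
at `p`.  Directions are added in the normal coordinates along a simplex `τ` of least dimension near
`p`, so that the metric is an extension along `τ` on the whole chart (`model_eq_extB_of_near`).  The
widths that define nearness here have an additional factor `e^{ξ + 3}`; since `c ≥ e^{4 + ξ}` and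
`c ς < e^{-(8 + ξ)}`, this leaves room for the stretching by a chart of excess at most `ξ`
(`width_bounds`, `params_of_bounds`).

The coefficients in this chart are a smooth function `chartEntry` of `κ`, `μ`, the component of `p`
normal to `τ`, the frame `B`, and the coordinates `(x, t)`.  This component and the frame range over
compact sets (`exists_frame_bound`).  For `κ = μ = 0` the coefficients are `e^{2t} k(t)`, where
`k(0)` is the identity matrix and `k` varies slowly, so they are `C²`-close to `e^{2t}`; by
compactness this persists for all small `κ` and `μ` (`exists_chartEntry_bound`,
`exists_chartScale`).  Both are small if `r - d_i` is large.
-/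

set_option linter.unusedSectionVars false
set_option linter.unnecessarySeqFocus false

noncomputable section

namespace HypCone

/-! ### Vectors with coordinates indexed by the vertices -/

section Coordinates

variable {V : Type*} [Fintype V] [DecidableEq V]

@[simp] lemma part_apply (σ : Finset V) (x : EV V) (v : V) :
    part σ x v = if v ∈ σ then x v else 0 := rfl

@[simp] lemma off_apply (σ : Finset V) (x : EV V) (v : V) :
    off σ x v = if v ∈ σ then 0 else x v := rfl

/-- The coordinate projection `part σ`, as a continuous linear map. -/
def partL (σ : Finset V) : EV V →L[ℝ] EV V :=
  LinearMap.toContinuousLinearMap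
    { toFun := part σ
      map_add' := fun x y => by ext v; simp only [part_apply, PiLp.add_apply]; split_ifs <;> simp
      map_smul' := fun s x => by
        ext v; simp only [part_apply, PiLp.smul_apply, RingHom.id_apply]; split_ifs <;> simp }

/-- The coordinate projection `off σ`, as a continuous linear map. -/
def offL (σ : Finset V) : EV V →L[ℝ] EV V :=
  LinearMap.toContinuousLinearMap
    { toFun := off σ
      map_add' := fun x y => by ext v; simp only [off_apply, PiLp.add_apply]; split_ifs <;> simp
      map_smul' := fun s x => by
        ext v; simp only [off_apply, PiLp.smul_apply, RingHom.id_apply]; split_ifs <;> simp }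

@[simp] lemma partL_apply (σ : Finset V) (x : EV V) : partL σ x = part σ x := rfl

@[simp] lemma offL_apply (σ : Finset V) (x : EV V) : offL σ x = off σ x := rfl

lemma off_smul (σ : Finset V) (s : ℝ) (x : EV V) : off σ (s • x) = s • off σ x :=
  (offL σ).map_smul s x

lemma part_smul (σ : Finset V) (s : ℝ) (x : EV V) : part σ (s • x) = s • part σ x :=
  (partL σ).map_smul s x

lemma part_add_off (σ : Finset V) (x : EV V) : part σ x + off σ x = x := by
  ext v; simp only [PiLp.add_apply, part_apply, off_apply]; split_ifs <;> simp

lemma norm_sq_eq_sum (x : EV V) : ‖x‖ ^ 2 = ∑ v, x v ^ 2 := by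
  rw [EuclideanSpace.norm_sq_eq]; simp

lemma inner_eq_sum (x y : EV V) : inner ℝ x y = ∑ v, x v * y v := by
  rw [PiLp.inner_apply]; exact Finset.sum_congr rfl fun v _ => by simp [mul_comm]

lemma norm_sq_off (σ : Finset V) (x : EV V) :
    ‖off σ x‖ ^ 2 = ∑ v, if v ∈ σ then 0 else x v ^ 2 := by
  rw [norm_sq_eq_sum]; refine Finset.sum_congr rfl fun v _ => ?_
  rw [off_apply]; split_ifs <;> simp

lemma inner_part_add_inner_off (σ : Finset V) (x y : EV V) :
    inner ℝ (part σ x) (part σ y) + inner ℝ (off σ x) (off σ y) = inner ℝ x y := by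
  simp only [inner_eq_sum, ← Finset.sum_add_distrib]
  refine Finset.sum_congr rfl fun v _ => ?_
  rw [part_apply, off_apply, part_apply, off_apply]; split_ifs <;> simp

lemma norm_sq_part_add_norm_sq_off (σ : Finset V) (x : EV V) :
    ‖part σ x‖ ^ 2 + ‖off σ x‖ ^ 2 = ‖x‖ ^ 2 := by
  simpa only [real_inner_self_eq_norm_sq] using inner_part_add_inner_off σ x x

lemma norm_off_le (σ : Finset V) (x : EV V) : ‖off σ x‖ ≤ ‖x‖ := by
  have := norm_sq_part_add_norm_sq_off σ x
  nlinarith [norm_nonneg (off σ x), norm_nonneg x, sq_nonneg ‖part σ x‖]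

lemma off_off {σ τ : Finset V} (hστ : σ ⊆ τ) (x : EV V) : off τ (off σ x) = off τ x := by
  ext v
  simp only [off_apply]
  split_ifs with h₁ h₂
  · rfl
  · exact absurd (hστ h₂) h₁
  · rfl

/-- A point at small distance from the cones of two simplices has small distance from the cone of their
intersection: this orthogonality is what the all-right metric provides. -/
lemma norm_sq_off_inter_le (σ τ : Finset V) (x : EV V) :
    ‖off (σ ∩ τ) x‖ ^ 2 ≤ ‖off σ x‖ ^ 2 + ‖off τ x‖ ^ 2 := by
  simp only [norm_sq_off, ← Finset.sum_add_distrib]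
  refine Finset.sum_le_sum fun v _ => ?_
  have := sq_nonneg (x v)
  by_cases h₁ : v ∈ σ <;> by_cases h₂ : v ∈ τ <;> simp [h₁, h₂] <;> positivity

lemma norm_sq_off_erase {σ : Finset V} {v : V} (hv : v ∈ σ) (x : EV V) :
    ‖off (σ.erase v) x‖ ^ 2 = x v ^ 2 + ‖off σ x‖ ^ 2 := by
  rw [norm_sq_off, norm_sq_off, ← Finset.add_sum_erase _ _ (Finset.mem_univ v),
    ← Finset.add_sum_erase (a := v) _ (fun w => if w ∈ σ then 0 else x w ^ 2) (Finset.mem_univ v)]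
  simp only [Finset.mem_erase, ne_eq, not_true_eq_false, false_and, if_false, hv, if_true, zero_add]
  congr 1
  refine Finset.sum_congr rfl fun w hw => ?_
  simp [(Finset.mem_erase.mp hw).1]

@[simp] lemma mem_supp {x : EV V} {v : V} : v ∈ supp x ↔ x v ≠ 0 := by simp [supp]

lemma supp_smul {s : ℝ} (hs : s ≠ 0) (x : EV V) : supp (s • x) = supp x := by
  ext v; simp [hs]

lemma supp_off (σ : Finset V) (x : EV V) : supp (off σ x) = supp x \ σ := by
  ext v; by_cases hv : v ∈ σ <;> simp [hv]

lemma off_eq_self {σ : Finset V} {x : EV V} (h : Disjoint (supp x) σ) : off σ x = x := by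
  ext v
  rw [off_apply]
  split_ifs with hv
  · by_contra hx
    exact Finset.disjoint_left.mp h (mem_supp.mpr (Ne.symm hx)) hv
  · rfl

lemma off_eq_zero {σ : Finset V} {x : EV V} (h : supp x ⊆ σ) : off σ x = 0 := by
  ext v
  rw [off_apply]
  split_ifs with hv
  · rfl
  · by_contra hx
    exact hv (h (mem_supp.mpr hx))

lemma supp_eq_empty {x : EV V} : supp x = ∅ ↔ x = 0 := by
  refine ⟨fun h => ?_, fun h => by ext v; simp [h]⟩
  ext v
  by_contra hx
  exact absurd (mem_supp.mpr hx) (by simp [h])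

end Coordinates

/-! ### Cones of maps and the link coordinates -/

section ConeMap

variable {X Y : Type*} [NormedAddCommGroup X] [NormedSpace ℝ X] [NormedAddCommGroup Y]
  [NormedSpace ℝ Y] {A : Set X} {B : Set Y}

lemma coneMap_zero (f : A → B) : coneMap f (0 : X) = 0 := by
  unfold coneMap; split_ifs <;> simp

lemma coneMap_of_mem (f : A → B) {x : X} (h : ‖x‖⁻¹ • x ∈ A) :
    coneMap f x = ‖x‖ • (f ⟨‖x‖⁻¹ • x, h⟩ : Y) := by
  simp [coneMap, h]

lemma coneMap_smul (f : A → B) {s : ℝ} (hs : 0 ≤ s) (x : X) :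
    coneMap f (s • x) = s • coneMap f x := by
  rcases hs.eq_or_lt with rfl | hs
  · simp [coneMap_zero]
  have h : ‖s • x‖⁻¹ • s • x = ‖x‖⁻¹ • x := by
    rw [norm_smul, Real.norm_of_nonneg hs.le, smul_smul, mul_inv]
    congr 1; field_simp
  by_cases hx : ‖x‖⁻¹ • x ∈ A
  · have hx' : ‖s • x‖⁻¹ • s • x ∈ A := by rwa [h]
    have he : (⟨_, hx'⟩ : A) = ⟨_, hx⟩ := Subtype.ext h
    rw [coneMap_of_mem f hx, coneMap_of_mem f hx', he, norm_smul, Real.norm_of_nonneg hs.le,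
      mul_smul]
  · have hx' : ‖s • x‖⁻¹ • s • x ∉ A := by rwa [h]
    rw [coneMap, coneMap, dif_neg hx, dif_neg hx', smul_zero]

lemma norm_coneMap (f : A → B) (hB : ∀ y ∈ B, ‖y‖ = 1) {x : X} (h : ‖x‖⁻¹ • x ∈ A) :
    ‖coneMap f x‖ = ‖x‖ := by
  rw [coneMap_of_mem f h, norm_smul, hB _ (f _).2, mul_one, norm_norm]

lemma coneMap_symm_coneMap (f : A ≃ₜ B) (hB : ∀ y ∈ B, ‖y‖ = 1) {x : X} (hx : x ≠ 0)
    (h : ‖x‖⁻¹ • x ∈ A) : coneMap f.symm (coneMap f x) = x := by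
  have hn := norm_coneMap f hB h
  have hx' : ‖x‖ ≠ 0 := norm_ne_zero_iff.mpr hx
  have h₁ : ‖coneMap f x‖⁻¹ • coneMap f x = f ⟨_, h⟩ := by
    rw [hn, coneMap_of_mem f h, smul_smul, inv_mul_cancel₀ hx', one_smul]
  have h₂ : ‖coneMap f x‖⁻¹ • coneMap f x ∈ B := by rw [h₁]; exact (f _).2
  have h₃ : (⟨_, h₂⟩ : B) = f ⟨_, h⟩ := Subtype.ext h₁
  rw [coneMap_of_mem f.symm h₂, h₃, hn, Homeomorph.symm_apply_apply, smul_smul,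
    mul_inv_cancel₀ hx', one_smul]

lemma continuous_coneMap (f : A → B) (hf : Continuous f) (hB : ∀ y ∈ B, ‖y‖ = 1)
    (hA : ∀ x : X, x ≠ 0 → ‖x‖⁻¹ • x ∈ A) : Continuous (coneMap f : X → Y) := by
  rw [continuous_iff_continuousAt]
  intro x
  by_cases hx : x = 0
  · subst hx
    have h0 : ∀ x : X, ‖coneMap f x‖ = ‖x‖ := fun x => by
      by_cases hx : x = 0
      · simp [hx, coneMap_zero]
      · exact norm_coneMap f hB (hA x hx)
    rw [ContinuousAt, coneMap_zero, tendsto_zero_iff_norm_tendsto_zero]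
    simp only [h0]
    simpa using (continuous_norm (E := X)).tendsto 0
  · have hU : IsOpen {x : X | x ≠ 0} := isOpen_ne
    suffices h : ContinuousOn (coneMap f : X → Y) {x | x ≠ 0} from h.continuousAt (hU.mem_nhds hx)
    rw [continuousOn_iff_continuous_domRestrict]
    have h : Set.domRestrict {x : X | x ≠ 0} (coneMap f : X → Y) =
        fun x => ‖x.1‖ • (f ⟨‖x.1‖⁻¹ • x.1, hA _ x.2⟩ : Y) :=
      funext fun x => coneMap_of_mem f _
    rw [h]
    have h' : Continuous fun x : {x : X | x ≠ 0} => ‖x.1‖⁻¹ • x.1 :=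
      (continuous_subtype_val.norm.inv₀ fun x => norm_ne_zero_iff.mpr x.2).smul
        continuous_subtype_val
    exact continuous_subtype_val.norm.smul
      (continuous_subtype_val.comp (hf.comp (h'.subtype_mk _)))

end ConeMap

section Link

variable {V : Type*} [Fintype V] [DecidableEq V] {K : PreAbstractSimplicialComplex V} {m : ℕ}

/-- The Euclidean space on which the cone of the link of `σ` is parametrized. -/
abbrev LC (m : ℕ) (σ : Face K) : Type := E (m + 1 - σ.1.card)

/-- The parametrization of the cone of the link of `σ` by a Euclidean space. -/
def cc (h : SphereFamily K m) (σ : Face K) : LC m σ → EV V := coneMap (h σ)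

/-- The inverse of the parametrization `cc h σ`. -/
def ci (h : SphereFamily K m) (σ : Face K) : EV V → LC m σ := coneMap (h σ).symm

lemma mem_link {σ τ : Finset V} : τ ∈ link K σ ↔ τ.Nonempty ∧ Disjoint τ σ ∧ τ ∪ σ ∈ K := Iff.rfl

variable (h : SphereFamily K m) (σ τ : Face K)

lemma mem_sphere_of_ne_zero {n : ℕ} {x : E n} (hx : x ≠ 0) :
    ‖x‖⁻¹ • x ∈ Metric.sphere (0 : E n) 1 := by
  simp [norm_smul, norm_ne_zero_iff.mpr hx]

lemma norm_of_mem_realization {Q : PreAbstractSimplicialComplex V} :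
    ∀ y ∈ realization Q, ‖y‖ = 1 := fun _ hy => hy.1

lemma norm_of_mem_sphere {n : ℕ} : ∀ y ∈ Metric.sphere (0 : E n) 1, ‖y‖ = 1 := fun y hy => by
  simpa using hy

lemma mem_realization_of_mem_cone {Q : PreAbstractSimplicialComplex V} {x : EV V} (hx : x ∈ cone Q)
    (h0 : x ≠ 0) : ‖x‖⁻¹ • x ∈ realization Q := by
  have hn : ‖x‖ ≠ 0 := norm_ne_zero_iff.mpr h0
  refine ⟨by simp [norm_smul, hn], fun v => ?_, ?_⟩
  · simpa using mul_nonneg (inv_nonneg.mpr (norm_nonneg x)) (hx.1 v)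
  · rw [supp_smul (inv_ne_zero hn)]; exact hx.2 h0

lemma cc_smul {s : ℝ} (hs : 0 ≤ s) (z : LC m σ) : cc h σ (s • z) = s • cc h σ z :=
  coneMap_smul _ hs z

lemma ci_smul {s : ℝ} (hs : 0 ≤ s) (x : EV V) : ci h σ (s • x) = s • ci h σ x :=
  coneMap_smul _ hs x

@[simp] lemma cc_zero : cc h σ 0 = 0 := coneMap_zero _

@[simp] lemma ci_zero : ci h σ 0 = 0 := coneMap_zero _

@[simp] lemma norm_cc (z : LC m σ) : ‖cc h σ z‖ = ‖z‖ := by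
  by_cases hz : z = 0
  · simp [hz]
  · exact norm_coneMap _ norm_of_mem_realization (mem_sphere_of_ne_zero hz)

@[simp] lemma ci_cc (z : LC m σ) : ci h σ (cc h σ z) = z := by
  by_cases hz : z = 0
  · simp [hz]
  · exact coneMap_symm_coneMap _ norm_of_mem_realization hz (mem_sphere_of_ne_zero hz)

lemma cc_ci {x : EV V} (hx : x ∈ cone (link K σ.1)) : cc h σ (ci h σ x) = x := by
  by_cases h0 : x = 0
  · simp [h0]
  · exact coneMap_symm_coneMap (h σ).symm norm_of_mem_sphere h0 (mem_realization_of_mem_cone hx h0)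

lemma continuous_cc : Continuous (cc h σ) :=
  continuous_coneMap _ (h σ).continuous norm_of_mem_realization fun _ => mem_sphere_of_ne_zero

lemma cc_mem (z : LC m σ) : cc h σ z ∈ cone (link K σ.1) := by
  by_cases hz : z = 0
  · simp [hz, cone]
  have hn : ‖z‖ ≠ 0 := norm_ne_zero_iff.mpr hz
  have hm := mem_sphere_of_ne_zero hz
  have he : cc h σ z = ‖z‖ • ((h σ) ⟨_, hm⟩ : EV V) := coneMap_of_mem _ hm
  obtain ⟨-, h₂, h₃⟩ := ((h σ) ⟨_, hm⟩).2
  refine ⟨fun v => ?_, fun _ => ?_⟩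
  · rw [he]; exact mul_nonneg (norm_nonneg z) (h₂ v)
  · rw [he, supp_smul hn]; exact h₃

lemma cc_nonneg (z : LC m σ) (v : V) : 0 ≤ cc h σ z v := (cc_mem h σ z).1 v

lemma cc_eq_zero {z : LC m σ} : cc h σ z = 0 ↔ z = 0 := by
  rw [← norm_eq_zero, norm_cc, norm_eq_zero]

lemma supp_cc_mem {z : LC m σ} (hz : z ≠ 0) : supp (cc h σ z) ∈ link K σ.1 :=
  (cc_mem h σ z).2 ((cc_eq_zero h σ).not.mpr hz)

lemma disjoint_supp_cc (z : LC m σ) : Disjoint (supp (cc h σ z)) σ.1 := by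
  by_cases hz : z = 0
  · rw [hz, cc_zero, supp_eq_empty.mpr rfl]; exact Finset.disjoint_empty_left _
  · exact (supp_cc_mem h σ hz).2.1

lemma cc_apply_of_mem (z : LC m σ) {v : V} (hv : v ∈ σ.1) : cc h σ z v = 0 := by
  by_contra hx
  exact Finset.disjoint_left.mp (disjoint_supp_cc h σ z) (mem_supp.mpr hx) hv

lemma off_cc (z : LC m σ) : off σ.1 (cc h σ z) = cc h σ z := off_eq_self (disjoint_supp_cc h σ z)

end Link

/-! ### Transition maps between the normal charts -/

section Transition

variable {V : Type*} [Fintype V] [DecidableEq V] {K : PreAbstractSimplicialComplex V} {m : ℕ}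

/-- The tangential component `X₁` of the normal coordinates `(X₁, X₂)` along the simplex `τ`. -/
def T1 (h : SphereFamily K m) (σ τ : Face K) (z : LC m σ) : EV V := part τ.1 (cc h σ z)

/-- The normal component `X₂` of the normal coordinates `(X₁, X₂)` along the simplex `τ`. -/
def T2 (h : SphereFamily K m) (σ τ : Face K) (z : LC m σ) : LC m τ :=
  ci h τ (off τ.1 (cc h σ z))

/-- The points of the cone of the link of `σ` that lie over the open star of `τ`. -/
def starDom (h : SphereFamily K m) (σ τ : Face K) : Set (LC m σ) :=
  {z | ∀ v ∈ τ.1, v ∉ σ.1 → 0 < cc h σ z v}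

/-- The point with normal coordinates `(y, v)` along `τ`. -/
def Tinv (h : SphereFamily K m) (σ τ : Face K) (q : EV V × LC m τ) : LC m σ :=
  ci h σ (off σ.1 (part τ.1 q.1 + cc h τ q.2))

lemma isOpen_starDom (h : SphereFamily K m) (σ τ : Face K) : IsOpen (starDom h σ τ) := by
  have : starDom h σ τ = ⋂ v : V, {z | v ∈ τ.1 → v ∉ σ.1 → 0 < cc h σ z v} := by
    ext z; simp [starDom]
  rw [this]
  refine isOpen_iInter_of_finite fun v => ?_
  by_cases h₁ : v ∈ τ.1 <;> by_cases h₂ : v ∈ σ.1 <;> simp only [h₁, h₂, not_true_eq_false,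
    not_false_eq_true, forall_const, false_imp_iff, Set.ofPred_true, isOpen_univ]
  have : Continuous fun z => cc h σ z v :=
    (EuclideanSpace.proj (𝕜 := ℝ) v).continuous.comp (continuous_cc h σ)
  exact isOpen_lt continuous_const this

section

variable (h : SphereFamily K m) {σ τ τ' : Face K} {z : LC m σ}

lemma smul_mem_starDom {s : ℝ} (hs : 0 < s) : s • z ∈ starDom h σ τ ↔ z ∈ starDom h σ τ := by
  simp only [starDom, Set.mem_ofPred_eq, cc_smul h σ hs.le, PiLp.smul_apply, smul_eq_mul,
    mul_pos_iff_of_pos_left hs]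

lemma starDom_anti (hττ : τ.1 ⊆ τ'.1) (hz : z ∈ starDom h σ τ') : z ∈ starDom h σ τ :=
  fun v hv => hz v (hττ hv)

lemma supp_union_mem_of_starDom (hστ : σ.1 ⊆ τ.1) (hz : z ∈ starDom h σ τ) (h0 : z ≠ 0) :
    supp (cc h σ z) ∪ τ.1 ∈ K := by
  have h₁ : supp (cc h σ z) ∪ τ.1 = supp (cc h σ z) ∪ σ.1 := by
    ext v
    simp only [Finset.mem_union]
    refine ⟨?_, fun hv => hv.imp_right fun hv => hστ hv⟩
    rintro (hv | hv)
    · exact Or.inl hv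
    · by_cases hv' : v ∈ σ.1
      · exact Or.inr hv'
      · exact Or.inl (mem_supp.mpr (hz v hv hv').ne')
  rw [h₁]; exact (supp_cc_mem h σ h0).2.2

lemma off_mem_cone {x : EV V} (hx : ∀ v, 0 ≤ x v) (hs : off τ.1 x ≠ 0 → supp x ∪ τ.1 ∈ K) :
    off τ.1 x ∈ cone (link K τ.1) := by
  refine ⟨fun v => ?_, fun h0 => ?_⟩
  · rw [off_apply]; split_ifs
    · exact le_rfl
    · exact hx v
  · rw [supp_off]
    refine mem_link.mpr ⟨?_, Finset.sdiff_disjoint, by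
      rw [Finset.sdiff_union_self_eq_union]; exact hs h0⟩
    rw [← supp_off, Finset.nonempty_iff_ne_empty]
    exact fun h => h0 (supp_eq_empty.mp h)

lemma off_cc_mem_cone (hs : z ≠ 0 → supp (cc h σ z) ∪ τ.1 ∈ K) :
    off τ.1 (cc h σ z) ∈ cone (link K τ.1) :=
  off_mem_cone (cc_nonneg h σ z) fun h0 => hs fun hz => h0 (by
    rw [hz, cc_zero]; exact (offL τ.1).map_zero)

/-- The normal component exists for all points of the closed star of `τ`, not only for those of the open
star. -/
lemma cc_T2' (hs : z ≠ 0 → supp (cc h σ z) ∪ τ.1 ∈ K) :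
    cc h τ (T2 h σ τ z) = off τ.1 (cc h σ z) := cc_ci h τ (off_cc_mem_cone h hs)

lemma cc_T2 (hστ : σ.1 ⊆ τ.1) (hz : z ∈ starDom h σ τ) :
    cc h τ (T2 h σ τ z) = off τ.1 (cc h σ z) := cc_T2' h (supp_union_mem_of_starDom h hστ hz)

lemma norm_T2 (hστ : σ.1 ⊆ τ.1) (hz : z ∈ starDom h σ τ) :
    ‖T2 h σ τ z‖ = ‖off τ.1 (cc h σ z)‖ := by rw [← cc_T2 h hστ hz, norm_cc]

lemma norm_sq_T1_add_norm_sq_T2 (hστ : σ.1 ⊆ τ.1) (hz : z ∈ starDom h σ τ) :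
    ‖T1 h σ τ z‖ ^ 2 + ‖T2 h σ τ z‖ ^ 2 = ‖z‖ ^ 2 := by
  rw [norm_T2 h hστ hz, T1, norm_sq_part_add_norm_sq_off, norm_cc]

lemma T1_smul {s : ℝ} (hs : 0 ≤ s) : T1 h σ τ (s • z) = s • T1 h σ τ z := by
  rw [T1, T1, cc_smul h σ hs, part_smul]

lemma T2_smul {s : ℝ} (hs : 0 ≤ s) : T2 h σ τ (s • z) = s • T2 h σ τ z := by
  rw [T2, T2, cc_smul h σ hs, off_smul, ci_smul h τ hs]

lemma Tinv_T (hστ : σ.1 ⊆ τ.1) (hz : z ∈ starDom h σ τ) :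
    Tinv h σ τ (T1 h σ τ z, T2 h σ τ z) = z := by
  rw [Tinv, cc_T2 h hστ hz, T1]
  have : part τ.1 (part τ.1 (cc h σ z)) = part τ.1 (cc h σ z) := by
    ext v; simp only [part_apply]; split_ifs <;> rfl
  rw [this, part_add_off, off_cc, ci_cc]

end

section

variable (h : SphereFamily K m) {σ τ : Face K} {q : EV V × LC m τ}

lemma off_part_add_cc_mem (hστ : σ.1 ⊆ τ.1) (hq : ∀ v ∈ τ.1, v ∉ σ.1 → 0 < q.1 v) :
    off σ.1 (part τ.1 q.1 + cc h τ q.2) ∈ cone (link K σ.1) := by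
  set x := off σ.1 (part τ.1 q.1 + cc h τ q.2) with hx
  have hxv : ∀ v, x v = if v ∈ σ.1 then 0 else (if v ∈ τ.1 then q.1 v else 0) + cc h τ q.2 v :=
    fun v => rfl
  refine ⟨fun v => ?_, fun h0 => ?_⟩
  · rw [hxv]
    split_ifs with h₁ h₂
    · exact le_rfl
    · exact add_nonneg (hq v h₂ h₁).le (cc_nonneg h τ _ v)
    · rw [zero_add]; exact cc_nonneg h τ _ v
  · have hne : (supp x).Nonempty := Finset.nonempty_iff_ne_empty.mpr fun h => h0 (supp_eq_empty.mp h)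
    have hd : Disjoint (supp x) σ.1 := Finset.disjoint_left.mpr fun v hv hv' => by
      rw [mem_supp, hxv, if_pos hv'] at hv; exact hv rfl
    refine mem_link.mpr ⟨hne, hd, ?_⟩
    have hsub : supp x ∪ σ.1 ⊆ supp (cc h τ q.2) ∪ τ.1 := by
      intro v hv
      rcases Finset.mem_union.mp hv with hv | hv
      · rw [mem_supp, hxv] at hv
        by_cases h₂ : v ∈ τ.1
        · exact Finset.mem_union_right _ h₂
        · refine Finset.mem_union_left _ (mem_supp.mpr fun h₃ => hv ?_)
          simp [h₂, h₃]
      · exact Finset.mem_union_right _ (hστ hv)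
    have hK : supp (cc h τ q.2) ∪ τ.1 ∈ K := by
      by_cases hz : q.2 = 0
      · rw [hz, cc_zero, supp_eq_empty.mpr rfl, Finset.empty_union]
        refine τ.2.resolve_left fun hτ => ?_
        rw [hz, cc_zero, supp_eq_empty.mpr rfl, hτ, Finset.empty_union] at hsub
        exact (hne.mono Finset.subset_union_left).ne_empty (Finset.subset_empty.mp hsub)
      · exact (supp_cc_mem h τ hz).2.2
    exact (K.isRelLowerSet_faces hK).2 hsub (hne.mono Finset.subset_union_left)

lemma cc_Tinv (hστ : σ.1 ⊆ τ.1) (hq : ∀ v ∈ τ.1, v ∉ σ.1 → 0 < q.1 v) :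
    cc h σ (Tinv h σ τ q) = off σ.1 (part τ.1 q.1 + cc h τ q.2) :=
  cc_ci h σ (off_part_add_cc_mem h hστ hq)

lemma Tinv_mem_starDom (hστ : σ.1 ⊆ τ.1) (hq : ∀ v ∈ τ.1, v ∉ σ.1 → 0 < q.1 v) :
    Tinv h σ τ q ∈ starDom h σ τ := fun v hv hv' => by
  rw [cc_Tinv h hστ hq, off_apply, if_neg hv', PiLp.add_apply, part_apply, if_pos hv]
  exact add_pos_of_pos_of_nonneg (hq v hv hv') (cc_nonneg h τ _ v)

lemma T2_Tinv (hστ : σ.1 ⊆ τ.1) (hq : ∀ v ∈ τ.1, v ∉ σ.1 → 0 < q.1 v) :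
    T2 h σ τ (Tinv h σ τ q) = q.2 := by
  rw [T2, cc_Tinv h hστ hq, off_off hστ]
  have : off τ.1 (part τ.1 q.1 + cc h τ q.2) = cc h τ q.2 := by
    rw [← offL_apply, map_add, offL_apply, offL_apply, off_cc]
    have : off τ.1 (part τ.1 q.1) = 0 := by
      ext v; simp only [off_apply, part_apply]; split_ifs <;> rfl
    rw [this, zero_add]
  rw [this, ci_cc]

lemma T1_Tinv (hστ : σ.1 ⊆ τ.1) (hq : ∀ v ∈ τ.1, v ∉ σ.1 → 0 < q.1 v) :
    T1 h σ τ (Tinv h σ τ q) = off σ.1 (part τ.1 q.1) := by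
  rw [T1, cc_Tinv h hστ hq]
  ext v
  simp only [part_apply, off_apply, PiLp.add_apply]
  split_ifs with h₁ h₂ <;> simp_all [cc_apply_of_mem h τ q.2]

end

variable (S : SmoothSphere K m) {σ τ τ' : Face K} {z : LC m σ}

/-- The normal chart of `σ` at the point of the open simplex with all coordinates equal to `1`. -/
lemma normalChart_one (v : V) :
    normalChart S.h σ ((WithLp.toLp 2 fun _ => 1 : EuclideanSpace ℝ σ.1), z) v =
      (if v ∈ σ.1 then 1 else 0) + cc S.h σ z v := by
  simp [normalChart, cc]

/-- The cone of the link of `σ` sits in the normal chart of `σ` as a slice, with the tangential coordinates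
fixed.  So the smoothness of `T1`, `T2` and `Tinv` follows from that of the transition maps. -/
lemma contDiffOn_normalCoord (σ τ : Face K) :
    ContDiffOn ℝ ∞ (fun z => normalCoord S.h τ (normalChart S.h σ
      ((WithLp.toLp 2 fun _ => 1 : EuclideanSpace ℝ σ.1), z))) (starDom S.h σ τ) := by
  refine (S.smooth σ τ).comp (f := fun z : LC m σ =>
    ((WithLp.toLp 2 fun _ => 1 : EuclideanSpace ℝ σ.1), z))
    (contDiff_const.prodMk contDiff_id).contDiffOn fun z hz => ⟨fun v => one_pos, fun v hv => ?_⟩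
  rw [normalChart_one]
  split_ifs with h₁
  · exact add_pos_of_pos_of_nonneg one_pos (cc_nonneg S.h σ z v)
  · rw [zero_add]; exact hz v hv h₁

lemma contDiffOn_T1 (σ τ : Face K) : ContDiffOn ℝ ∞ (T1 S.h σ τ) (starDom S.h σ τ) := by
  rw [contDiffOn_euclidean]
  intro v
  by_cases hv : v ∈ τ.1
  · by_cases hv' : v ∈ σ.1
    · refine (contDiffOn_const (c := 0)).congr fun z _ => ?_
      simp [T1, hv, cc_apply_of_mem S.h σ z hv']
    · have h₁ := (contDiffOn_normalCoord S σ τ).fst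
      rw [contDiffOn_euclidean] at h₁
      refine (h₁ ⟨v, hv⟩).congr fun z _ => ?_
      have : (normalCoord S.h τ (normalChart S.h σ
        ((WithLp.toLp 2 fun _ => 1 : EuclideanSpace ℝ σ.1), z))).1 ⟨v, hv⟩ =
        normalChart S.h σ ((WithLp.toLp 2 fun _ => 1 : EuclideanSpace ℝ σ.1), z) v := rfl
      rw [this, normalChart_one]
      simp [T1, hv, hv']
  · refine (contDiffOn_const (c := 0)).congr fun z _ => ?_
    simp [T1, hv]

lemma contDiffOn_T2 (hστ : σ.1 ⊆ τ.1) : ContDiffOn ℝ ∞ (T2 S.h σ τ) (starDom S.h σ τ) := by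
  refine (contDiffOn_normalCoord S σ τ).snd.congr fun z _ => ?_
  simp only [normalCoord, T2, ci]
  congr 1
  ext v
  rw [off_apply, off_apply]
  split_ifs with hv
  · rfl
  · rw [normalChart_one, if_neg fun h => hv (hστ h), zero_add]

lemma contDiffOn_Tinv (hστ : σ.1 ⊆ τ.1) : ContDiffOn ℝ ∞ (Tinv S.h σ τ)
    {q | ∀ v ∈ τ.1, v ∉ σ.1 → 0 < q.1 v} := by
  -- the coordinates along `σ` do not matter, so they may be moved to positive values
  let e : EV V × LC m τ → EuclideanSpace ℝ τ.1 × LC m τ := fun q =>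
    (WithLp.toLp 2 fun v => if v.1 ∈ σ.1 then 1 else q.1 v.1, q.2)
  have he : ContDiff ℝ ∞ e := by
    refine ContDiff.prodMk ?_ contDiff_snd
    rw [contDiff_euclidean]
    intro v
    by_cases hv : v.1 ∈ σ.1
    · simpa [hv] using contDiff_const
    · simp only [hv, if_false]
      exact (contDiff_euclidean.mp contDiff_fst v.1)
  have hc : ∀ q v, normalChart S.h τ (e q) v =
      (if v ∈ τ.1 then (if v ∈ σ.1 then 1 else q.1 v) else 0) + cc S.h τ q.2 v := by
    intro q v
    simp only [normalChart, e, PiLp.add_apply, cc]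
    congr 1
  refine (((S.smooth τ σ).comp (f := e) he.contDiffOn fun q hq => ⟨fun v => ?_, fun v hv => ?_⟩).snd
    ).congr fun q hq => ?_
  · change 0 < if v.1 ∈ σ.1 then 1 else q.1 v.1
    split_ifs with h₁
    · exact one_pos
    · exact hq v.1 v.2 h₁
  · rw [hc, if_pos (hστ hv), if_pos hv]
    exact add_pos_of_pos_of_nonneg one_pos (cc_nonneg S.h τ _ v)
  · simp only [Function.comp, normalCoord, Tinv, ci]
    congr 1
    ext v
    rw [off_apply, off_apply]
    split_ifs with hv
    · rfl
    · rw [hc, if_neg hv]; rfl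

lemma contDiffAt_T1 (_ : σ.1 ⊆ τ.1) (hz : z ∈ starDom S.h σ τ) :
    ContDiffAt ℝ ∞ (T1 S.h σ τ) z :=
  (contDiffOn_T1 S σ τ).contDiffAt ((isOpen_starDom _ _ _).mem_nhds hz)

lemma contDiffAt_T2 (hστ : σ.1 ⊆ τ.1) (hz : z ∈ starDom S.h σ τ) :
    ContDiffAt ℝ ∞ (T2 S.h σ τ) z :=
  (contDiffOn_T2 S hστ).contDiffAt ((isOpen_starDom _ _ _).mem_nhds hz)

/-- The derivative of `T1`. -/
def D1 (h : SphereFamily K m) (σ τ : Face K) (z : LC m σ) : LC m σ →L[ℝ] EV V :=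
  fderiv ℝ (T1 h σ τ) z

/-- The derivative of `T2`. -/
def D2 (h : SphereFamily K m) (σ τ : Face K) (z : LC m σ) : LC m σ →L[ℝ] LC m τ :=
  fderiv ℝ (T2 h σ τ) z

lemma hasFDerivAt_T1 (hστ : σ.1 ⊆ τ.1) (hz : z ∈ starDom S.h σ τ) :
    HasFDerivAt (T1 S.h σ τ) (D1 S.h σ τ z) z :=
  ((contDiffAt_T1 S hστ hz).differentiableAt (by simp)).hasFDerivAt

lemma hasFDerivAt_T2 (hστ : σ.1 ⊆ τ.1) (hz : z ∈ starDom S.h σ τ) :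
    HasFDerivAt (T2 S.h σ τ) (D2 S.h σ τ z) z :=
  ((contDiffAt_T2 S hστ hz).differentiableAt (by simp)).hasFDerivAt

lemma contDiffAt_D1 (hστ : σ.1 ⊆ τ.1) (hz : z ∈ starDom S.h σ τ) :
    ContDiffAt ℝ ∞ (D1 S.h σ τ) z := (contDiffAt_T1 S hστ hz).fderiv_right (by simp)

lemma contDiffAt_D2 (hστ : σ.1 ⊆ τ.1) (hz : z ∈ starDom S.h σ τ) :
    ContDiffAt ℝ ∞ (D2 S.h σ τ) z := (contDiffAt_T2 S hστ hz).fderiv_right (by simp)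

lemma fderiv_smul_of_homogeneous {X Y : Type*} [NormedAddCommGroup X] [NormedSpace ℝ X]
    [NormedAddCommGroup Y] [NormedSpace ℝ Y] {f : X → Y} {s : ℝ} (hs : 0 < s)
    (hf : ∀ x, f (s • x) = s • f x) (x : X) : fderiv ℝ f (s • x) = fderiv ℝ f x := by
  have h₁ : fderiv ℝ (fun x => f (s • x)) x = s • fderiv ℝ f (s • x) := fderiv_comp_smul s
  have h₂ : fderiv ℝ (fun x => f (s • x)) x = s • fderiv ℝ f x := by
    have h₃ : (fun x => f (s • x)) = s • f := funext hf
    rw [h₃, fderiv_const_smul_field]; rfl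
  exact smul_right_injective _ hs.ne' (h₁.symm.trans h₂)

lemma D1_smul (h : SphereFamily K m) {s : ℝ} (hs : 0 < s) : D1 h σ τ (s • z) = D1 h σ τ z :=
  fderiv_smul_of_homogeneous hs (fun _ => T1_smul h hs.le) z

lemma D2_smul (h : SphereFamily K m) {s : ℝ} (hs : 0 < s) : D2 h σ τ (s • z) = D2 h σ τ z :=
  fderiv_smul_of_homogeneous hs (fun _ => T2_smul h hs.le) z

/-- Euler's relation for positively homogeneous maps of degree one. -/
lemma fderiv_self_of_homogeneous {X Y : Type*} [NormedAddCommGroup X] [NormedSpace ℝ X]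
    [NormedAddCommGroup Y] [NormedSpace ℝ Y] {f : X → Y} {f' : X →L[ℝ] Y} {x : X}
    (hf : ∀ s : ℝ, 0 < s → f (s • x) = s • f x) (h : HasFDerivAt f f' x) : f' x = f x := by
  have h₁ : HasDerivAt (fun s : ℝ => s • x) x 1 := by
    simpa using (hasDerivAt_id (1 : ℝ)).smul_const x
  have h₂ : HasDerivAt (fun s : ℝ => f (s • x)) (f' x) 1 := by
    have h' : HasFDerivAt f f' ((1 : ℝ) • x) := by rwa [one_smul]
    exact h'.comp_hasDerivAt (1 : ℝ) h₁
  have h₃ : HasDerivAt (fun s : ℝ => s • f x) (f x) 1 := by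
    simpa using (hasDerivAt_id (1 : ℝ)).smul_const (f x)
  refine h₂.unique (h₃.congr_of_eventuallyEq ?_)
  filter_upwards [lt_mem_nhds one_pos] with s hs using hf s hs

lemma D1_self (hστ : σ.1 ⊆ τ.1) (hz : z ∈ starDom S.h σ τ) : D1 S.h σ τ z z = T1 S.h σ τ z :=
  fderiv_self_of_homogeneous (fun _ hs => T1_smul S.h hs.le) (hasFDerivAt_T1 S hστ hz)

lemma D2_self (hστ : σ.1 ⊆ τ.1) (hz : z ∈ starDom S.h σ τ) : D2 S.h σ τ z z = T2 S.h σ τ z :=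
  fderiv_self_of_homogeneous (fun _ hs => T2_smul S.h hs.le) (hasFDerivAt_T2 S hστ hz)

/-- The differential of `‖T1 z‖² + ‖T2 z‖² = ‖z‖²`.  It says that extensions keep the radial vector normal
to the spheres, as in the lemma of Gauss. -/
lemma inner_T_D (hστ : σ.1 ⊆ τ.1) (hz : z ∈ starDom S.h σ τ) (a : LC m σ) :
    inner ℝ (T1 S.h σ τ z) (D1 S.h σ τ z a) + inner ℝ (T2 S.h σ τ z) (D2 S.h σ τ z a) =
      inner ℝ z a := by
  have h₁ := ((hasFDerivAt_T1 S hστ hz).norm_sq).add (hasFDerivAt_T2 S hστ hz).norm_sq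
  have h₂ : HasFDerivAt (fun z : LC m σ => ‖z‖ ^ 2) _ z := (hasFDerivAt_id z).norm_sq
  have h₃ := h₂.unique (h₁.congr_of_eventuallyEq (by
    filter_upwards [(isOpen_starDom S.h σ τ).mem_nhds hz] with y hy
    exact (norm_sq_T1_add_norm_sq_T2 S.h hστ hy).symm))
  have h₄ := congrArg (fun L => L a) h₃
  simp at h₄
  linarith

/-- `(T1, T2)` is an immersion, since it has the smooth left inverse `Tinv`. -/
lemma eq_zero_of_D (hστ : σ.1 ⊆ τ.1) (hz : z ∈ starDom S.h σ τ) {a : LC m σ}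
    (h₁ : D1 S.h σ τ z a = 0) (h₂ : D2 S.h σ τ z a = 0) : a = 0 := by
  have hq : (T1 S.h σ τ z, T2 S.h σ τ z) ∈ {q : EV V × LC m τ | ∀ v ∈ τ.1, v ∉ σ.1 → 0 < q.1 v} :=
    fun v hv hv' => by simpa [T1, hv] using hz v hv hv'
  have ho : IsOpen {q : EV V × LC m τ | ∀ v ∈ τ.1, v ∉ σ.1 → 0 < q.1 v} := by
    have : {q : EV V × LC m τ | ∀ v ∈ τ.1, v ∉ σ.1 → 0 < q.1 v} =
        ⋂ v : V, {q | v ∈ τ.1 → v ∉ σ.1 → 0 < q.1 v} := by ext q; simp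
    rw [this]
    refine isOpen_iInter_of_finite fun v => ?_
    by_cases h₁ : v ∈ τ.1 <;> by_cases h₂ : v ∈ σ.1 <;> simp only [h₁, h₂, not_true_eq_false,
      not_false_eq_true, forall_const, false_imp_iff, Set.ofPred_true, isOpen_univ]
    have : Continuous fun q : EV V × LC m τ => q.1 v :=
      (EuclideanSpace.proj (𝕜 := ℝ) v).continuous.comp continuous_fst
    exact isOpen_lt continuous_const this
  have h₃ := ((contDiffOn_Tinv S hστ).contDiffAt (ho.mem_nhds hq)).differentiableAt (by simp)
  have h₄ := h₃.hasFDerivAt.comp z ((hasFDerivAt_T1 S hστ hz).prodMk (hasFDerivAt_T2 S hστ hz))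
  have h₅ := (hasFDerivAt_id z).unique (h₄.congr_of_eventuallyEq (by
    filter_upwards [(isOpen_starDom S.h σ τ).mem_nhds hz] with y hy
    exact (Tinv_T S.h hστ hy).symm))
  have h₆ := congrArg (fun L => L a) h₅
  simpa [h₁, h₂, Prod.mk_zero_zero] using h₆

/-! ### Transition maps for nested simplices -/

lemma T2_mem_starDom (h : SphereFamily K m) (hστ : σ.1 ⊆ τ.1) (hττ : τ.1 ⊆ τ'.1)
    (hz : z ∈ starDom h σ τ') : T2 h σ τ z ∈ starDom h τ τ' := fun v hv hv' => by
  rw [cc_T2 h hστ (starDom_anti h hττ hz), off_apply, if_neg hv']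
  exact hz v hv fun h => hv' (hστ h)

lemma T2_T2 (h : SphereFamily K m) (hστ : σ.1 ⊆ τ.1) (hττ : τ.1 ⊆ τ'.1)
    (hz : z ∈ starDom h σ τ) : T2 h τ τ' (T2 h σ τ z) = T2 h σ τ' z := by
  rw [T2, cc_T2 h hστ hz, off_off hττ]; rfl

lemma T1_T2 (h : SphereFamily K m) (hστ : σ.1 ⊆ τ.1)
    (hz : z ∈ starDom h σ τ) : T1 h τ τ' (T2 h σ τ z) = off τ.1 (T1 h σ τ' z) := by
  rw [T1, cc_T2 h hστ hz, T1]
  ext v; simp only [part_apply, off_apply]; split_ifs <;> rfl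

lemma D2_T2 (hστ : σ.1 ⊆ τ.1) (hττ : τ.1 ⊆ τ'.1) (hz : z ∈ starDom S.h σ τ') (a : LC m σ) :
    D2 S.h τ τ' (T2 S.h σ τ z) (D2 S.h σ τ z a) = D2 S.h σ τ' z a := by
  have hz' := starDom_anti S.h hττ hz
  have h₁ := (hasFDerivAt_T2 S hττ (T2_mem_starDom S.h hστ hττ hz)).comp z
    (hasFDerivAt_T2 S hστ hz')
  have h₂ := (hasFDerivAt_T2 S (hστ.trans hττ) hz).unique (h₁.congr_of_eventuallyEq (by
    filter_upwards [(isOpen_starDom S.h σ τ).mem_nhds hz'] with y hy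
    exact (T2_T2 S.h hστ hττ hy).symm))
  rw [h₂]; rfl

lemma D1_T2 (hστ : σ.1 ⊆ τ.1) (hττ : τ.1 ⊆ τ'.1) (hz : z ∈ starDom S.h σ τ') (a : LC m σ) :
    D1 S.h τ τ' (T2 S.h σ τ z) (D2 S.h σ τ z a) = off τ.1 (D1 S.h σ τ' z a) := by
  have hz' := starDom_anti S.h hττ hz
  have h₁ := (hasFDerivAt_T1 S hττ (T2_mem_starDom S.h hστ hττ hz)).comp z
    (hasFDerivAt_T2 S hστ hz')
  have h₂ := ((offL τ.1).hasFDerivAt.comp z (hasFDerivAt_T1 S (hστ.trans hττ) hz)).unique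
    (h₁.congr_of_eventuallyEq (by
      filter_upwards [(isOpen_starDom S.h σ τ).mem_nhds hz'] with y hy
      exact (T1_T2 S.h hστ hy).symm))
  exact (congrArg (fun L => L a) h₂).symm

lemma D1_eq_part (hστ : σ.1 ⊆ τ.1) (hττ : τ.1 ⊆ τ'.1) (hz : z ∈ starDom S.h σ τ') (a : LC m σ) :
    D1 S.h σ τ z a = part τ.1 (D1 S.h σ τ' z a) := by
  have hz' := starDom_anti S.h hττ hz
  have h₂ := (hasFDerivAt_T1 S hστ hz').unique
    (((partL τ.1).hasFDerivAt.comp z (hasFDerivAt_T1 S (hστ.trans hττ) hz)).congr_of_eventuallyEq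
      (Filter.Eventually.of_forall fun y => by
        change T1 S.h σ τ y = part τ.1 (T1 S.h σ τ' y)
        rw [T1, T1]
        ext v
        simp only [part_apply]
        split_ifs with h₁ h₂
        · rfl
        · exact absurd (hττ h₁) h₂
        · rfl))
  exact congrArg (fun L => L a) h₂

end Transition

/-! ### Products of a Euclidean metric and a metric on the cone of a link -/

section Ext

variable {V : Type*} [Fintype V] [DecidableEq V] {K : PreAbstractSimplicialComplex V} {m : ℕ}

/-- The inner product as a continuous bilinear map. -/
def innerB (X : Type*) [NormedAddCommGroup X] [InnerProductSpace ℝ X] : X →L[ℝ] X →L[ℝ] ℝ :=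
  (innerₗ X).mkContinuous₂ 1 fun x y => by simpa using norm_inner_le_norm (𝕜 := ℝ) x y

/-- Bilinear forms on `E n`, as a normed space. -/
def Bil (n : ℕ) : Type := E n →L[ℝ] E n →L[ℝ] ℝ

namespace Bil

variable {n : ℕ}

instance : NormedAddCommGroup (Bil n) :=
  inferInstanceAs (NormedAddCommGroup (E n →L[ℝ] E n →L[ℝ] ℝ))

instance : NormedSpace ℝ (Bil n) := inferInstanceAs (NormedSpace ℝ (E n →L[ℝ] E n →L[ℝ] ℝ))

/-- The value of a bilinear form on two vectors. -/
def ev (β : Bil n) (a b : E n) : ℝ := (show E n →L[ℝ] E n →L[ℝ] ℝ from β) a b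

instance : CoeFun (Bil n) fun _ => E n → E n → ℝ := ⟨ev⟩

lemma ext {β γ : Bil n} (h : ∀ a b, β a b = γ a b) : β = γ :=
  ContinuousLinearMap.ext fun a => ContinuousLinearMap.ext fun b => h a b

@[simp] lemma add_ev (β γ : Bil n) (a b : E n) : (β + γ) a b = β a b + γ a b := rfl

@[simp] lemma smul_ev (s : ℝ) (β : Bil n) (a b : E n) : (s • β) a b = s * β a b := rfl

@[simp] lemma zero_ev (a b : E n) : (0 : Bil n) a b = 0 := rfl

lemma ev_add_left (β : Bil n) (a a' b : E n) : β (a + a') b = β a b + β a' b :=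
  ContinuousLinearMap.map_add₂ (show E n →L[ℝ] E n →L[ℝ] ℝ from β) a a' b

lemma ev_smul_left (β : Bil n) (s : ℝ) (a b : E n) : β (s • a) b = s * β a b :=
  ContinuousLinearMap.map_smul₂ (show E n →L[ℝ] E n →L[ℝ] ℝ from β) s a b

lemma ev_add_right (β : Bil n) (a b b' : E n) : β a (b + b') = β a b + β a b' :=
  ((show E n →L[ℝ] E n →L[ℝ] ℝ from β) a).map_add b b'

lemma ev_smul_right (β : Bil n) (s : ℝ) (a b : E n) : β a (s • b) = s * β a b :=
  ((show E n →L[ℝ] E n →L[ℝ] ℝ from β) a).map_smul s b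

@[simp] lemma ev_zero_left (β : Bil n) (b : E n) : β 0 b = 0 := by
  simpa using β.ev_smul_left 0 0 b

@[simp] lemma ev_zero_right (β : Bil n) (a : E n) : β a 0 = 0 := by
  simpa using β.ev_smul_right 0 a 0

/-- The Euclidean inner product. -/
def eucl (n : ℕ) : Bil n := innerB (E n)

@[simp] lemma eucl_ev (a b : E n) : eucl n a b = inner ℝ a b := rfl

variable {X : Type*} [NormedAddCommGroup X] [NormedSpace ℝ X] {k : WithTop ℕ∞} {x : X}

lemma contDiffAt_ev {f : X → Bil n} {u v : X → E n} (hf : ContDiffAt ℝ k f x)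
    (hu : ContDiffAt ℝ k u x) (hv : ContDiffAt ℝ k v x) :
    ContDiffAt ℝ k (fun x => f x (u x) (v x)) x :=
  ContDiffAt.clm_apply (ContDiffAt.clm_apply (f := fun x => show E n →L[ℝ] E n →L[ℝ] ℝ from f x)
    hf hu) hv

lemma ext_single {β γ : Bil n}
    (h : ∀ i j, β (EuclideanSpace.single i 1) (EuclideanSpace.single j 1) =
      γ (EuclideanSpace.single i 1) (EuclideanSpace.single j 1)) : β = γ := by
  refine ContinuousLinearMap.coe_injective
    ((EuclideanSpace.basisFun (Fin n) ℝ).toBasis.ext fun i => ?_)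
  refine ContinuousLinearMap.coe_injective
    ((EuclideanSpace.basisFun (Fin n) ℝ).toBasis.ext fun j => ?_)
  simp only [OrthonormalBasis.coe_toBasis, EuclideanSpace.basisFun_apply]
  exact h i j

lemma contDiffAt_of_ev {f : X → Bil n} (hf : ∀ a b, ContDiffAt ℝ k (fun x => f x a b) x) :
    ContDiffAt ℝ k f x := by
  let L : Bil n →ₗ[ℝ] (Fin n → Fin n → ℝ) :=
    { toFun := fun β i j => β (EuclideanSpace.single i 1) (EuclideanSpace.single j 1)
      map_add' := fun β γ => rfl
      map_smul' := fun s β => rfl }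
  have hL : Function.Injective L := fun β γ h => ext_single fun i j => congrFun (congrFun h i) j
  obtain ⟨L', hL'⟩ := L.exists_leftInverse_of_injective (LinearMap.ker_eq_bot.mpr hL)
  have h₁ : f = fun x => L'.toContinuousLinearMap (L (f x)) :=
    funext fun x => (congrArg (fun F => F (f x)) hL').symm
  rw [h₁]
  refine L'.toContinuousLinearMap.contDiff.contDiffAt.comp x ?_
  exact contDiffAt_pi.mpr fun i => contDiffAt_pi.mpr fun j => hf _ _

end Bil

/-- The form at `z` which is the pullback, under the normal coordinates `(X₁, X₂)` along `τ`, of the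
product of the Euclidean metric and the form `β` on the cone of the link of `τ`.  In hyperboloid
coordinates this is what hyperbolic extension does. -/
def extB (h : SphereFamily K m) (σ τ : Face K) (z : LC m σ) (β : Bil (m + 1 - τ.1.card)) :
    Bil (m + 1 - σ.1.card) :=
  show LC m σ →L[ℝ] LC m σ →L[ℝ] ℝ from
    (innerB (EV V)).bilinearComp (D1 h σ τ z) (D1 h σ τ z) +
      (show LC m τ →L[ℝ] LC m τ →L[ℝ] ℝ from β).bilinearComp (D2 h σ τ z) (D2 h σ τ z)

@[simp] lemma extB_ev (h : SphereFamily K m) (σ τ : Face K) (z : LC m σ)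
    (β : Bil (m + 1 - τ.1.card)) (a b : LC m σ) : extB h σ τ z β a b =
      inner ℝ (D1 h σ τ z a) (D1 h σ τ z b) + β (D2 h σ τ z a) (D2 h σ τ z b) := rfl

variable (S : SmoothSphere K m) {σ τ τ' : Face K} {z : LC m σ}

lemma extB_smul (h : SphereFamily K m) {s : ℝ} (hs : 0 < s) (β : Bil (m + 1 - τ.1.card)) :
    extB h σ τ (s • z) β = extB h σ τ z β := by
  rw [extB, extB, D1_smul h hs, D2_smul h hs]

/-- Hyperbolic extensions along nested simplices compose. -/
lemma extB_extB (hστ : σ.1 ⊆ τ.1) (hττ : τ.1 ⊆ τ'.1) (hz : z ∈ starDom S.h σ τ')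
    (β : Bil (m + 1 - τ'.1.card)) :
    extB S.h σ τ z (extB S.h τ τ' (T2 S.h σ τ z) β) = extB S.h σ τ' z β := by
  refine Bil.ext fun a b => ?_
  simp only [extB_ev]
  rw [D2_T2 S hστ hττ hz, D2_T2 S hστ hττ hz, D1_T2 S hστ hττ hz, D1_T2 S hστ hττ hz,
    D1_eq_part S hστ hττ hz, D1_eq_part S hστ hττ hz, ← add_assoc, inner_part_add_inner_off]

lemma extB_gauss (hστ : σ.1 ⊆ τ.1) (hz : z ∈ starDom S.h σ τ) {β : Bil (m + 1 - τ.1.card)}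
    (hβ : ∀ b, β (T2 S.h σ τ z) b = inner ℝ (T2 S.h σ τ z) b) (a : LC m σ) :
    extB S.h σ τ z β z a = inner ℝ z a := by
  rw [extB_ev, D1_self S hστ hz, D2_self S hστ hz, hβ, inner_T_D S hστ hz]

lemma extB_pos (hστ : σ.1 ⊆ τ.1) (hz : z ∈ starDom S.h σ τ) {β : Bil (m + 1 - τ.1.card)}
    (hβ : ∀ a, a ≠ 0 → 0 < β a a) {a : LC m σ} (ha : a ≠ 0) : 0 < extB S.h σ τ z β a a := by
  rw [extB_ev, real_inner_self_eq_norm_sq]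
  by_cases h₂ : D2 S.h σ τ z a = 0
  · have h₁ : D1 S.h σ τ z a ≠ 0 := fun h₁ => ha (eq_zero_of_D S hστ hz h₁ h₂)
    rw [h₂, Bil.ev_zero_left, add_zero]
    exact pow_pos (norm_pos_iff.mpr h₁) 2
  · exact add_pos_of_nonneg_of_pos (sq_nonneg _) (hβ _ h₂)

end Ext

/-! ### Normal neighborhoods of the simplices form chains -/

section Near

variable {V : Type*} [Fintype V] [DecidableEq V] {K : PreAbstractSimplicialComplex V} {m : ℕ}

/-- The width `ς ^ n / ς ^ (m - 1)` of the normal neighborhood of a simplex with `n` vertices,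
measured in hyperboloid coordinates and in units of `sinh r`. -/
def wt (ς : ℝ) (m n : ℕ) : ℝ := ς ^ n / ς ^ (m - 1)

/-- The inequalities between the constants: `C₀` bounds the widths of the normal neighborhoods in
which the metric has to be understood as a hyperbolic extension. -/
structure Params (ς c C₀ : ℝ) : Prop where
  pos : 0 < ς
  exp_lt : Real.exp 1 < c
  lt : c < C₀
  mul_le : C₀ * ς ≤ 1 / 4

namespace Params

variable {ς c C₀ : ℝ} (hP : Params ς c C₀)
include hP

lemma le : c ≤ C₀ := hP.lt.le

lemma exp_le : Real.exp 1 ≤ c := hP.exp_lt.le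

lemma two_le : 2 ≤ c := by linarith [Real.exp_one_gt_d9, hP.exp_le]

lemma lt_one : ς < 1 := by nlinarith [hP.two_le, hP.le, hP.mul_le, hP.pos]

lemma wt_pos (m n : ℕ) : 0 < wt ς m n := div_pos (pow_pos hP.pos _) (pow_pos hP.pos _)

lemma wt_succ (m n : ℕ) : wt ς m (n + 1) = ς * wt ς m n := by rw [wt, wt, pow_succ]; ring

lemma wt_anti (m : ℕ) {n n' : ℕ} (hn : n ≤ n') : wt ς m n' ≤ wt ς m n := by
  unfold wt
  exact div_le_div_of_nonneg_right (pow_le_pow_of_le_one hP.pos.le hP.lt_one.le hn)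
    (pow_pos hP.pos _).le

/-- Even `C₀` times the width for a simplex is small compared to the width for a face of it. -/
lemma mul_wt_le (m : ℕ) {n n' : ℕ} (hn : n < n') : C₀ * wt ς m n' ≤ wt ς m n / 4 := by
  have h₁ := hP.wt_anti m (Nat.succ_le_of_lt hn)
  rw [Nat.succ_eq_add_one, hP.wt_succ] at h₁
  have h₂ : 0 ≤ C₀ := by linarith [hP.two_le, hP.le]
  nlinarith [mul_le_mul_of_nonneg_left h₁ h₂, hP.mul_le, hP.wt_pos m n]

end Params

/-- A subset of a simplex. -/
def Face.sub (τ : Face K) (s : Finset V) (hs : s ⊆ τ.1) : Face K :=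
  ⟨s, by
    rcases s.eq_empty_or_nonempty with h | h
    · exact Or.inl h
    · refine Or.inr ((K.isRelLowerSet_faces (τ.2.resolve_left fun h' => ?_)).2 hs h)
      rw [h'] at hs
      exact h.ne_empty (Finset.subset_empty.mp hs)⟩

/-- The point `z` of the cone of the link of `σ` lies in the closed normal neighborhood of width
`C * wt` of the simplex that is spanned, together with `σ`, by `τ`. -/
def Near (h : SphereFamily K m) (ς C : ℝ) (σ : Face K) (z : LC m σ) (τ : Face K) : Prop :=
  σ.1 ⊂ τ.1 ∧ supp (cc h σ z) ∪ τ.1 ∈ K ∧ ‖off τ.1 (cc h σ z)‖ ≤ C * wt ς m τ.1.card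

/-- `τ` is a simplex of least dimension with `Near h ς c σ z τ`. -/
def LeastNear (h : SphereFamily K m) (ς c : ℝ) (σ : Face K) (z : LC m σ) (τ : Face K) : Prop :=
  Near h ς c σ z τ ∧ ∀ τ', Near h ς c σ z τ' → τ.1.card ≤ τ'.1.card

variable {h : SphereFamily K m} {ς c C₀ C : ℝ} {σ τ τ' : Face K} {z : LC m σ}

lemma Near.mono {C' : ℝ} (hP : Params ς c C₀) (hC : C ≤ C') (hn : Near h ς C σ z τ) :
    Near h ς C' σ z τ :=
  ⟨hn.1, hn.2.1, hn.2.2.trans (mul_le_mul_of_nonneg_right hC (hP.wt_pos _ _).le)⟩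

lemma Near.of_subset {s : Finset V} (hst : s ⊆ τ.1) (hσs : σ.1 ⊂ s)
    (hK : supp (cc h σ z) ∪ τ.1 ∈ K) (hs : ‖off s (cc h σ z)‖ ≤ C * wt ς m s.card) :
    Near h ς C σ z (τ.sub s hst) := by
  refine ⟨hσs, (K.isRelLowerSet_faces hK).2 (Finset.union_subset_union_right hst) ?_, hs⟩
  exact (Finset.Nonempty.mono Finset.subset_union_right
    (Finset.nonempty_iff_ne_empty.mpr fun h => by
      change s = ∅ at h; rw [h] at hσs; exact absurd hσs (Finset.not_ssubset_empty _)))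

/-- Two simplices near a point outside of the core ball are nested, or the point is also near to
their intersection. -/
lemma near_inter (hP : Params ς c C₀) (hz : wt ς m σ.1.card / 2 ≤ ‖z‖) (hτ : Near h ς C₀ σ z τ)
    (hτ' : Near h ς C₀ σ z τ') (h₁ : ¬ τ.1 ⊆ τ'.1) (h₂ : ¬ τ'.1 ⊆ τ.1) :
    Near h ς 1 σ z (τ.sub (τ.1 ∩ τ'.1) Finset.inter_subset_left) := by
  have hlt : (τ.1 ∩ τ'.1).card < τ.1.card := Finset.card_lt_card
    (Finset.ssubset_iff_subset_ne.mpr ⟨Finset.inter_subset_left, fun h =>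
      h₁ (Finset.inter_eq_left.mp h)⟩)
  have hlt' : (τ.1 ∩ τ'.1).card < τ'.1.card := Finset.card_lt_card
    (Finset.ssubset_iff_subset_ne.mpr ⟨Finset.inter_subset_right, fun h =>
      h₂ (Finset.inter_eq_right.mp h)⟩)
  have hw := hP.wt_pos m (τ.1 ∩ τ'.1).card
  have ht := hτ.2.2.trans (hP.mul_wt_le m hlt)
  have ht' := hτ'.2.2.trans (hP.mul_wt_le m hlt')
  have hlt3 : ‖off (τ.1 ∩ τ'.1) (cc h σ z)‖ < wt ς m (τ.1 ∩ τ'.1).card / 2 := by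
    have := norm_sq_off_inter_le τ.1 τ'.1 (cc h σ z)
    refine lt_of_pow_lt_pow_left₀ 2 (by positivity) ?_
    nlinarith [pow_le_pow_left₀ (norm_nonneg _) ht 2, pow_le_pow_left₀ (norm_nonneg _) ht' 2]
  refine Near.of_subset Finset.inter_subset_left ?_ hτ.2.1 (by linarith)
  refine Finset.ssubset_iff_subset_ne.mpr ⟨Finset.subset_inter hτ.1.1 hτ'.1.1, fun he => ?_⟩
  rw [← he, off_cc, norm_cc] at hlt3
  linarith

/-- A simplex of least dimension near a point is comparable, under inclusion, to all the simplices near it. -/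
lemma LeastNear.subset (hP : Params ς c C₀) (hz : wt ς m σ.1.card / 2 ≤ ‖z‖)
    (hτ : LeastNear h ς c σ z τ) (hτ' : Near h ς C₀ σ z τ') (hsub : ¬ τ'.1 ⊆ τ.1) :
    τ.1 ⊂ τ'.1 := by
  refine Finset.ssubset_iff_subset_ne.mpr ⟨?_, fun h => hsub h.symm.subset⟩
  by_contra h₁
  have h₂ := hτ.2 _ ((near_inter hP hz (hτ.1.mono hP hP.le) hτ' h₁ hsub).mono hP
    (by linarith [hP.two_le]))
  exact absurd h₂ (not_le.mpr (Finset.card_lt_card (Finset.ssubset_iff_subset_ne.mpr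
    ⟨Finset.inter_subset_left, fun h => h₁ (Finset.inter_eq_left.mp h)⟩)))

/-- A quantitative bound from below for the coordinates along `τ` of a point near to `τ` but not
near to its proper faces. -/
lemma le_cc_apply (hP : Params ς c C₀) (hz : wt ς m σ.1.card / 2 ≤ ‖z‖) (hC : 1 / 2 ≤ C)
    (hτ : Near h ς C₀ σ z τ)
    (hmin : ∀ τ', Near h ς C σ z τ' → τ.1.card ≤ τ'.1.card) {v : V} (hv : v ∈ τ.1)
    (hv' : v ∉ σ.1) : wt ς m τ.1.card ≤ cc h σ z v := by
  have hcard : (τ.1.erase v).card < τ.1.card := Finset.card_erase_lt_of_mem hv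
  have hsub : σ.1 ⊆ τ.1.erase v := fun x hx =>
    Finset.mem_erase.mpr ⟨fun h => hv' (h ▸ hx), hτ.1.1 hx⟩
  have hw := hP.wt_pos m (τ.1.erase v).card
  have h₁ : wt ς m (τ.1.erase v).card / 2 ≤ ‖off (τ.1.erase v) (cc h σ z)‖ := by
    by_cases he : σ.1 = τ.1.erase v
    · rwa [← he, off_cc, norm_cc]
    · by_contra hlt
      push Not at hlt
      refine absurd (hmin _ (Near.of_subset (C := C) (Finset.erase_subset v τ.1)
        (Finset.ssubset_iff_subset_ne.mpr ⟨hsub, he⟩) hτ.2.1 ?_)) (not_le.mpr hcard)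
      nlinarith
  have h₂ := hτ.2.2.trans (hP.mul_wt_le m hcard)
  have h₃ := hP.mul_wt_le m hcard
  have h₄ := norm_sq_off_erase hv (cc h σ z)
  have hw' := hP.wt_pos m τ.1.card
  have h₅ : wt ς m τ.1.card ≤ wt ς m (τ.1.erase v).card / 8 := by
    nlinarith [hP.two_le, hP.le]
  refine le_of_sq_le_sq ?_ (cc_nonneg h σ z v)
  nlinarith [pow_le_pow_left₀ (by positivity) h₁ 2, pow_le_pow_left₀ (norm_nonneg _) h₂ 2,
    pow_le_pow_left₀ hw'.le h₅ 2]

/-- A point lies over the open star of each simplex of least dimension near it, so the normal coordinates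
along this simplex are available. -/
lemma LeastNear.mem_starDom (hP : Params ς c C₀) (hz : wt ς m σ.1.card / 2 ≤ ‖z‖)
    (hτ : LeastNear h ς c σ z τ) : z ∈ starDom h σ τ := fun _ hv hv' =>
  (hP.wt_pos _ _).trans_le (le_cc_apply hP hz (by linarith [hP.two_le]) (hτ.1.mono hP hP.le) hτ.2 hv hv')

/-- Such a simplex exists: the carrier of a point has distance `0` from it. -/
lemma exists_leastNear (hP : Params ς c C₀) (hz : z ≠ 0) {C : ℝ} (hC : 0 ≤ C) :
    ∃ τ, Near h ς C σ z τ ∧ ∀ τ', Near h ς C σ z τ' → τ.1.card ≤ τ'.1.card := by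
  have hs := supp_cc_mem h σ hz
  have hex : ∃ τ, Near h ς C σ z τ := by
    refine ⟨⟨supp (cc h σ z) ∪ σ.1, Or.inr hs.2.2⟩, ?_, ?_, ?_⟩
    · refine Finset.ssubset_iff_subset_ne.mpr ⟨Finset.subset_union_right, fun he => ?_⟩
      obtain ⟨v, hv⟩ := hs.1
      have : v ∈ σ.1 := by rw [he]; exact Finset.mem_union_left _ hv
      exact Finset.disjoint_left.mp hs.2.1 hv this
    · simpa [← Finset.union_assoc] using hs.2.2
    · rw [off_eq_zero Finset.subset_union_left, norm_zero]
      exact mul_nonneg hC (hP.wt_pos _ _).le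
  have hfin : Finite (Face K) := inferInstanceAs (Finite {σ : Finset V // σ = ∅ ∨ σ ∈ K})
  obtain ⟨τ, hτ, hmin⟩ := Set.exists_min_image {τ | Near h ς C σ z τ} (fun τ => τ.1.card)
    (Set.toFinite _) hex
  exact ⟨τ, hτ, hmin⟩

lemma near_T2 {C : ℝ} (hστ : σ.1 ⊆ τ.1) (hττ : τ.1 ⊂ τ'.1) (hz : z ∈ starDom h σ τ)
    (hn : supp (cc h σ z) ∪ τ'.1 ∈ K) :
    Near h ς C τ (T2 h σ τ z) τ' ↔ ‖off τ'.1 (cc h σ z)‖ ≤ C * wt ς m τ'.1.card := by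
  rw [Near, cc_T2 h hστ hz, off_off hττ.1]
  refine ⟨fun h => h.2.2, fun h => ⟨hττ, ?_, h⟩⟩
  rw [supp_off]
  have : ∀ s : Finset V, s \ τ.1 ∪ τ'.1 = s ∪ τ'.1 := by
    intro s
    ext v
    simp only [Finset.mem_union, Finset.mem_sdiff]
    constructor
    · rintro (h | h)
      · exact Or.inl h.1
      · exact Or.inr h
    · rintro (h | h)
      · by_cases hv : v ∈ τ.1
        · exact Or.inr (hττ.1 hv)
        · exact Or.inl ⟨h, hv⟩
      · exact Or.inr h
  rw [this]; exact hn

end Near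

/-! ### The smoothed metric in scale-invariant coordinates -/

section Model

variable {V : Type*} [Fintype V] [DecidableEq V] {K : PreAbstractSimplicialComplex V} {m : ℕ}

/-- The difference `arsinh (z / κ) - arsinh (w / κ)`, written so that it makes sense and is smooth
for `κ = 0` as well. -/
def cutArg (κ z w : ℝ) : ℝ :=
  Real.log (z + Real.sqrt (z ^ 2 + κ ^ 2)) - Real.log (w + Real.sqrt (w ^ 2 + κ ^ 2))

open Classical in
/-- Hyperbolic forcing in scale-invariant hyperboloid coordinates, at the scale `w`. -/
def forceB {n : ℕ} (ρ : ℝ → ℝ) (κ w d : ℝ) (P : E n → Bil n) (z : E n) : Bil n :=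
  if z = 0 then Bil.eucl n
  else (1 - ρ (2 * ((cutArg κ ‖z‖ w + d) / d))) • Bil.eucl n +
    ρ (2 * ((cutArg κ ‖z‖ w + d) / d)) •
      ((1 - ρ (2 * cutArg κ ‖z‖ w)) • P ((w / ‖z‖) • z) + ρ (2 * cutArg κ ‖z‖ w) • P z)

lemma forceB_of_eq_one {n : ℕ} {ρ : ℝ → ℝ} {κ w d : ℝ} {P : E n → Bil n} {z : E n} (hz : z ≠ 0)
    (h₁ : ρ (2 * ((cutArg κ ‖z‖ w + d) / d)) = 1) (h₂ : ρ (2 * cutArg κ ‖z‖ w) = 1) :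
    forceB ρ κ w d P z = P z := by
  rw [forceB, if_neg hz, h₁, h₂]; simp

open Classical in
/-- The family of Euclidean-like metrics on the cones of the links which, for `κ = 1 / sinh r`,
describes the smoothed metric in the coordinates `κ • X`, with `X` hyperboloid coordinates.  The
metric with parameter `κ = 0` is the limit for `r → ∞`. -/
def model (h : SphereFamily K m) (ρ : ℝ → ℝ) (ς c : ℝ) (d : ℕ → ℝ) (σ : Face K) (κ : ℝ) :
    LC m σ → Bil (m + 1 - σ.1.card) :=
  if σ.1.card + 1 ≤ m then
    forceB ρ κ (wt ς m σ.1.card) (d (m - σ.1.card + 1)) fun z =>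
      if hp : ∃ τ, LeastNear h ς c σ z τ then
        extB h σ hp.choose z (model h ρ ς c d hp.choose κ (T2 h σ hp.choose z))
      else 0
  else fun _ => Bil.eucl _
termination_by Fintype.card V - σ.1.card
decreasing_by
  have h₁ := Finset.card_lt_card hp.choose_spec.1.1
  have h₂ := Finset.card_le_univ hp.choose.1
  omega

open Classical in
/-- The patched metric to which hyperbolic forcing applies in the definition of `model`. -/
def patB (h : SphereFamily K m) (ρ : ℝ → ℝ) (ς c : ℝ) (d : ℕ → ℝ) (σ : Face K) (κ : ℝ)
    (z : LC m σ) : Bil (m + 1 - σ.1.card) :=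
  if hp : ∃ τ, LeastNear h ς c σ z τ then
    extB h σ hp.choose z (model h ρ ς c d hp.choose κ (T2 h σ hp.choose z))
  else 0

variable {ρ : ℝ → ℝ} {ς c C₀ : ℝ} {d : ℕ → ℝ} {κ : ℝ} {σ τ τ' : Face K}

lemma model_of_le (h : SphereFamily K m) (hσ : σ.1.card + 1 ≤ m) : model h ρ ς c d σ κ =
    forceB ρ κ (wt ς m σ.1.card) (d (m - σ.1.card + 1)) (patB h ρ ς c d σ κ) := by
  rw [model, if_pos hσ]; rfl

lemma model_of_not_le (h : SphereFamily K m) (hσ : ¬ σ.1.card + 1 ≤ m) (z : LC m σ) :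
    model h ρ ς c d σ κ z = Bil.eucl _ := by
  rw [model, if_neg hσ]

lemma patB_eq (h : SphereFamily K m) {z : LC m σ} (hp : ∃ τ, LeastNear h ς c σ z τ) :
    ∃ τ, LeastNear h ς c σ z τ ∧
      patB h ρ ς c d σ κ z = extB h σ τ z (model h ρ ς c d τ κ (T2 h σ τ z)) :=
  ⟨hp.choose, hp.choose_spec, by rw [patB, dif_pos hp]⟩

/-- If the cone of the link of `σ` is a line, then the Euclidean metric is its own extension from the
adjacent simplices of full dimension. -/
lemma eucl_eq_extB (S : SmoothSphere K m) (hσ : m ≤ σ.1.card) (hστ : σ.1 ⊂ τ.1) {z : LC m σ}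
    (hz : z ∈ starDom S.h σ τ) : Bil.eucl _ = extB S.h σ τ z (Bil.eucl _) := by
  obtain ⟨v, hv, hv'⟩ := Finset.exists_of_ssubset hστ
  have hz0 : z ≠ 0 := fun h0 => by
    have := hz v hv hv'
    rw [h0, cc_zero] at this
    exact lt_irrefl _ this
  have hτ : τ.1.card ≤ m + 1 := S.card_le _ (τ.2.resolve_left (Finset.ne_empty_of_mem hv))
  have hlt := Finset.card_lt_card hστ
  have hr : Module.finrank ℝ (LC m σ) = 1 := by
    rw [finrank_euclideanSpace, Fintype.card_fin]; omega
  have hs := (finrank_eq_one_iff_of_nonzero' z hz0).mp hr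
  refine Bil.ext fun a b => ?_
  obtain ⟨s, rfl⟩ := hs a
  obtain ⟨t, rfl⟩ := hs b
  have hg := extB_gauss S hστ.1 hz (β := Bil.eucl _) (fun b => rfl) z
  simp only [Bil.ev_smul_left, Bil.ev_smul_right, hg, Bil.eucl_ev]

lemma cutArg_ge (hw : 0 < C₀) {z : ℝ} (hκ : 2 * |κ| ≤ C₀) (hz : Real.exp 1 * C₀ ≤ z) :
    1 / 2 ≤ cutArg κ z C₀ := by
  have he := Real.exp_one_gt_d9
  have hz0 : 0 < z := by nlinarith
  have h₁ : Real.sqrt (C₀ ^ 2 + κ ^ 2) ≤ C₀ + |κ| := by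
    rw [Real.sqrt_le_left (by positivity)]
    nlinarith [abs_nonneg κ, sq_abs κ]
  have h₂ : z ≤ Real.sqrt (z ^ 2 + κ ^ 2) := Real.le_sqrt_of_sq_le (by nlinarith [sq_nonneg κ])
  have h₃ : Real.exp (1 / 2) ≤ 1.65 := by
    have h : Real.exp (1 / 2) ^ 2 = Real.exp 1 := by rw [← Real.exp_nat_mul]; norm_num
    have := Real.exp_one_lt_d9
    nlinarith [Real.exp_pos (1 / 2 : ℝ)]
  rw [cutArg, ← Real.log_div (by positivity) (by positivity), Real.le_log_iff_exp_le (by positivity),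
    le_div_iff₀ (by positivity)]
  have h₄ : C₀ + Real.sqrt (C₀ ^ 2 + κ ^ 2) ≤ 2.5 * C₀ := by linarith
  nlinarith [Real.sqrt_nonneg (C₀ ^ 2 + κ ^ 2)]

lemma IsCutoff.eq_one (hρ : IsCutoff ρ) {t : ℝ} (ht : 1 ≤ t) : ρ t = 1 := by
  obtain ⟨δ, hδ, -, h₁⟩ := hρ.flat
  exact h₁ t (by linarith)

lemma IsCutoff.eq_zero (hρ : IsCutoff ρ) {t : ℝ} (ht : t ≤ 0) : ρ t = 0 := by
  obtain ⟨δ, hδ, h₀, -⟩ := hρ.flat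
  exact h₀ t (by linarith)

/-- Smallness of `κ` with respect to the widths of the neighborhoods, and a bound from below for the
parameters of hyperbolic forcing. -/
structure Small (K : PreAbstractSimplicialComplex V) (m : ℕ) (ς : ℝ) (d : ℕ → ℝ) (κ : ℝ) :
    Prop where
  one_le : ∀ σ : Face K, σ.1.card + 1 ≤ m → 1 ≤ d (m - σ.1.card + 1)
  lt : ∀ σ : Face K, σ.1.card + 1 ≤ m →
    |κ| < Real.exp (-d (m - σ.1.card + 1)) * wt ς m σ.1.card

lemma Small.two_mul_le (hP : Params ς c C₀) (hS : Small K m ς d κ) (hσ : σ.1.card + 1 ≤ m) :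
    2 * |κ| ≤ wt ς m σ.1.card := by
  have h₁ := hS.lt σ hσ
  have h₂ : Real.exp (-d (m - σ.1.card + 1)) ≤ 1 / 2 := by
    rw [Real.exp_neg, one_div]
    refine inv_anti₀ two_pos ?_
    linarith [Real.exp_le_exp.mpr (hS.one_le σ hσ), Real.exp_one_gt_d9]
  nlinarith [hP.wt_pos m σ.1.card]

/-- Hyperbolic forcing does not change the metric outside of the core ball, by a factor `e` in the radius. -/
lemma model_eq_patB (h : SphereFamily K m) (hρ : IsCutoff ρ) (hP : Params ς c C₀)
    (hS : Small K m ς d κ) (hσ : σ.1.card + 1 ≤ m) {z : LC m σ}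
    (hz : Real.exp 1 * wt ς m σ.1.card ≤ ‖z‖) :
    model h ρ ς c d σ κ z = patB h ρ ς c d σ κ z := by
  have hw := hP.wt_pos m σ.1.card
  have h₁ := cutArg_ge hw (hS.two_mul_le hP hσ) hz
  have hz0 : z ≠ 0 := fun h => by
    rw [h, norm_zero] at hz
    nlinarith [Real.exp_pos 1]
  have hd : 0 < d (m - σ.1.card + 1) := by linarith [hS.one_le σ hσ]
  have h₂ : 1 ≤ 2 * ((cutArg κ ‖z‖ (wt ς m σ.1.card) + d (m - σ.1.card + 1)) /
      d (m - σ.1.card + 1)) := by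
    rw [← mul_div_assoc, le_div_iff₀ hd]; linarith
  rw [model_of_le h hσ]
  exact forceB_of_eq_one hz0 (hρ.eq_one h₂) (hρ.eq_one (by linarith))

/-- Outside of the cores of the neighborhoods of the faces between `σ` and `τ`, the patched metric
and the smoothed metric are extensions along `τ`.  The metric `patB` is by definition an extension
along some simplex `τ₀` of least dimension near the point; `τ₀` and `τ` are nested, so the claim for
the cone of the link of the smaller of the two, which has fewer vertices, shows that the extensions
along `τ₀` and `τ` agree. -/
lemma eq_extB (S : SmoothSphere K m) (hρ : IsCutoff ρ) (hP : Params ς c C₀)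
    (hS : Small K m ς d κ) (n : ℕ) : ∀ (σ : Face K), Fintype.card V - σ.1.card ≤ n →
    ∀ (τ : Face K) (z : LC m σ), z ∈ starDom S.h σ τ → Near S.h ς C₀ σ z τ →
    (∀ τ' : Face K, τ'.1 ⊂ τ.1 → τ'.1.card + 1 ≤ m → ¬ Near S.h ς (Real.exp 1) σ z τ') →
    (wt ς m σ.1.card / 2 ≤ ‖z‖ → patB S.h ρ ς c d σ κ z =
      extB S.h σ τ z (model S.h ρ ς c d τ κ (T2 S.h σ τ z))) ∧
    ((σ.1.card + 1 ≤ m → Real.exp 1 * wt ς m σ.1.card ≤ ‖z‖) → model S.h ρ ς c d σ κ z =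
      extB S.h σ τ z (model S.h ρ ς c d τ κ (T2 S.h σ τ z))) := by
  have he := Real.exp_one_gt_d9
  induction n with
  | zero =>
    intro σ hσ τ z hz hn
    have h₁ := Finset.card_lt_card hn.1
    have h₂ := Finset.card_le_univ τ.1
    omega
  | succ n ih =>
    intro σ hσ τ z hz hn hmin
    have hcard := Finset.card_lt_card hn.1
    have hcard' := Finset.card_le_univ τ.1
    have hpat : wt ς m σ.1.card / 2 ≤ ‖z‖ → patB S.h ρ ς c d σ κ z =
        extB S.h σ τ z (model S.h ρ ς c d τ κ (T2 S.h σ τ z)) := by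
      intro hzw
      have hz0 : z ≠ 0 := fun h => by
        rw [h, norm_zero] at hzw; linarith [hP.wt_pos m σ.1.card]
      obtain ⟨τ₀, hτ₀, heq⟩ := patB_eq (ρ := ρ) (d := d) (κ := κ) S.h
        (exists_leastNear (h := S.h) (σ := σ) hP hz0 (C := c) (by linarith [hP.two_le]))
      have hz₀ := hτ₀.mem_starDom hP hzw
      rw [heq]
      have hc₀ := Finset.card_lt_card hτ₀.1.1
      by_cases hsub : τ.1 ⊆ τ₀.1
      · rcases hsub.eq_or_ssubset with he' | hss
        · have : τ = τ₀ := Subtype.ext he'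
          rw [this]
        · -- `τ` is a proper face of `τ₀`, and the point is not near to `τ`
          have hnot : ¬ Near S.h ς c σ z τ := fun hc =>
            absurd (hτ₀.2 _ hc) (not_le.mpr (Finset.card_lt_card hss))
          have hfar : c * wt ς m τ.1.card ≤ ‖T2 S.h σ τ z‖ := by
            rw [norm_T2 S.h hn.1.1 hz]
            by_contra hlt
            push Not at hlt
            exact hnot ⟨hn.1, hn.2.1, hlt.le⟩
          have key := (ih τ (by omega) τ₀ (T2 S.h σ τ z) (T2_mem_starDom S.h hn.1.1 hss.1 hz₀)
            ((near_T2 hn.1.1 hss hz hτ₀.1.2.1).mpr (hτ₀.1.mono hP hP.le).2.2) ?_).2 ?_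
          · rw [key, extB_extB S hn.1.1 hss.1 hz₀]
            congr 2
            exact (T2_T2 S.h hn.1.1 hss.1 hz).symm
          · intro τ' hτ' _ hne
            have hK : supp (cc S.h σ z) ∪ τ'.1 ∈ K :=
              (K.isRelLowerSet_faces hτ₀.1.2.1).2 (Finset.union_subset_union_right hτ'.1)
                ((supp_cc_mem S.h σ hz0).1.mono Finset.subset_union_left)
            have h₁ := (near_T2 hn.1.1 hne.1 hz hK).mp hne
            exact absurd (hτ₀.2 τ' (Near.mono (C := Real.exp 1) hP hP.exp_le
              ⟨hn.1.trans hne.1, hK, h₁⟩))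
              (not_le.mpr (Finset.card_lt_card hτ'))
          · intro _
            exact (mul_le_mul_of_nonneg_right hP.exp_le (hP.wt_pos _ _).le).trans hfar
      · -- `τ₀` is a proper face of `τ`
        have hss := hτ₀.subset hP hzw hn hsub
        have key := (ih τ₀ (by have := Finset.card_lt_card hss; omega) τ (T2 S.h σ τ₀ z)
          (T2_mem_starDom S.h hτ₀.1.1.1 hss.1 hz)
          ((near_T2 hτ₀.1.1.1 hss hz₀ hn.2.1).mpr hn.2.2) ?_).2 ?_
        · rw [key, extB_extB S hτ₀.1.1.1 hss.1 hz]
          congr 2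
          exact T2_T2 S.h hτ₀.1.1.1 hss.1 hz₀
        · intro τ' hτ' hm hne
          have hK : supp (cc S.h σ z) ∪ τ'.1 ∈ K :=
            (K.isRelLowerSet_faces hn.2.1).2 (Finset.union_subset_union_right hτ'.1)
              ((supp_cc_mem S.h σ hz0).1.mono Finset.subset_union_left)
          exact hmin τ' hτ' hm ⟨hτ₀.1.1.trans hne.1, hK,
            (near_T2 hτ₀.1.1.1 hne.1 hz₀ hK).mp hne⟩
        · intro hm
          rw [norm_T2 S.h hτ₀.1.1.1 hz₀]
          by_contra hlt
          push Not at hlt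
          exact hmin τ₀ hss hm ⟨hτ₀.1.1, hτ₀.1.2.1, hlt.le⟩
    refine ⟨hpat, fun hfar => ?_⟩
    by_cases hm : σ.1.card + 1 ≤ m
    · rw [model_eq_patB S.h hρ hP hS hm (hfar hm)]
      refine hpat ?_
      have := hfar hm
      nlinarith [hP.wt_pos m σ.1.card]
    · rw [model_of_not_le S.h hm, model_of_not_le S.h (by omega), ← eucl_eq_extB S (by omega) hn.1 hz]

end Model

/-! ### Regularity of the scale-invariant model -/

section Regularity

variable {V : Type*} [Fintype V] [DecidableEq V] {K : PreAbstractSimplicialComplex V} {m : ℕ}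
  {ρ : ℝ → ℝ} {ς c C₀ : ℝ} {d : ℕ → ℝ} {κ : ℝ}

instance : Finite (Face K) := inferInstanceAs (Finite {σ : Finset V // σ = ∅ ∨ σ ∈ K})

/-- `β` is a scalar product for which the radial vector `z` is a unit normal of the spheres, up to
the factor `‖z‖`. -/
structure IsConeMetric {n : ℕ} (z : E n) (β : Bil n) : Prop where
  symm : ∀ a b, β a b = β b a
  gauss : ∀ b, β z b = inner ℝ z b
  pos : ∀ a, a ≠ 0 → 0 < β a a

lemma isConeMetric_eucl {n : ℕ} (z : E n) : IsConeMetric z (Bil.eucl n) where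
  symm a b := real_inner_comm b a
  gauss b := rfl
  pos a ha := by
    rw [Bil.eucl_ev, real_inner_self_eq_norm_sq]; exact pow_pos (norm_pos_iff.mpr ha) 2

lemma IsConeMetric.extB (S : SmoothSphere K m) {σ τ : Face K} (hστ : σ.1 ⊆ τ.1) {z : LC m σ}
    (hz : z ∈ starDom S.h σ τ) {β : Bil (m + 1 - τ.1.card)}
    (hβ : IsConeMetric (T2 S.h σ τ z) β) : IsConeMetric z (extB S.h σ τ z β) where
  symm a b := by rw [extB_ev, extB_ev, real_inner_comm, hβ.symm]
  gauss b := extB_gauss S hστ hz hβ.gauss b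
  pos a ha := extB_pos S hστ hz hβ.pos ha

lemma IsConeMetric.smul {n : ℕ} {z : E n} {β : Bil n} {s : ℝ} (hs : s ≠ 0)
    (h : IsConeMetric (s • z) β) : IsConeMetric z β where
  symm := h.symm
  gauss b := by
    have := h.gauss b
    rw [Bil.ev_smul_left, real_inner_smul_left] at this
    exact mul_left_cancel₀ hs this
  pos := h.pos

/-- A convex combination; the second form need not be a cone metric where its weight vanishes, as in the
cut-offs of hyperbolic forcing. -/
lemma IsConeMetric.convex {n : ℕ} {z : E n} {β γ : Bil n} {s : ℝ} (h0 : 0 ≤ s) (h1 : s ≤ 1)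
    (hβ : IsConeMetric z β) (hγ : s ≠ 0 → IsConeMetric z γ) :
    IsConeMetric z ((1 - s) • β + s • γ) := by
  by_cases hs : s = 0
  · subst hs
    have : (1 - (0 : ℝ)) • β + (0 : ℝ) • γ = β := by simp
    rwa [this]
  have hγ := hγ hs
  have hs0 : 0 < s := lt_of_le_of_ne h0 (Ne.symm hs)
  refine ⟨fun a b => ?_, fun b => ?_, fun a ha => ?_⟩
  · simp only [Bil.add_ev, Bil.smul_ev, hβ.symm a b, hγ.symm a b]
  · simp only [Bil.add_ev, Bil.smul_ev, hβ.gauss b, hγ.gauss b]; ring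
  · simp only [Bil.add_ev, Bil.smul_ev]
    have h₁ := hβ.pos a ha
    have h₂ := hγ.pos a ha
    nlinarith [mul_nonneg (sub_nonneg.mpr h1) h₁.le, mul_pos hs0 h₂]

lemma cutArg_nonpos {κ z w : ℝ} (hz : 0 < z) (hzw : z ≤ w) : cutArg κ z w ≤ 0 := by
  rw [cutArg, sub_nonpos]
  refine Real.log_le_log (by positivity) (add_le_add hzw (Real.sqrt_le_sqrt ?_))
  nlinarith

lemma isConeMetric_forceB {n : ℕ} (hρ : IsCutoff ρ) {w d : ℝ} (hw : 0 < w) {P : E n → Bil n}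
    (hP : ∀ z, w ≤ ‖z‖ → IsConeMetric z (P z)) (z : E n) :
    IsConeMetric z (forceB ρ κ w d P z) := by
  by_cases hz : z = 0
  · rw [forceB, if_pos hz]; exact isConeMetric_eucl z
  have hn : 0 < ‖z‖ := norm_pos_iff.mpr hz
  rw [forceB, if_neg hz]
  refine (isConeMetric_eucl z).convex (hρ.mem_Icc _).1 (hρ.mem_Icc _).2 fun _ => ?_
  refine IsConeMetric.convex (hρ.mem_Icc _).1 (hρ.mem_Icc _).2 ?_ fun h => ?_
  · refine IsConeMetric.smul (div_pos hw hn).ne' (hP _ ?_)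
    rw [norm_smul, Real.norm_of_nonneg (div_pos hw hn).le, div_mul_cancel₀ _ hn.ne']
  · refine hP z ?_
    by_contra hlt
    push Not at hlt
    refine h (hρ.eq_zero ?_)
    linarith [cutArg_nonpos (κ := κ) hn hlt.le]

lemma isConeMetric_patB (S : SmoothSphere K m) (hP : Params ς c C₀) {σ : Face K}
    (ih : ∀ τ : Face K, σ.1 ⊂ τ.1 → ∀ z, IsConeMetric z (model S.h ρ ς c d τ κ z)) {z : LC m σ}
    (hz : wt ς m σ.1.card / 2 ≤ ‖z‖) : IsConeMetric z (patB S.h ρ ς c d σ κ z) := by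
  have hz0 : z ≠ 0 := fun h => by rw [h, norm_zero] at hz; linarith [hP.wt_pos m σ.1.card]
  obtain ⟨τ, hτ, heq⟩ := patB_eq (ρ := ρ) (d := d) (κ := κ) S.h
    (exists_leastNear (h := S.h) (σ := σ) hP hz0 (C := c) (by linarith [hP.two_le]))
  rw [heq]
  exact (ih τ hτ.1.1 _).extB S hτ.1.1.1 (hτ.mem_starDom hP hz)

/-- The members of the model are scalar products with the radial structure of the cone: extensions and
convex combinations, of which they are composed, keep this. -/
theorem isConeMetric_model (S : SmoothSphere K m) (hρ : IsCutoff ρ) (hP : Params ς c C₀) (n : ℕ) :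
    ∀ (σ : Face K), Fintype.card V - σ.1.card < n → ∀ z,
      IsConeMetric z (model S.h ρ ς c d σ κ z) := by
  induction n with
  | zero => intro σ hσ; omega
  | succ n ih =>
    intro σ hσ z
    by_cases hm : σ.1.card + 1 ≤ m
    · have hw := hP.wt_pos m σ.1.card
      rw [model_of_le S.h hm]
      refine isConeMetric_forceB hρ hw (fun z hz => ?_) z
      refine isConeMetric_patB S hP (fun τ hτ => ih τ ?_) (by linarith)
      have h₁ := Finset.card_lt_card hτ
      have h₂ := Finset.card_le_univ τ.1
      omega
    · rw [model_of_not_le S.h hm]; exact isConeMetric_eucl z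

lemma contDiffAt_extB (S : SmoothSphere K m) {σ τ : Face K} (hστ : σ.1 ⊆ τ.1) {z : LC m σ}
    (hz : z ∈ starDom S.h σ τ) {F : ℝ → LC m τ → Bil (m + 1 - τ.1.card)}
    (hF : ContDiffAt ℝ ∞ (fun p : ℝ × LC m τ => F p.1 p.2) (κ, T2 S.h σ τ z)) :
    ContDiffAt ℝ ∞ (fun p : ℝ × LC m σ => extB S.h σ τ p.2 (F p.1 (T2 S.h σ τ p.2))) (κ, z) := by
  refine Bil.contDiffAt_of_ev fun a b => ?_
  simp only [extB_ev]
  have h₁ : ContDiffAt ℝ ∞ (fun p : ℝ × LC m σ => D1 S.h σ τ p.2) (κ, z) :=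
    (contDiffAt_D1 S hστ hz).comp (κ, z) contDiffAt_snd
  have h₂ : ContDiffAt ℝ ∞ (fun p : ℝ × LC m σ => D2 S.h σ τ p.2) (κ, z) :=
    (contDiffAt_D2 S hστ hz).comp (κ, z) contDiffAt_snd
  have h₃ : ContDiffAt ℝ ∞ (fun p : ℝ × LC m σ => T2 S.h σ τ p.2) (κ, z) :=
    ContDiffAt.comp (κ, z) (g := T2 S.h σ τ) (f := Prod.snd) (contDiffAt_T2 S hστ hz) contDiffAt_snd
  refine ((h₁.clm_apply contDiffAt_const).inner ℝ (h₁.clm_apply contDiffAt_const)).add ?_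
  refine Bil.contDiffAt_ev ?_ (h₂.clm_apply contDiffAt_const) (h₂.clm_apply contDiffAt_const)
  exact ContDiffAt.comp (κ, z) (g := fun p : ℝ × LC m τ => F p.1 p.2)
    (f := fun p : ℝ × LC m σ => (p.1, T2 S.h σ τ p.2)) hF (contDiffAt_fst.prodMk h₃)

lemma Small.eventually (hS : Small K m ς d κ) : ∀ᶠ κ' in nhds κ, Small K m ς d κ' := by
  have h : ∀ᶠ κ' in nhds κ, ∀ σ : Face K, σ.1.card + 1 ≤ m →
      |κ'| < Real.exp (-d (m - σ.1.card + 1)) * wt ς m σ.1.card := by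
    refine Filter.eventually_all.mpr fun σ => ?_
    by_cases hm : σ.1.card + 1 ≤ m
    · filter_upwards [continuous_abs.continuousAt.eventually_lt continuousAt_const (hS.lt σ hm)]
        with κ' hκ' using fun _ => hκ'
    · exact Filter.Eventually.of_forall fun _ h => absurd h hm
  filter_upwards [h] with κ' hκ' using ⟨hS.one_le, hκ'⟩

/-- Locally, the patched metric is an extension along a fixed simplex. -/
lemma eventually_patB_eq (S : SmoothSphere K m) (hρ : IsCutoff ρ) (hP : Params ς c C₀)
    (hS : Small K m ς d κ) {σ : Face K} {z : LC m σ} (hz : wt ς m σ.1.card / 2 < ‖z‖) :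
    ∃ τ, LeastNear S.h ς c σ z τ ∧ ∀ᶠ p : ℝ × LC m σ in nhds (κ, z),
      patB S.h ρ ς c d σ p.1 p.2 = extB S.h σ τ p.2 (model S.h ρ ς c d τ p.1 (T2 S.h σ τ p.2)) := by
  have hz0 : z ≠ 0 := fun h => by rw [h, norm_zero] at hz; linarith [hP.wt_pos m σ.1.card]
  obtain ⟨τ, hτ⟩ := exists_leastNear (h := S.h) (σ := σ) hP hz0 (C := c) (by linarith [hP.two_le])
  have hτ : LeastNear S.h ς c σ z τ := hτ
  have hzτ := hτ.mem_starDom hP hz.le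
  refine ⟨τ, hτ, ?_⟩
  have hoff : ∀ s : Finset V, Continuous fun z : LC m σ => ‖off s (cc S.h σ z)‖ := fun s =>
    ((offL s).continuous.comp (continuous_cc S.h σ)).norm
  have h₁ : ∀ᶠ y in nhds z, y ∈ starDom S.h σ τ := (isOpen_starDom S.h σ τ).mem_nhds hzτ
  have h₂ : ∀ᶠ y in nhds z, ‖off τ.1 (cc S.h σ y)‖ < C₀ * wt ς m τ.1.card := by
    refine (hoff τ.1).continuousAt.eventually_lt continuousAt_const (hτ.1.2.2.trans_lt ?_)
    exact mul_lt_mul_of_pos_right hP.lt (hP.wt_pos _ _)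
  have h₃ : ∀ᶠ y in nhds z, ∀ τ' : Face K, τ'.1 ⊂ τ.1 → ¬ Near S.h ς (Real.exp 1) σ y τ' := by
    refine Filter.eventually_all.mpr fun τ' => ?_
    by_cases hss : τ'.1 ⊂ τ.1
    · by_cases hσ : σ.1 ⊂ τ'.1
      · have hK : supp (cc S.h σ z) ∪ τ'.1 ∈ K := (K.isRelLowerSet_faces hτ.1.2.1).2
          (Finset.union_subset_union_right hss.1)
          ((supp_cc_mem S.h σ hz0).1.mono Finset.subset_union_left)
        have hlt : Real.exp 1 * wt ς m τ'.1.card < ‖off τ'.1 (cc S.h σ z)‖ := by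
          by_contra hle
          push Not at hle
          refine absurd (hτ.2 τ' ⟨hσ, hK, hle.trans ?_⟩) (not_le.mpr (Finset.card_lt_card hss))
          exact mul_le_mul_of_nonneg_right hP.exp_le (hP.wt_pos _ _).le
        filter_upwards [continuousAt_const.eventually_lt (hoff τ'.1).continuousAt hlt]
          with y hy _ hn using absurd hn.2.2 (not_le.mpr hy)
      · exact Filter.Eventually.of_forall fun y _ hn => hσ hn.1
    · exact Filter.Eventually.of_forall fun y h => absurd h hss
  have h₄ : ∀ᶠ y in nhds z, wt ς m σ.1.card / 2 < ‖y‖ :=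
    continuousAt_const.eventually_lt continuous_norm.continuousAt hz
  have h₅ := (h₁.and (h₂.and (h₃.and h₄)))
  rw [nhds_prod_eq]
  filter_upwards [Filter.prod_mem_prod hS.eventually h₅] with p hp
  obtain ⟨hp₀, hp₁, hp₂, hp₃, hp₄⟩ := hp
  refine (eq_extB S hρ hP hp₀ _ σ le_rfl τ p.2 hp₁ ⟨hτ.1.1, ?_, hp₂.le⟩
    fun τ' hτ' _ => hp₃ τ' hτ').1 hp₄.le
  exact supp_union_mem_of_starDom S.h hτ.1.1.1 hp₁ fun h => by
    rw [h, norm_zero] at hp₄; linarith [hP.wt_pos m σ.1.card]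

lemma contDiffAt_cutArg {n : ℕ} {z : E n} (hz : z ≠ 0) {w : ℝ} (hw : 0 < w) :
    ContDiffAt ℝ ∞ (fun p : ℝ × E n => cutArg p.1 ‖p.2‖ w) (κ, z) := by
  have hn : 0 < ‖z‖ := norm_pos_iff.mpr hz
  have h₁ : ContDiffAt ℝ ∞ (fun p : ℝ × E n => ‖p.2‖) (κ, z) :=
    ContDiffAt.norm ℝ contDiffAt_snd hz
  have h₂ : ContDiffAt ℝ ∞ (fun p : ℝ × E n => p.1 ^ 2) (κ, z) := contDiffAt_fst.pow 2
  unfold cutArg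
  refine ContDiffAt.sub (ContDiffAt.log (h₁.add (ContDiffAt.sqrt ((h₁.pow 2).add h₂) ?_)) ?_)
    (ContDiffAt.log (contDiffAt_const.add (ContDiffAt.sqrt (contDiffAt_const.add h₂) ?_)) ?_)
  all_goals dsimp only; positivity

/-- The model is smooth in the parameter and the point jointly, also for `κ = 0` and at the origin. -/
theorem contDiffAt_model (S : SmoothSphere K m) (hρ : IsCutoff ρ) (hP : Params ς c C₀) (n : ℕ) :
    ∀ (σ : Face K), Fintype.card V - σ.1.card < n → ∀ κ, Small K m ς d κ → ∀ z : LC m σ,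
      ContDiffAt ℝ ∞ (fun p : ℝ × LC m σ => model S.h ρ ς c d σ p.1 p.2) (κ, z) := by
  induction n with
  | zero => intro σ hσ; omega
  | succ n ih =>
    intro σ hσ κ hS z
    by_cases hm : σ.1.card + 1 ≤ m
    swap
    · simp only [model_of_not_le S.h hm]; exact contDiffAt_const
    have hw := hP.wt_pos m σ.1.card
    set w := wt ς m σ.1.card with hw_def
    have hpat : ∀ z : LC m σ, w / 2 < ‖z‖ →
        ContDiffAt ℝ ∞ (fun p : ℝ × LC m σ => patB S.h ρ ς c d σ p.1 p.2) (κ, z) := by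
      intro z hz
      obtain ⟨τ, hτ, hev⟩ := eventually_patB_eq S hρ hP hS hz
      refine ContDiffAt.congr_of_eventuallyEq ?_ hev
      refine contDiffAt_extB S hτ.1.1.1 (hτ.mem_starDom hP hz.le) (ih τ ?_ κ hS _)
      have h₁ := Finset.card_lt_card hτ.1.1
      have h₂ := Finset.card_le_univ τ.1
      omega
    set D := d (m - σ.1.card + 1) with hD
    have hD1 : 1 ≤ D := hS.one_le σ hm
    have hρs : ContDiff ℝ ∞ ρ := hρ.smooth
    simp only [model_of_le S.h hm]
    by_cases hsmall : ‖z‖ + √(‖z‖ ^ 2 + κ ^ 2) < Real.exp (-D) * (w + √(w ^ 2 + κ ^ 2))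
    · -- the Euclidean metric near the origin
      have hev : ∀ᶠ p : ℝ × LC m σ in nhds (κ, z),
          ‖p.2‖ + √(‖p.2‖ ^ 2 + p.1 ^ 2) < Real.exp (-D) * (w + √(w ^ 2 + p.1 ^ 2)) := by
        refine ContinuousAt.eventually_lt (Continuous.continuousAt ?_)
          (Continuous.continuousAt ?_) hsmall <;> fun_prop
      refine (contDiffAt_const (c := Bil.eucl _)).congr_of_eventuallyEq ?_
      filter_upwards [hev] with p hp
      unfold forceB
      by_cases hp0 : p.2 = 0
      · rw [if_pos hp0]
      have hpn : 0 < ‖p.2‖ := norm_pos_iff.mpr hp0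
      rw [if_neg hp0, hρ.eq_zero (t := 2 * ((cutArg p.1 ‖p.2‖ w + D) / D))]
      · simp
      · have h₁ : cutArg p.1 ‖p.2‖ w ≤ -D := by
          rw [cutArg, sub_le_iff_le_add, ← Real.log_exp (-D), ← Real.log_mul (by positivity)
            (by positivity)]
          exact Real.log_le_log (by positivity) hp.le
        have h₂ : (cutArg p.1 ‖p.2‖ w + D) / D ≤ 0 :=
          div_nonpos_of_nonpos_of_nonneg (by linarith) (by linarith)
        linarith
    -- `Small` says that the origin lies in the Euclidean region
    have hz : z ≠ 0 := by
      rintro rfl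
      refine hsmall ?_
      rw [norm_zero, zero_add, zero_pow two_ne_zero, zero_add, Real.sqrt_sq_eq_abs]
      have h₁ := hS.lt σ hm
      have h₂ : w ≤ √(w ^ 2 + κ ^ 2) := Real.le_sqrt_of_sq_le (by nlinarith [sq_nonneg κ])
      nlinarith [Real.exp_pos (-D)]
    have hn : 0 < ‖z‖ := norm_pos_iff.mpr hz
    have hcut : ContDiffAt ℝ ∞ (fun p : ℝ × LC m σ => cutArg p.1 ‖p.2‖ w) (κ, z) :=
      contDiffAt_cutArg hz hw
    have hne : ∀ᶠ p : ℝ × LC m σ in nhds (κ, z), p.2 ≠ 0 :=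
      continuousAt_snd.eventually_ne hz
    have hχ : ContDiffAt ℝ ∞
        (fun p : ℝ × LC m σ => ρ (2 * ((cutArg p.1 ‖p.2‖ w + D) / D))) (κ, z) :=
      hρs.contDiffAt.comp (κ, z)
        (contDiffAt_const.mul ((hcut.add contDiffAt_const).div_const D))
    have hψ : ContDiffAt ℝ ∞ (fun p : ℝ × LC m σ => ρ (2 * cutArg p.1 ‖p.2‖ w)) (κ, z) :=
      hρs.contDiffAt.comp (κ, z) (contDiffAt_const.mul hcut)
    have hproj : ContDiffAt ℝ ∞
        (fun p : ℝ × LC m σ => patB S.h ρ ς c d σ p.1 ((w / ‖p.2‖) • p.2)) (κ, z) := by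
      have h₁ : ContDiffAt ℝ ∞ (fun p : ℝ × LC m σ => (p.1, (w / ‖p.2‖) • p.2)) (κ, z) :=
        contDiffAt_fst.prodMk ((contDiffAt_const.div (ContDiffAt.norm ℝ contDiffAt_snd hz)
          hn.ne').smul contDiffAt_snd)
      refine ContDiffAt.comp (κ, z) (g := fun p : ℝ × LC m σ => patB S.h ρ ς c d σ p.1 p.2)
        (f := fun p : ℝ × LC m σ => (p.1, (w / ‖p.2‖) • p.2)) (hpat _ ?_) h₁
      rw [norm_smul, Real.norm_of_nonneg (by positivity), div_mul_cancel₀ _ hn.ne']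
      linarith
    -- inside the ball of radius `w`, where `patB` need not be smooth, only its values on the sphere of
    -- radius `w` occur
    by_cases hzw : ‖z‖ < w
    · have hev : ∀ᶠ p : ℝ × LC m σ in nhds (κ, z), ‖p.2‖ < w :=
        continuousAt_snd.norm.eventually_lt continuousAt_const hzw
      refine ContDiffAt.congr_of_eventuallyEq (f := fun p : ℝ × LC m σ =>
        (1 - ρ (2 * ((cutArg p.1 ‖p.2‖ w + D) / D))) • Bil.eucl _ +
          ρ (2 * ((cutArg p.1 ‖p.2‖ w + D) / D)) •
            patB S.h ρ ς c d σ p.1 ((w / ‖p.2‖) • p.2)) ?_ ?_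
      · exact ((contDiffAt_const.sub hχ).smul contDiffAt_const).add (hχ.smul hproj)
      · filter_upwards [hev, hne] with p hp hp0
        have hpn : 0 < ‖p.2‖ := norm_pos_iff.mpr hp0
        rw [forceB, if_neg hp0, hρ.eq_zero (t := 2 * cutArg p.1 ‖p.2‖ w)
          (by linarith [cutArg_nonpos (κ := p.1) hpn hp.le])]
        simp only [sub_zero, one_smul, zero_smul, add_zero]
        rfl
    · -- outside, all terms of the forcing are smooth
      refine ContDiffAt.congr_of_eventuallyEq (f := fun p : ℝ × LC m σ =>
        (1 - ρ (2 * ((cutArg p.1 ‖p.2‖ w + D) / D))) • Bil.eucl _ +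
          ρ (2 * ((cutArg p.1 ‖p.2‖ w + D) / D)) •
            ((1 - ρ (2 * cutArg p.1 ‖p.2‖ w)) • patB S.h ρ ς c d σ p.1 ((w / ‖p.2‖) • p.2) +
              ρ (2 * cutArg p.1 ‖p.2‖ w) • patB S.h ρ ς c d σ p.1 p.2)) ?_ ?_
      · exact ((contDiffAt_const.sub hχ).smul contDiffAt_const).add (hχ.smul
          (((contDiffAt_const.sub hψ).smul hproj).add (hψ.smul (hpat z (by linarith)))))
      · filter_upwards [hne] with p hp0
        rw [forceB, if_neg hp0]

end Regularity

/-! ### Radial rescaling between polar and hyperboloid coordinates -/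

section Radial

variable {X : Type*} [NormedAddCommGroup X] [InnerProductSpace ℝ X]

/-- `(f ‖x‖ / ‖x‖) x`, the change of the radial coordinate by `f`. -/
def rescale (f : ℝ → ℝ) (x : X) : X := (f ‖x‖ / ‖x‖) • x

/-- The linear map that multiplies vectors orthogonal to `x` by `u` and `x` by `v`. -/
def radialMap (x : X) (u v : ℝ) : X →L[ℝ] X :=
  u • ContinuousLinearMap.id ℝ X + ((v - u) / ‖x‖ ^ 2) • (innerB X x).smulRight x

@[simp] lemma innerB_apply (x y : X) : innerB X x y = inner ℝ x y := rfl

lemma radialMap_apply (x : X) (u v : ℝ) (a : X) :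
    radialMap x u v a = u • a + ((v - u) / ‖x‖ ^ 2 * inner ℝ x a) • x := by
  simp [radialMap, smul_smul]

lemma norm_rescale {f : ℝ → ℝ} {x : X} (hf0 : f 0 = 0) (hf : 0 ≤ f ‖x‖) :
    ‖rescale f x‖ = f ‖x‖ := by
  by_cases hx : x = 0
  · simp [rescale, hx, hf0]
  · have : 0 < ‖x‖ := norm_pos_iff.mpr hx
    rw [rescale, norm_smul, Real.norm_of_nonneg (by positivity), div_mul_cancel₀ _ this.ne']

lemma rescale_smul (f : ℝ → ℝ) {s : ℝ} (hs : 0 < s) (x : X) :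
    rescale f (s • x) = (f (s * ‖x‖) / ‖x‖) • x := by
  rw [rescale, norm_smul, Real.norm_of_nonneg hs.le, smul_smul]
  congr 1; field_simp

lemma hasFDerivAt_rescale {f : ℝ → ℝ} {f' : ℝ} {x : X} (hx : x ≠ 0) (hf : HasDerivAt f f' ‖x‖) :
    HasFDerivAt (rescale f) (radialMap x (f ‖x‖ / ‖x‖) f') x := by
  have hn : ‖x‖ ≠ 0 := norm_ne_zero_iff.mpr hx
  have h₁ : HasFDerivAt (fun x : X => ‖x‖) (‖x‖⁻¹ • innerB X x) x := by
    have h := ((hasFDerivAt_id x).norm_sq).sqrt (by simpa using hx)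
    simp only [id, Real.sqrt_sq (norm_nonneg _)] at h
    refine h.congr_fderiv ?_
    ext a
    simp
    field_simp
  have h₂ := ((hf.div (hasDerivAt_id ‖x‖) hn).comp_hasFDerivAt x h₁).smul (hasFDerivAt_id x)
  refine h₂.congr_fderiv ?_
  ext1 a
  rw [radialMap_apply]
  simp [smul_smul]
  congr 1
  field_simp

lemma hasFDerivAt_rescale_zero {f : ℝ → ℝ} (hf0 : f 0 = 0) (hf : HasDerivAt f 1 0) :
    HasFDerivAt (rescale f : X → X) (ContinuousLinearMap.id ℝ X) 0 := by
  rw [hasFDerivAt_iff_isLittleO_nhds_zero]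
  have h₁ := hasDerivAt_iff_isLittleO_nhds_zero.mp hf
  simp only [zero_add, hf0, sub_zero, smul_eq_mul, mul_one] at h₁
  have h₂ := (h₁.comp_tendsto (k := fun x : X => ‖x‖) (by
    simpa using (continuous_norm (E := X)).tendsto 0)).norm_right
  simp only [Function.comp_def, norm_norm] at h₂
  refine (Asymptotics.IsLittleO.of_norm_left (h₂.norm_left.congr_left fun x => ?_)).of_norm_right
  by_cases hx : x = 0
  · simp [hx, hf0, rescale]
  · have hn : ‖x‖ ≠ 0 := norm_ne_zero_iff.mpr hx
    have : rescale f (0 + x) - rescale f 0 - ContinuousLinearMap.id ℝ X x =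
        ((f ‖x‖ - ‖x‖) / ‖x‖) • x := by
      rw [zero_add, rescale, rescale, smul_zero, sub_zero, sub_div, sub_smul, div_self hn, one_smul]
      rfl
    rw [this, norm_smul, norm_div, norm_norm, div_mul_cancel₀ _ hn]

lemma rescale_sinh_arsinh (x : X) : rescale Real.sinh (rescale Real.arsinh x) = x := by
  by_cases hx : x = 0
  · simp [hx, rescale]
  have hn : 0 < ‖x‖ := norm_pos_iff.mpr hx
  have hs : 0 < Real.arsinh ‖x‖ := Real.arsinh_pos_iff.mpr hn
  rw [rescale, norm_rescale Real.arsinh_zero hs.le, Real.sinh_arsinh, rescale, smul_smul]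
  convert one_smul ℝ x using 2
  field_simp

lemma norm_rescale_sinh (x : X) : ‖rescale Real.sinh x‖ = Real.sinh ‖x‖ :=
  norm_rescale Real.sinh_zero (Real.sinh_nonneg_iff.mpr (norm_nonneg x))

lemma norm_rescale_arsinh (x : X) : ‖rescale Real.arsinh x‖ = Real.arsinh ‖x‖ :=
  norm_rescale Real.arsinh_zero (Real.arsinh_nonneg_iff.mpr (norm_nonneg x))

lemma hasFDerivAt_sinh {x : X} (hx : x ≠ 0) : HasFDerivAt (rescale Real.sinh)
    (radialMap x (Real.sinh ‖x‖ / ‖x‖) (Real.cosh ‖x‖)) x :=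
  hasFDerivAt_rescale hx (Real.hasDerivAt_sinh _)

/-- The derivative of the radial rescaling from hyperboloid to polar coordinates. -/
lemma exists_hasFDerivAt_arsinh (x : X) : ∃ L : X →L[ℝ] X,
    HasFDerivAt (rescale Real.arsinh) L x ∧ (x = 0 → L = ContinuousLinearMap.id ℝ X) := by
  by_cases hx : x = 0
  · subst hx
    exact ⟨_, hasFDerivAt_rescale_zero Real.arsinh_zero (by simpa using Real.hasDerivAt_arsinh 0),
      fun _ => rfl⟩
  · exact ⟨_, hasFDerivAt_rescale hx (Real.hasDerivAt_arsinh _), fun h => absurd h hx⟩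

end Radial

/-! ### Metrics in polar and in hyperboloid coordinates -/

section Polar

variable {n : ℕ}

open Classical in
/-- The metric in geodesic polar coordinates which is given in hyperboloid coordinates by the
Euclidean-like metric `β`, minus the contribution of the time coordinate of Minkowski space. -/
def polarOf (β : E n → Bil n) : Form (E n) := fun p a b =>
  if p = 0 then inner ℝ a b
  else (Real.sinh ‖p‖ / ‖p‖) ^ 2 * (β (rescale Real.sinh p) a b - radialForm p a b) +
    radialForm p a b

/-- The metric in hyperboloid coordinates. -/
def hypB (β : E n → Bil n) : Form (E n) := fun x a b =>
  β x a b - inner ℝ x a * inner ℝ x b / (1 + ‖x‖ ^ 2)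

/-- `polarOf β` is the pullback of `hypB β` under the change from polar to hyperboloid coordinates. -/
lemma polarOf_eq_hypB {β : E n → Bil n} {p : E n} (hp : p ≠ 0)
    (hβ : IsConeMetric (rescale Real.sinh p) (β (rescale Real.sinh p))) (a b : E n) :
    hypB β (rescale Real.sinh p)
      (radialMap p (Real.sinh ‖p‖ / ‖p‖) (Real.cosh ‖p‖) a)
      (radialMap p (Real.sinh ‖p‖ / ‖p‖) (Real.cosh ‖p‖) b) = polarOf β p a b := by
  have hn : 0 < ‖p‖ := norm_pos_iff.mpr hp
  have hs : 0 < Real.sinh ‖p‖ := Real.sinh_pos_iff.mpr hn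
  have hq : IsConeMetric p (β (rescale Real.sinh p)) :=
    IsConeMetric.smul (s := Real.sinh ‖p‖ / ‖p‖) (div_pos hs hn).ne' hβ
  rw [hypB, polarOf, if_neg hp, norm_rescale_sinh, radialMap_apply, radialMap_apply]
  set B := β (rescale Real.sinh p) with hB
  rw [rescale]
  simp only [Bil.ev_add_left, Bil.ev_add_right, Bil.ev_smul_left, Bil.ev_smul_right,
    real_inner_smul_left, inner_add_right, real_inner_smul_right, hq.gauss,
    hq.symm a p, real_inner_self_eq_norm_sq, radialForm]
  have hc : 1 + Real.sinh ‖p‖ ^ 2 = Real.cosh ‖p‖ ^ 2 := by rw [Real.cosh_sq]; ring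
  have hc0 : Real.cosh ‖p‖ ≠ 0 := (Real.cosh_pos _).ne'
  rw [hc]
  have hn' := hn.ne'
  field_simp
  have hc2 : Real.cosh ‖p‖ ^ 2 = 1 + Real.sinh ‖p‖ ^ 2 := hc.symm
  linear_combination (inner ℝ p a * inner ℝ p b * ‖p‖ ^ 2 * Real.cosh ‖p‖ ^ 2) * hc2

/-- `hypB β` is the pullback of `polarOf β` under the inverse change of coordinates, at the origin too. -/
lemma hypB_eq_polarOf {β : E n → Bil n} (h0 : β 0 = Bil.eucl n) (x : E n)
    (hβ : IsConeMetric x (β x)) {L : E n →L[ℝ] E n} (hL : HasFDerivAt (rescale Real.arsinh) L x)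
    (hL0 : x = 0 → L = ContinuousLinearMap.id ℝ _) (a b : E n) :
    polarOf β (rescale Real.arsinh x) (L a) (L b) = hypB β x a b := by
  by_cases hx : x = 0
  · subst hx
    rw [hL0 rfl]
    simp [polarOf, hypB, rescale, h0]
  · have hne : rescale Real.arsinh x ≠ 0 := by
      rw [← norm_ne_zero_iff, norm_rescale_arsinh]
      exact (Real.arsinh_pos_iff.mpr (norm_pos_iff.mpr hx)).ne'
    have hr := rescale_sinh_arsinh x
    rw [← polarOf_eq_hypB hne (by rwa [hr]), hr]
    have h₁ := ((hasFDerivAt_sinh hne).comp x hL)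
    have h₂ : ∀ a, radialMap (rescale Real.arsinh x)
        (Real.sinh ‖rescale Real.arsinh x‖ / ‖rescale Real.arsinh x‖)
        (Real.cosh ‖rescale Real.arsinh x‖) (L a) = a := fun a => by
      have h₃ := h₁.unique ((hasFDerivAt_id x).congr_of_eventuallyEq
        (Filter.Eventually.of_forall fun y => rescale_sinh_arsinh y))
      exact congrArg (fun F => F a) h₃
    rw [h₂, h₂]

/-- The product structure of hyperbolic extensions in hyperboloid coordinates. -/
lemma cosh_sq_mul_hypHyperboloid {Y : Type*} [NormedAddCommGroup Y] [InnerProductSpace ℝ Y]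
    (x : Y) {t : ℝ} {N : ℝ} (hN0 : 0 < N) (hN : N ^ 2 = 1 + t ^ 2) (a b : Y) (α α' : ℝ) :
    N ^ 2 * hypHyperboloid (N⁻¹ • x) (N⁻¹ • a - (α / N ^ 3) • x) (N⁻¹ • b - (α' / N ^ 3) • x) -
        α * α' / (1 + t ^ 2) =
      inner ℝ a b - (inner ℝ x a + α) * (inner ℝ x b + α') / (1 + (‖x‖ ^ 2 + t ^ 2)) := by
  rw [hypHyperboloid, norm_smul, Real.norm_of_nonneg (inv_nonneg.mpr hN0.le), mul_pow]
  simp only [inner_sub_left, inner_sub_right, real_inner_smul_left, real_inner_smul_right,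
    real_inner_self_eq_norm_sq, real_inner_comm a x]
  have h₁ : 1 + (‖x‖ ^ 2 + t ^ 2) = N ^ 2 + ‖x‖ ^ 2 := by rw [hN]; ring
  have h₂ : 1 + N⁻¹ ^ 2 * ‖x‖ ^ 2 = (N ^ 2 + ‖x‖ ^ 2) / N ^ 2 := by field_simp
  have h₃ : 0 < N ^ 2 + ‖x‖ ^ 2 := by positivity
  rw [h₁, h₂, ← hN]
  field_simp
  ring

end Polar

section Star

variable {V : Type*} [Fintype V] [DecidableEq V] {K : PreAbstractSimplicialComplex V} {m : ℕ}

lemma sinhScale_cc (h : SphereFamily K m) (σ : Face K) (p : LC m σ) :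
    sinhScale (cc h σ p) = cc h σ (rescale Real.sinh p) := by
  rw [rescale, cc_smul h σ (div_nonneg (Real.sinh_nonneg_iff.mpr (norm_nonneg p)) (norm_nonneg p)),
    sinhScale, norm_cc]

lemma starCoord_eq (h : SphereFamily K m) {σ τ : Face K} (hστ : σ.1 ⊆ τ.1) {p : LC m σ}
    (hp : rescale Real.sinh p ∈ starDom h σ τ) : starCoord h σ τ p =
      ((√(1 + ‖T2 h σ τ (rescale Real.sinh p)‖ ^ 2))⁻¹ • T1 h σ τ (rescale Real.sinh p),
        rescale Real.arsinh (T2 h σ τ (rescale Real.sinh p))) := by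
  have h₁ : starCoord h σ τ p =
      ((√(1 + ‖off τ.1 (sinhScale (cc h σ p))‖ ^ 2))⁻¹ • part τ.1 (sinhScale (cc h σ p)),
        ci h τ (arsinhScale (off τ.1 (sinhScale (cc h σ p))))) := rfl
  rw [h₁, sinhScale_cc, ← norm_T2 h hστ hp, arsinhScale, ci_smul, ← norm_T2 h hστ hp]
  · rfl
  · exact div_nonneg (Real.arsinh_nonneg_iff.mpr (norm_nonneg _)) (norm_nonneg _)

/-- In hyperboloid coordinates, hyperbolic extension along `τ` is `extB`, the product with a Euclidean
metric. -/
lemma pullback_starCoord (S : SmoothSphere K m) {σ τ : Face K} (hστ : σ.1 ⊆ τ.1) {p : LC m σ}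
    (hp0 : p ≠ 0) (hp : rescale Real.sinh p ∈ starDom S.h σ τ)
    {β : LC m τ → Bil (m + 1 - τ.1.card)} (h0 : β 0 = Bil.eucl _)
    (hβ : IsConeMetric (T2 S.h σ τ (rescale Real.sinh p)) (β (T2 S.h σ τ (rescale Real.sinh p))))
    (a b : LC m σ) : pullback (starCoord S.h σ τ) (hypExtension (polarOf β)) p a b =
      polarOf (fun x => extB S.h σ τ x (β (T2 S.h σ τ x))) p a b := by
  rw [← polarOf_eq_hypB hp0 (hβ.extB S hστ hp)]
  have hsc := hasFDerivAt_sinh hp0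
  set A := radialMap p (Real.sinh ‖p‖ / ‖p‖) (Real.cosh ‖p‖) with hA
  set z := rescale Real.sinh p with hz
  have h₁ := (hasFDerivAt_T1 S hστ hp).comp p hsc
  have h₂ := (hasFDerivAt_T2 S hστ hp).comp p hsc
  obtain ⟨L, hL, hL0⟩ := exists_hasFDerivAt_arsinh (T2 S.h σ τ z)
  set N : ℝ := √(1 + ‖T2 S.h σ τ z‖ ^ 2) with hN
  have hN0 : 0 < N := Real.sqrt_pos.mpr (by positivity)
  have hN2 : N ^ 2 = 1 + ‖T2 S.h σ τ z‖ ^ 2 := Real.sq_sqrt (by positivity)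
  have h₃ : HasFDerivAt (fun y => (√(1 + ‖T2 S.h σ τ (rescale Real.sinh y)‖ ^ 2))⁻¹) _ p :=
    (hasDerivAt_inv hN0.ne').comp_hasFDerivAt p
      (((h₂.norm_sq).const_add 1).sqrt (by positivity))
  have h₄ := (h₃.smul h₁).prodMk (hL.comp p h₂)
  have h₅ : HasFDerivAt (starCoord S.h σ τ) _ p := h₄.congr_of_eventuallyEq (by
    filter_upwards [hsc.continuousAt.preimage_mem_nhds ((isOpen_starDom S.h σ τ).mem_nhds hp)]
      with y hy using starCoord_eq S.h hστ hy)
  have h₆ : ∀ a, fderiv ℝ (starCoord S.h σ τ) p a =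
      (N⁻¹ • D1 S.h σ τ z (A a) -
        (inner ℝ (T2 S.h σ τ z) (D2 S.h σ τ z (A a)) / N ^ 3) • T1 S.h σ τ z,
        L (D2 S.h σ τ z (A a))) := by
    intro a
    rw [h₅.fderiv]
    refine Prod.ext ?_ rfl
    simp only [Function.comp_apply, ContinuousLinearMap.prod_apply, add_apply,
      smul_apply, ContinuousLinearMap.smulRight_apply, ContinuousLinearMap.comp_apply,
      innerSL_apply_apply, smul_eq_mul]
    rw [← hz, ← hN, sub_eq_add_neg, ← neg_smul]
    congr 2
    simp
    field_simp
  rw [pullback, h₆, h₆, starCoord_eq S.h hστ hp, hypExtension]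
  dsimp only
  rw [← hz, ← hN, norm_rescale_arsinh, Real.cosh_sq, Real.sinh_arsinh, add_comm _ (1 : ℝ), ← hN2,
    hypB_eq_polarOf h0 _ hβ hL hL0, hypB, hypB, extB_ev, ← inner_T_D S hστ hp,
    ← inner_T_D S hστ hp, ← norm_sq_T1_add_norm_sq_T2 S.h hστ hp]
  have h₇ := cosh_sq_mul_hypHyperboloid (T1 S.h σ τ z) hN0 hN2 (D1 S.h σ τ z (A a))
    (D1 S.h σ τ z (A b)) (inner ℝ (T2 S.h σ τ z) (D2 S.h σ τ z (A a)))
    (inner ℝ (T2 S.h σ τ z) (D2 S.h σ τ z (A b)))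
  linarith

end Star

/-! ### Hyperbolic forcing in hyperboloid coordinates -/

section Forcing

variable {n : ℕ}

/-- In scaled hyperboloid coordinates `cutArg` is a difference of distances to the vertex, the argument of
the cut-offs of hyperbolic forcing. -/
lemma cutArg_sinh {κ : ℝ} (hκ : 0 < κ) (t s : ℝ) :
    cutArg κ (κ * Real.sinh t) (κ * Real.sinh s) = t - s := by
  have h : ∀ t : ℝ, Real.log (κ * Real.sinh t + √((κ * Real.sinh t) ^ 2 + κ ^ 2)) =
      Real.log κ + t := fun t => by
    have h₁ : (κ * Real.sinh t) ^ 2 + κ ^ 2 = (κ * Real.cosh t) ^ 2 := by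
      rw [mul_pow, mul_pow, Real.cosh_sq]; ring
    rw [h₁, Real.sqrt_sq (mul_pos hκ (Real.cosh_pos t)).le, ← mul_add, Real.sinh_add_cosh,
      Real.log_mul hκ.ne' (Real.exp_pos t).ne', Real.log_exp]
  rw [cutArg, h, h]; ring

/-- Warping by `sinh` keeps the form `β` in hyperboloid coordinates constant along rays. -/
lemma warpedCut_eq {s : ℝ} (hs : 0 < s) {g : Form (E n)} {β : E n → Bil n} {p : E n} (hp : p ≠ 0)
    (hg : g ((s / ‖p‖) • p) = polarOf β ((s / ‖p‖) • p))
    (hβ : IsConeMetric p (β (rescale Real.sinh ((s / ‖p‖) • p)))) (a b : E n) :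
    warpedCut s g p a b = (Real.sinh ‖p‖ / ‖p‖) ^ 2 *
      (β (rescale Real.sinh ((s / ‖p‖) • p)) a b - radialForm p a b) + radialForm p a b := by
  have hn : 0 < ‖p‖ := norm_pos_iff.mpr hp
  have hss : 0 < Real.sinh s := Real.sinh_pos_iff.mpr hs
  have hq0 : (s / ‖p‖) • p ≠ 0 := smul_ne_zero (div_pos hs hn).ne' hp
  have hqn : ‖(s / ‖p‖) • p‖ = s := by
    rw [norm_smul, Real.norm_of_nonneg (div_pos hs hn).le, div_mul_cancel₀ _ hn.ne']
  have horth : ∀ a, inner ℝ p (a - (inner ℝ p a / ‖p‖ ^ 2) • p) = 0 := fun a => by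
    rw [inner_sub_right, real_inner_smul_right, real_inner_self_eq_norm_sq]
    field_simp; ring
  have hr : radialForm ((s / ‖p‖) • p) (projDeriv s p a) (projDeriv s p b) = 0 := by
    rw [radialForm, projDeriv, real_inner_smul_left, real_inner_smul_right, horth]; simp
  rw [warpedCut, hg, polarOf, if_neg hq0, hr, hqn]
  set B := β (rescale Real.sinh ((s / ‖p‖) • p))
  have hB : B (projDeriv s p a) (projDeriv s p b) =
      (s / ‖p‖) ^ 2 * (B a b - radialForm p a b) := by
    simp only [projDeriv, sub_eq_add_neg, ← neg_smul, Bil.ev_add_left, Bil.ev_add_right,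
      Bil.ev_smul_left, Bil.ev_smul_right, hβ.gauss, hβ.symm a p, radialForm,
      real_inner_self_eq_norm_sq]
    field_simp; ring
  rw [hB]
  field_simp
  ring

/-- Hyperbolic forcing of a metric given by `P` in scaled hyperboloid coordinates is given by `forceB` of
`P`. -/
lemma hypForcing_polarOf {ρ : ℝ → ℝ} (hρ : IsCutoff ρ) {s d κ w : ℝ} (hd : 0 < d) (hds : d ≤ s)
    (hκ : 0 < κ) (hw : w = κ * Real.sinh s) {g : Form (E n)} {P : E n → Bil n}
    (hg : ∀ p, s ≤ ‖p‖ → g p = polarOf (fun x => P (κ • x)) p)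
    (hP : ∀ z, w ≤ ‖z‖ → IsConeMetric z (P z)) :
    hypForcing ρ s d g = polarOf (fun x => forceB ρ κ w d P (κ • x)) := by
  have hs : 0 < s := hd.trans_le hds
  have hss : 0 < Real.sinh s := Real.sinh_pos_iff.mpr hs
  funext p a b
  by_cases hp : p = 0
  · subst hp
    have h₁ : ρ (2 * ((‖(0 : E n)‖ - (s - d)) / d)) = 0 := hρ.eq_zero (by
      rw [norm_zero]
      have : (0 - (s - d)) / d ≤ 0 := div_nonpos_of_nonpos_of_nonneg (by linarith) hd.le
      linarith)
    rw [hypForcing, twoVariable, h₁, polarOf, if_pos rfl, hypPolar, if_pos rfl]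
    ring
  have hn : 0 < ‖p‖ := norm_pos_iff.mpr hp
  have hsp : 0 < Real.sinh ‖p‖ := Real.sinh_pos_iff.mpr hn
  have hz0 : κ • rescale Real.sinh p ≠ 0 := by
    rw [← norm_ne_zero_iff, norm_smul, norm_rescale_sinh]
    exact (mul_pos (norm_pos_iff.mpr hκ.ne') hsp).ne'
  have hzn : ‖κ • rescale Real.sinh p‖ = κ * Real.sinh ‖p‖ := by
    rw [norm_smul, norm_rescale_sinh, Real.norm_of_nonneg hκ.le]
  have hcut : cutArg κ ‖κ • rescale Real.sinh p‖ w = ‖p‖ - s := by rw [hzn, hw, cutArg_sinh hκ]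
  have hχ : 2 * ((‖p‖ - s + d) / d) = 2 * ((‖p‖ - (s - d)) / d) := by ring
  have hψ : 2 * (‖p‖ - s) = 2 * ‖p‖ - 2 * s := by ring
  have hqn : ‖(s / ‖p‖) • p‖ = s := by
    rw [norm_smul, Real.norm_of_nonneg (div_pos hs hn).le, div_mul_cancel₀ _ hn.ne']
  have hproj : (w / ‖κ • rescale Real.sinh p‖) • κ • rescale Real.sinh p =
      κ • rescale Real.sinh ((s / ‖p‖) • p) := by
    rw [hzn, hw, rescale_smul _ (div_pos hs hn), div_mul_cancel₀ _ hn.ne', rescale, smul_smul,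
      smul_smul, smul_smul]
    congr 1; field_simp
  have hwc := warpedCut_eq (β := fun x => P (κ • x)) hs hp (hg _ hqn.ge) (by
    have h₁ := hP (κ • rescale Real.sinh ((s / ‖p‖) • p)) (by
      rw [norm_smul, norm_rescale_sinh, hqn, hw, Real.norm_of_nonneg hκ.le])
    have h₂ : κ • rescale Real.sinh ((s / ‖p‖) • p) = (κ * (Real.sinh s / ‖p‖)) • p := by
      rw [rescale_smul _ (div_pos hs hn), div_mul_cancel₀ _ hn.ne', smul_smul]
    exact IsConeMetric.smul (s := κ * (Real.sinh s / ‖p‖)) (by positivity) (h₂ ▸ h₁)) a b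
  rw [hypForcing, twoVariable, warpForcing, hwc, polarOf, if_neg hp, forceB, if_neg hz0, hcut, hχ,
    hψ, hproj, hypPolar, if_neg hp]
  simp only [Bil.add_ev, Bil.smul_ev, Bil.eucl_ev]
  rcases lt_or_ge ‖p‖ s with hlt | hge
  · rw [hρ.eq_zero (t := 2 * ‖p‖ - 2 * s) (by linarith)]
    ring
  · rw [hg p hge, polarOf, if_neg hp]
    ring

end Forcing

/-! ### The smoothed metric and its scale-invariant model -/

section Identification

variable {V : Type*} [Fintype V] [DecidableEq V] {K : PreAbstractSimplicialComplex V} {m : ℕ}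
  {ρ : ℝ → ℝ} {ς c C₀ ξ r : ℝ} {d : ℕ → ℝ}

lemma sinh_rad (ς r : ℝ) (i : ℕ) : Real.sinh (rad ς r i) = Real.sinh r / ς ^ i :=
  Real.sinh_arsinh _

/-- In hyperboloid coordinates and in units of `sinh r`, the point with coordinates `p` lies in the
open normal neighborhood of the simplex `Δ` of the link of `σ`. -/
def OpenNear (h : SphereFamily K m) (ς c r : ℝ) (σ : Face K) (p : LC m σ) (Δ : Finset V) : Prop :=
  Δ ∈ link K σ.1 ∧ supp (cc h σ p) ∪ Δ ∈ link K σ.1 ∧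
    ‖off (σ.1 ∪ Δ) (cc h σ (rescale Real.sinh p))‖ <
      c * wt ς m (σ.1 ∪ Δ).card * Real.sinh r

lemma width_eq (hς : 0 < ς) {σ : Face K} (hσ : σ.1.card + 1 ≤ m) {Δ : Finset V}
    (hΔ : Disjoint Δ σ.1) :
    Real.sinh (rad ς r (m - σ.1.card - 1)) * (c * ς ^ Δ.card) =
      c * wt ς m (σ.1 ∪ Δ).card * Real.sinh r := by
  rw [sinh_rad, wt, Finset.card_union_of_disjoint hΔ.symm]
  have h₁ : ς ^ (m - 1) = ς ^ (m - σ.1.card - 1) * ς ^ σ.1.card := by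
    rw [← pow_add]; congr 1; omega
  rw [h₁, pow_add]
  field_simp

lemma off_union_cc (h : SphereFamily K m) (σ : Face K) (z : LC m σ) (Δ : Finset V) :
    off (σ.1 ∪ Δ) (cc h σ z) = off Δ (cc h σ z) := by
  ext v
  simp only [off_apply, Finset.mem_union]
  by_cases h₁ : v ∈ σ.1
  · simp [h₁, cc_apply_of_mem h σ z h₁]
  · simp [h₁]

lemma mem_openNbhd_iff (hς : 0 < ς) {h : SphereFamily K m} {σ : Face K} (hσ : σ.1.card + 1 ≤ m)
    {p : LC m σ} {Δ : Finset V} (hΔ : Δ ∈ link K σ.1) :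
    cc h σ p ∈ openNbhd (link K σ.1) Δ
        (Real.arsinh (Real.sinh (rad ς r (m - σ.1.card - 1)) * (c * ς ^ Δ.card))) ↔
      OpenNear h ς c r σ p Δ := by
  rw [openNbhd, Set.mem_ofPred_eq, coneStar, Set.mem_ofPred_eq, coneDist, Real.arsinh_lt_arsinh,
    sinhScale_cc, width_eq hς hσ hΔ.2.1, OpenNear, off_union_cc]
  exact ⟨fun h => ⟨hΔ, h.1.2, h.2⟩, fun h' => ⟨⟨cc_mem h σ p, h'.2.1⟩, h'.2.2⟩⟩

/-- The closed neighborhood of a simplex that is removed in the definition of the patches is contained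
in the open neighborhood of the same simplex. -/
lemma openNear_of_mem_closedNbhd (hP : Params ς c C₀) (hr : 0 < r) {h : SphereFamily K m}
    {σ : Face K} {p : LC m σ} {Δ : Finset V} (hΔ : Δ ∈ link K σ.1) (hc : σ.1.card + Δ.card + 1 ≤ m)
    (hp : cc h σ p ∈ closedNbhd (link K σ.1) Δ (rad ς r (m - σ.1.card - 1 - Δ.card))) :
    OpenNear h ς c r σ p Δ := by
  refine ⟨hΔ, hp.1.2, ?_⟩
  have h₁ := hp.2
  rw [coneDist, rad, Real.arsinh_le_arsinh, sinhScale_cc] at h₁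
  rw [off_union_cc]
  have hs : 0 < Real.sinh r := Real.sinh_pos_iff.mpr hr
  refine h₁.trans_lt ?_
  have h₂ : Real.sinh r / ς ^ (m - σ.1.card - 1 - Δ.card) =
      wt ς m (σ.1 ∪ Δ).card * Real.sinh r := by
    have hς := hP.pos
    rw [wt, Finset.card_union_of_disjoint hΔ.2.1.symm]
    have h₁ : ς ^ (m - 1) = ς ^ (m - σ.1.card - 1 - Δ.card) * ς ^ (σ.1.card + Δ.card) := by
      rw [← pow_add]; congr 1; omega
    rw [h₁]
    field_simp
  rw [h₂]
  refine mul_lt_mul_of_pos_right ?_ hs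
  nlinarith [hP.wt_pos m (σ.1 ∪ Δ).card, hP.two_le]

/-- A point in the open neighborhood of a simplex of codimension at least two lies in a patch, of a
simplex of at most the same dimension: for the least dimension, nothing is removed. -/
lemma exists_isPatch (hP : Params ς c C₀) (hξ : 0 < ξ) (hr : 0 < r) {h : SphereFamily K m}
    {σ : Face K} (hσ : σ.1.card + 1 ≤ m) {p : LC m σ} (hp : rad ς r (m - σ.1.card - 1) ≤ ‖p‖)
    {Δ : Finset V} (hΔ : OpenNear h ς c r σ p Δ) (hc : Δ.card + 1 ≤ m - σ.1.card) :
    ∃ Δ', IsPatch (link K σ.1) (m - σ.1.card) ξ ς c r (cc h σ p) Δ' ∧ Δ'.card ≤ Δ.card := by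
  obtain ⟨Δ', ⟨hΔ', hc'⟩, hmin⟩ := Set.exists_min_image
    {Δ' | OpenNear h ς c r σ p Δ' ∧ Δ'.card + 1 ≤ m - σ.1.card} Finset.card (Set.toFinite _)
    ⟨Δ, hΔ, hc⟩
  refine ⟨Δ', ⟨hΔ'.1, hc', ⟨(mem_openNbhd_iff hP.pos hσ hΔ'.1).mpr hΔ', ?_⟩, ?_⟩, hmin Δ ⟨hΔ, hc⟩⟩
  · rintro (hu | hb)
    · obtain ⟨Δ'', ⟨h₁, h₂⟩, h₃⟩ := Set.mem_iUnion₂.mp hu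
      exact absurd (hmin Δ'' ⟨openNear_of_mem_closedNbhd hP hr h₁ (by omega) h₃, by omega⟩)
        (not_le.mpr h₂)
    · rw [mem_ball_zero_iff, norm_cc] at hb
      linarith
  · intro Δ'' h₁ h₂ h₃
    exact hmin Δ'' ⟨(mem_openNbhd_iff hP.pos hσ h₁).mp h₃.1, h₂⟩

/-- The smoothed metrics of the links are given by the scale-invariant model with
`κ = 1 / sinh r`.  The patches in the definition of the smoothed metric need not be those in the
definition of the model, but the metrics agree by `eq_extB`. -/
theorem smoothedLink_eq (S : SmoothSphere K m) (hρ : IsCutoff ρ) (hP : Params ς c C₀)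
    (hξ : 0 < ξ) (hr : 0 < r) (hS : Small K m ς d (Real.sinh r)⁻¹)
    (hd : ∀ σ : Face K, σ.1.card + 1 ≤ m → d (m - σ.1.card + 1) ≤ rad ς r (m - σ.1.card - 1))
    (n : ℕ) : ∀ (σ : Face K), Fintype.card V - σ.1.card < n → σ.1.card + 1 ≤ m →
      smoothedLink S.h ρ ξ ς c r d σ =
        polarOf fun x => model S.h ρ ς c d σ (Real.sinh r)⁻¹ ((Real.sinh r)⁻¹ • x) := by
  have hς := hP.pos
  have hs : 0 < Real.sinh r := Real.sinh_pos_iff.mpr hr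
  set κ := (Real.sinh r)⁻¹ with hκ_def
  have hκ : 0 < κ := inv_pos.mpr hs
  have hκs : κ * Real.sinh r = 1 := inv_mul_cancel₀ hs.ne'
  induction n with
  | zero => intro σ hσ; omega
  | succ n ih =>
    intro σ hσn hσ
    have hw := hP.wt_pos m σ.1.card
    have hd1 := hS.one_le σ hσ
    have hwr : wt ς m σ.1.card = κ * Real.sinh (rad ς r (m - σ.1.card - 1)) := by
      rw [sinh_rad, wt]
      have h₁ : ς ^ (m - 1) = ς ^ (m - σ.1.card - 1) * ς ^ σ.1.card := by
        rw [← pow_add]; congr 1; omega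
      rw [h₁]
      field_simp
      linarith
    rw [smoothedLink, model_of_le S.h hσ]
    refine hypForcing_polarOf hρ (by linarith) (hd σ hσ) hκ hwr (fun p hp => ?_)
      (fun z hz => isConeMetric_patB S hP (fun τ _ z => isConeMetric_model S hρ hP _ τ
        (Nat.lt_succ_self _) z) (by linarith))
    have hrad : 0 < rad ς r (m - σ.1.card - 1) := Real.arsinh_pos_iff.mpr (by positivity)
    have hp0 : p ≠ 0 := norm_pos_iff.mp (hrad.trans_le hp)
    have hn : 0 < ‖p‖ := norm_pos_iff.mpr hp0
    have hsp : 0 < Real.sinh ‖p‖ := Real.sinh_pos_iff.mpr hn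
    set x := rescale Real.sinh p with hx
    have hxp : x = (Real.sinh ‖p‖ / ‖p‖) • p := rfl
    have hzn : wt ς m σ.1.card / 2 ≤ ‖κ • x‖ := by
      rw [norm_smul, hx, norm_rescale_sinh, Real.norm_of_nonneg hκ.le, hwr]
      have h₁ := mul_le_mul_of_nonneg_left (Real.sinh_le_sinh.mpr hp) hκ.le
      linarith [hwr ▸ hw]
    have hz0 : κ • x ≠ 0 := fun h => by rw [h, norm_zero] at hzn; linarith
    have hsupp : supp (cc S.h σ (κ • x)) = supp (cc S.h σ p) := by
      rw [cc_smul S.h σ hκ.le, hxp, cc_smul S.h σ (by positivity), supp_smul hκ.ne',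
        supp_smul (by positivity)]
    -- the relevant neighborhoods of simplices of codimension at least two
    have hopen : ∀ τ : Face K, τ.1.card + 1 ≤ m → Near S.h ς (Real.exp 1) σ (κ • x) τ →
        ∃ Δ', IsPatch (link K σ.1) (m - σ.1.card) ξ ς c r (cc S.h σ p) Δ' ∧
          σ.1.card + Δ'.card ≤ τ.1.card := by
      intro τ hτ hnear
      have hu : σ.1 ∪ τ.1 \ σ.1 = τ.1 := Finset.union_sdiff_of_subset hnear.1.1
      have hcard := Finset.card_sdiff_add_card_eq_card hnear.1.1
      have hne : (τ.1 \ σ.1).Nonempty := Finset.sdiff_nonempty.mpr hnear.1.2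
      have hτK : τ.1 ∈ K := τ.2.resolve_left fun h => by
        rw [h] at hne; simp at hne
      have hΔ : τ.1 \ σ.1 ∈ link K σ.1 := mem_link.mpr ⟨hne, Finset.sdiff_disjoint, by
        rwa [Finset.union_comm, hu]⟩
      have hon : OpenNear S.h ς c r σ p (τ.1 \ σ.1) := by
        refine ⟨hΔ, mem_link.mpr ⟨hne.mono Finset.subset_union_right, ?_, ?_⟩, ?_⟩
        · exact Finset.disjoint_union_left.mpr ⟨disjoint_supp_cc S.h σ p, Finset.sdiff_disjoint⟩
        · rw [Finset.union_assoc, Finset.union_comm _ σ.1, hu, ← hsupp]; exact hnear.2.1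
        · rw [hu]
          have h₃ := hnear.2.2
          rw [cc_smul S.h σ hκ.le, off_smul, norm_smul, Real.norm_of_nonneg hκ.le] at h₃
          have h₄ : Real.exp 1 * wt ς m τ.1.card < c * wt ς m τ.1.card :=
            mul_lt_mul_of_pos_right hP.exp_lt (hP.wt_pos _ _)
          have h₅ := mul_lt_mul_of_pos_right (h₃.trans_lt h₄) hs
          calc ‖off τ.1 (cc S.h σ x)‖ = κ * Real.sinh r * ‖off τ.1 (cc S.h σ x)‖ := by
                rw [hκs, one_mul]
            _ = κ * ‖off τ.1 (cc S.h σ x)‖ * Real.sinh r := by ring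
            _ < _ := h₅
      obtain ⟨Δ', h₁, h₂⟩ := exists_isPatch hP hξ hr hσ hp hon (by omega)
      exact ⟨Δ', h₁, by omega⟩
    -- hyperbolic extensions along simplices as in `eq_extB` give the patched metric of the model
    have hfinal : ∀ τ : Face K, σ.1 ⊂ τ.1 → κ • x ∈ starDom S.h σ τ →
        Near S.h ς C₀ σ (κ • x) τ → (∀ τ' : Face K, τ'.1 ⊂ τ.1 → τ'.1.card + 1 ≤ m →
          ¬ Near S.h ς (Real.exp 1) σ (κ • x) τ') →
        pullback (starCoord S.h σ τ) (hypExtension (polarOf fun x =>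
          model S.h ρ ς c d τ κ (κ • x))) p =
        polarOf (fun x => patB S.h ρ ς c d σ κ (κ • x)) p := by
      intro τ hστ hdom hnear hmin
      have hdom' : x ∈ starDom S.h σ τ := (smul_mem_starDom S.h hκ).mp hdom
      have hcone := isConeMetric_model (ς := ς) (c := c) (d := d) (κ := κ) S hρ hP _ τ
        (Nat.lt_succ_self _)
      funext a b
      rw [pullback_starCoord S hστ.1 hp0 hdom' (β := fun x => model S.h ρ ς c d τ κ (κ • x)) ?_
        (IsConeMetric.smul hκ.ne' (hcone _))]
      · rw [polarOf, polarOf, if_neg hp0, if_neg hp0, ← hx,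
          (eq_extB S hρ hP hS _ σ le_rfl τ (κ • x) hdom hnear hmin).1 hzn, extB_smul S.h hκ,
          T2_smul S.h hκ.le]
      · rw [smul_zero]
        by_cases hτ : τ.1.card + 1 ≤ m
        · rw [model_of_le S.h hτ, forceB, if_pos rfl]
        · rw [model_of_not_le S.h hτ]
    have hKσ : ∀ Δ, supp (cc S.h σ p) ∪ Δ ∈ link K σ.1 →
        supp (cc S.h σ (κ • x)) ∪ (σ.1 ∪ Δ) ∈ K := fun Δ h => by
      rw [hsupp, Finset.union_comm σ.1, ← Finset.union_assoc]; exact h.2.2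
    have hss : ∀ Δ, Δ ∈ link K σ.1 → σ.1 ⊂ σ.1 ∪ Δ := fun Δ hΔ =>
      Finset.ssubset_iff_subset_ne.mpr ⟨Finset.subset_union_left, fun h => by
        obtain ⟨v, hv⟩ := hΔ.1
        exact Finset.disjoint_left.mp hΔ.2.1 hv (h ▸ Finset.mem_union_right _ hv)⟩
    split_ifs with hpatch
    · obtain ⟨h₁, h₂, h₃, h₄⟩ := hpatch.choose_spec
      set Δ := hpatch.choose with hΔ
      have hcard : (σ.1 ∪ Δ).card = σ.1.card + Δ.card :=
        Finset.card_union_of_disjoint h₁.2.1.symm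
      have hon : OpenNear S.h ς c r σ p Δ := (mem_openNbhd_iff hς hσ h₁).mp h₃.1
      have hmin : ∀ τ : Face K, Near S.h ς (Real.exp 1) σ (κ • x) τ →
          (σ.1 ∪ Δ).card ≤ τ.1.card := by
        intro τ hτ
        by_contra hlt
        push Not at hlt
        obtain ⟨Δ', h₅, h₆⟩ := hopen τ (by omega) hτ
        have := h₄ Δ' h₅.1 h₅.2.1 h₅.2.2.1
        omega
      have hnear : Near S.h ς C₀ σ (κ • x) (σ.join Δ h₁) := by
        refine ⟨hss Δ h₁, hKσ Δ hon.2.1, ?_⟩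
        rw [cc_smul S.h σ hκ.le, off_smul, norm_smul, Real.norm_of_nonneg hκ.le]
        have h₅ := mul_le_mul_of_nonneg_left hon.2.2.le hκ.le
        have h₆ : κ * (c * wt ς m (σ.1 ∪ Δ).card * Real.sinh r) = c * wt ς m (σ.1 ∪ Δ).card := by
          linear_combination (c * wt ς m (σ.1 ∪ Δ).card) * hκs
        rw [h₆] at h₅
        exact h₅.trans (mul_le_mul_of_nonneg_right hP.le (hP.wt_pos _ _).le)
      rw [ih (σ.join Δ h₁) ?_ ?_]
      · refine hfinal _ (hss Δ h₁) (fun v hv hv' => ?_) hnear fun τ' h₅ _ h₆ =>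
          absurd (hmin τ' h₆) (not_le.mpr (Finset.card_lt_card h₅))
        exact (hP.wt_pos _ _).trans_le
          (le_cc_apply hP hzn (by linarith [Real.exp_one_gt_d9]) hnear hmin hv hv')
      · have := Finset.card_lt_card (hss Δ h₁)
        have := Finset.card_le_univ (σ.1 ∪ Δ)
        change Fintype.card V - (σ.1 ∪ Δ).card < n
        omega
      · change (σ.1 ∪ Δ).card + 1 ≤ m
        omega
    · -- without a patch, the carrier of the point has codimension at most one
      have h₁ : supp (cc S.h σ p) ∈ link K σ.1 := supp_cc_mem S.h σ hp0
      have h₁' : supp (coneMap (S.h σ) p) ∈ link K σ.1 := h₁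
      rw [pwHyperbolic, dif_pos h₁']
      set Δ := supp (coneMap (S.h σ) p) with hΔ
      have hno : ∀ τ : Face K, τ.1.card + 1 ≤ m → ¬ Near S.h ς (Real.exp 1) σ (κ • x) τ :=
        fun τ hτ hnear => by
          obtain ⟨Δ', h₅, -⟩ := hopen τ hτ hnear
          exact hpatch ⟨Δ', h₅⟩
      have hoff : off (σ.1 ∪ Δ) (cc S.h σ (κ • x)) = 0 :=
        off_eq_zero (by rw [hsupp]; exact Finset.subset_union_right)
      have hnear : ∀ C : ℝ, 0 ≤ C → Near S.h ς C σ (κ • x) (σ.join Δ h₁') := fun C hC =>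
        ⟨hss Δ h₁', hKσ Δ (by
          have : supp (cc S.h σ p) ∪ Δ = Δ := Finset.union_self _
          rw [this]; exact h₁'), by
          change ‖off (σ.1 ∪ Δ) (cc S.h σ (κ • x))‖ ≤ _
          rw [hoff, norm_zero]; exact mul_nonneg hC (hP.wt_pos _ _).le⟩
      have hcodim : ¬ (σ.join Δ h₁').1.card + 1 ≤ m := fun h =>
        hno _ h (hnear _ (Real.exp_pos 1).le)
      rw [← hfinal (σ.join Δ h₁') (hss Δ h₁') (fun v hv hv' => ?_)
        (hnear _ (by linarith [hP.two_le, hP.le])) fun τ' _ h => hno τ' h]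
      · -- the link is a point or a line, with its standard metric
        congr 2
        funext q a b
        simp only [model_of_not_le S.h hcodim]
        rw [polarOf]
        split_ifs with hq
        · rfl
        · have hone : radialForm q a b = inner ℝ a b := by
            have hr : Module.finrank ℝ (LC m (σ.join Δ h₁')) = 1 := by
              have hpos : 0 < Module.finrank ℝ (LC m (σ.join Δ h₁')) :=
                Module.finrank_pos_iff_exists_ne_zero.mpr ⟨q, hq⟩
              rw [finrank_euclideanSpace, Fintype.card_fin] at hpos ⊢
              omega
            have hsp := (finrank_eq_one_iff_of_nonzero' q hq).mp hr
            obtain ⟨s, rfl⟩ := hsp a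
            obtain ⟨t, rfl⟩ := hsp b
            have hq' : ‖q‖ ≠ 0 := norm_ne_zero_iff.mpr hq
            rw [radialForm]
            simp only [real_inner_smul_right, real_inner_smul_left, real_inner_self_eq_norm_sq]
            field_simp
          rw [hone, Bil.eucl_ev]; ring
      · have hv₂ : v ∈ Δ := (Finset.mem_union.mp hv).resolve_left hv'
        have hv₃ : v ∈ supp (cc S.h σ (κ • x)) := by rw [hsupp]; exact hv₂
        exact lt_of_le_of_ne (cc_nonneg S.h σ _ v) (Ne.symm (mem_supp.mp hv₃))

end Identification

/-! ### Slow variation in the limit `κ = 0` -/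

section Slow

/-- The first two derivatives of `f` at `s` are at most `η f s`. -/
structure SlowAt (η : ℝ) (f : ℝ → ℝ) (s : ℝ) : Prop where
  contDiffAt : ContDiffAt ℝ 2 f s
  deriv_le : |deriv f s| ≤ η * f s
  deriv_deriv_le : |deriv (deriv f) s| ≤ η * f s

variable {η : ℝ} {f g : ℝ → ℝ} {s : ℝ}

lemma SlowAt.congr (h : SlowAt η f s) (hfg : g =ᶠ[nhds s] f) : SlowAt η g s := by
  refine ⟨h.1.congr_of_eventuallyEq hfg, ?_, ?_⟩
  · rw [hfg.deriv_eq, hfg.eq_of_nhds]; exact h.2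
  · rw [hfg.deriv.deriv_eq, hfg.eq_of_nhds]; exact h.3

lemma SlowAt.mono {η' : ℝ} (h : SlowAt η f s) (hη : η ≤ η') (hf : 0 ≤ f s) : SlowAt η' f s :=
  ⟨h.1, h.2.trans (mul_le_mul_of_nonneg_right hη hf), h.3.trans (mul_le_mul_of_nonneg_right hη hf)⟩

lemma slowAt_const {b : ℝ} (hη : 0 ≤ η) (hb : 0 ≤ b) : SlowAt η (fun _ => b) s := by
  refine ⟨contDiffAt_const, ?_, ?_⟩ <;> simp <;> positivity

lemma SlowAt.const_add {b : ℝ} (h : SlowAt η f s) (hη : 0 ≤ η) (hb : 0 ≤ b) :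
    SlowAt η (fun t => b + f t) s := by
  have hd : deriv (fun t => b + f t) = deriv f := by funext t; exact deriv_const_add b
  have h₁ := mul_nonneg hη hb
  refine ⟨contDiffAt_const.add h.1, ?_, ?_⟩
  · rw [hd]; linarith [h.2]
  · rw [hd]; linarith [h.3]

lemma eventually_deriv_mul (hf : ContDiffAt ℝ 2 f s) (hg : ContDiffAt ℝ 2 g s) :
    deriv (fun t => f t * g t) =ᶠ[nhds s] fun t => deriv f t * g t + f t * deriv g t := by
  filter_upwards [hf.eventually (by simp), hg.eventually (by simp)] with t h₁ h₂
  exact deriv_fun_mul (h₁.differentiableAt (by simp)) (h₂.differentiableAt (by simp))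

lemma differentiableAt_deriv (hf : ContDiffAt ℝ 2 f s) : DifferentiableAt ℝ (deriv f) s := by
  have h₁ : ContDiffAt ℝ 1 (fderiv ℝ f) s := hf.fderiv_right (by norm_num)
  exact (h₁.differentiableAt (by simp)).clm_apply (differentiableAt_const 1)

lemma deriv_deriv_mul (hf : ContDiffAt ℝ 2 f s) (hg : ContDiffAt ℝ 2 g s) :
    deriv (deriv fun t => f t * g t) s =
      deriv (deriv f) s * g s + 2 * (deriv f s * deriv g s) + f s * deriv (deriv g) s := by
  have h₁ := hf.differentiableAt (by simp)
  have h₂ := hg.differentiableAt (by simp)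
  rw [(eventually_deriv_mul hf hg).deriv_eq]
  have := ((differentiableAt_deriv hf).hasDerivAt.mul h₂.hasDerivAt).add
    (h₁.hasDerivAt.mul (differentiableAt_deriv hg).hasDerivAt)
  have e := this.deriv
  calc _ = _ := e
    _ = _ := by ring

/-- A positive function with slow variation is nearly constant. -/
lemma abs_log_sub_le {s t : ℝ} (hf : ∀ x ∈ Set.uIcc s t, SlowAt η f x ∧ 0 < f x) :
    |Real.log (f t) - Real.log (f s)| ≤ η * |t - s| := by
  have h := Convex.norm_image_sub_le_of_norm_hasDerivWithin_le (f := fun x => Real.log (f x))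
    (f' := fun x => deriv f x / f x) (s := Set.uIcc s t) (C := η) (x := s) (y := t)
    (fun x hx => ?_) (fun x hx => ?_) (convex_uIcc s t) Set.left_mem_uIcc Set.right_mem_uIcc
  · exact h
  · exact ((((hf x hx).1.1.differentiableAt (by simp)).hasDerivAt).log
      (hf x hx).2.ne').hasDerivWithinAt
  · rw [Real.norm_eq_abs, abs_div, abs_of_pos (hf x hx).2, div_le_iff₀ (hf x hx).2]
    exact (hf x hx).1.2

/-- The values of such a function at two points differ by at most the factor `e^{η |t - s|}`. -/
lemma le_exp_mul {s t : ℝ} (hf : ∀ x ∈ Set.uIcc s t, SlowAt η f x ∧ 0 < f x) :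
    f t ≤ Real.exp (η * |t - s|) * f s ∧ f s ≤ Real.exp (η * |t - s|) * f t := by
  have h := abs_le.mp (abs_log_sub_le hf)
  have h₁ := (hf s Set.left_mem_uIcc).2
  have h₂ := (hf t Set.right_mem_uIcc).2
  constructor
  · have := Real.exp_le_exp.mpr (show Real.log (f t) ≤ η * |t - s| + Real.log (f s) by linarith)
    rwa [Real.exp_add, Real.exp_log h₁, Real.exp_log h₂] at this
  · have := Real.exp_le_exp.mpr (show Real.log (f s) ≤ η * |t - s| + Real.log (f t) by linarith)
    rwa [Real.exp_add, Real.exp_log h₁, Real.exp_log h₂] at this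

variable {ρ : ℝ → ℝ}

/-- The derivatives of a cut-off vanish outside `[0, 1]`. -/
lemma IsCutoff.exists_bound (hρ : IsCutoff ρ) :
    ∃ M, 1 ≤ M ∧ ∀ t, |deriv ρ t| ≤ M ∧ |deriv (deriv ρ) t| ≤ M := by
  have hs := hρ.smooth
  have h₁ : Continuous (deriv ρ) := hs.continuous_deriv (by simp)
  have h₂ : Continuous (deriv (deriv ρ)) := by
    have : ContDiff ℝ 1 (deriv ρ) :=
      ((contDiff_succ_iff_deriv (n := 1)).mp (hs.of_le (by norm_cast))).2.2
    exact this.continuous_deriv le_rfl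
  obtain ⟨M₁, hM₁⟩ := (isCompact_Icc (a := (0 : ℝ)) (b := 1)).exists_bound_of_continuousOn
    h₁.continuousOn
  obtain ⟨M₂, hM₂⟩ := (isCompact_Icc (a := (0 : ℝ)) (b := 1)).exists_bound_of_continuousOn
    h₂.continuousOn
  obtain ⟨δ, hδ, h0, h1⟩ := hρ.flat
  refine ⟨max 1 (max M₁ M₂), le_max_left _ _, fun t => ?_⟩
  have key : ∀ b : ℝ, ρ =ᶠ[nhds t] (fun _ => b) → |deriv ρ t| ≤ max 1 (max M₁ M₂) ∧
      |deriv (deriv ρ) t| ≤ max 1 (max M₁ M₂) := by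
    intro b hb
    have hd := hb.deriv
    rw [hb.deriv_eq, hd.deriv_eq]
    simp
  by_cases ht : t ∈ Set.Icc (0 : ℝ) 1
  · have h₃ := hM₁ t ht
    have h₄ := hM₂ t ht
    rw [Real.norm_eq_abs] at h₃ h₄
    exact ⟨h₃.trans ((le_max_left _ _).trans (le_max_right _ _)),
      h₄.trans ((le_max_right _ _).trans (le_max_right _ _))⟩
  · rw [Set.mem_Icc, not_and_or, not_le, not_le] at ht
    rcases ht with ht | ht
    · refine key 0 ?_
      filter_upwards [Iio_mem_nhds ht] with x hx using h0 x (by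
        have : x < 0 := hx
        linarith)
    · refine key 1 ?_
      filter_upwards [Ioi_mem_nhds ht] with x hx using h1 x (by
        have : 1 < x := hx
        linarith)

lemma deriv_comp_affine (hρ : IsCutoff ρ) (α β s : ℝ) :
    deriv (fun t => ρ (α * t + β)) s = α * deriv ρ (α * s + β) ∧
      deriv (deriv fun t => ρ (α * t + β)) s = α ^ 2 * deriv (deriv ρ) (α * s + β) := by
  have ha : ∀ t, HasDerivAt (fun t => α * t + β) α t := fun t => by
    simpa using ((hasDerivAt_id t).const_mul α).add_const β
  have h₁ : ∀ t, deriv (fun t => ρ (α * t + β)) t = α * deriv ρ (α * t + β) := fun t => by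
    have := ((hρ.smooth.differentiable (by simp)) (α * t + β)).hasDerivAt.comp t (ha t)
    rw [mul_comm]; exact this.deriv
  refine ⟨h₁ s, ?_⟩
  rw [show deriv (fun t => ρ (α * t + β)) = fun t => α * deriv ρ (α * t + β) from funext h₁]
  have h₂ : DifferentiableAt ℝ (deriv ρ) (α * s + β) :=
    differentiableAt_deriv (hρ.smooth.contDiffAt.of_le (by norm_cast))
  have := (h₂.hasDerivAt.comp s (ha s)).const_mul α
  rw [show α ^ 2 * deriv (deriv ρ) (α * s + β) = α * (deriv (deriv ρ) (α * s + β) * α) by ring]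
  exact this.deriv

/-- A slow transition between two constants has slow variation.  This is the outer cut-off of
hyperbolic forcing, with `α = 2 / d`. -/
lemma slowAt_transition (hρ : IsCutoff ρ) {M : ℝ} (hM : ∀ t, |deriv ρ t| ≤ M ∧
    |deriv (deriv ρ) t| ≤ M) {α β A B C : ℝ} (hα : 0 ≤ α) (hα1 : α ≤ 1) (hA : 0 ≤ A)
    (hC : 1 ≤ C) (hB : C⁻¹ * A ≤ B) (hB' : B ≤ C * A) (hη : α * M * C ^ 2 ≤ η) :
    SlowAt η (fun t => (1 - ρ (α * t + β)) * A + ρ (α * t + β) * B) s := by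
  have hC0 : 0 < C := by linarith
  have hM0 : 0 ≤ M := (abs_nonneg _).trans (hM 0).1
  have hCi : C⁻¹ ≤ 1 := inv_le_one_of_one_le₀ hC
  have hCip : 0 < C⁻¹ := inv_pos.mpr hC0
  have hlow : C⁻¹ * A ≤ (1 - ρ (α * s + β)) * A + ρ (α * s + β) * B := by
    have h₁ := (hρ.mem_Icc (α * s + β)).1
    have h₂ := (hρ.mem_Icc (α * s + β)).2
    nlinarith [mul_le_mul_of_nonneg_left hB h₁, mul_le_mul_of_nonneg_right hCi hA,
      mul_le_mul_of_nonneg_left (mul_le_mul_of_nonneg_right hCi hA) (sub_nonneg.mpr h₂)]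
  have hBA : |B - A| ≤ C * A := by
    rw [abs_le]; constructor <;> nlinarith [mul_nonneg hCip.le hA]
  have hbd : ∀ x, |x| ≤ α * M → |x * (B - A)| ≤
      η * ((1 - ρ (α * s + β)) * A + ρ (α * s + β) * B) := by
    intro x hx
    rw [abs_mul]
    have hαM : 0 ≤ α * M := mul_nonneg hα hM0
    calc |x| * |B - A| ≤ α * M * (C * A) := mul_le_mul hx hBA (abs_nonneg _) hαM
      _ = α * M * C ^ 2 * (C⁻¹ * A) := by field_simp
      _ ≤ η * (C⁻¹ * A) := mul_le_mul_of_nonneg_right hη (by positivity)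
      _ ≤ _ := mul_le_mul_of_nonneg_left hlow ((by positivity : 0 ≤ α * M * C ^ 2).trans hη)
  have hfun : (fun t => (1 - ρ (α * t + β)) * A + ρ (α * t + β) * B) =
      fun t => A + ρ (α * t + β) * (B - A) := by funext t; ring
  obtain ⟨h₁, h₂⟩ := deriv_comp_affine hρ α β s
  have hcd : ContDiff ℝ 2 fun t => ρ (α * t + β) :=
    (hρ.smooth.of_le (by norm_cast)).comp (by fun_prop)
  have hd : deriv (fun t => A + ρ (α * t + β) * (B - A)) =
      fun t => deriv (fun t => ρ (α * t + β)) t * (B - A) := by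
    funext t
    rw [deriv_const_add]
    exact deriv_mul_const (hcd.contDiffAt.differentiableAt (by simp)) _
  refine ⟨?_, ?_, ?_⟩
  · rw [hfun]; exact (contDiff_const.add (hcd.mul contDiff_const)).contDiffAt
  · rw [hfun, hd]
    dsimp only
    rw [h₁]
    refine hbd _ ?_
    rw [abs_mul, abs_of_nonneg hα]
    exact mul_le_mul_of_nonneg_left (hM _).1 hα
  · rw [hfun, hd, deriv_mul_const (differentiableAt_deriv hcd.contDiffAt), h₂]
    refine hbd _ ?_
    rw [abs_mul, abs_of_nonneg (by positivity)]
    nlinarith [mul_le_mul_of_nonneg_left (hM (α * s + β)).2 (sq_nonneg α), mul_nonneg hα hM0,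
      mul_nonneg (mul_nonneg hα hM0) (sub_nonneg.mpr hα1)]

/-- A transition between a function with slow variation and its value `A` at a nearby point has slow
variation, although the cut-off is fast.  This is the inner cut-off of hyperbolic forcing. -/
lemma slowAt_cut (hρ : IsCutoff ρ) {M : ℝ} (hM1 : 1 ≤ M) (hM : ∀ t, |deriv ρ t| ≤ M ∧
    |deriv (deriv ρ) t| ≤ M) {l A : ℝ} {p : ℝ → ℝ} (hη1 : η ≤ 1)
    (hp : SlowAt η p s) (hA : 0 < A) (h₁ : p s ≤ Real.exp (η / 2) * A)
    (h₂ : A ≤ Real.exp (η / 2) * p s) (hη : 0 ≤ η) :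
    SlowAt (40 * M * η) (fun t => (1 - ρ (2 * t + l)) * A + ρ (2 * t + l) * p t) s := by
  have he : Real.exp (η / 2) ≤ 1 + η := by
    have := Real.exp_bound' (x := η / 2) (by linarith) (by linarith) (n := 1) (by norm_num)
    norm_num at this
    linarith
  have hps : 0 < p s := by
    by_contra h
    push Not at h
    have := mul_nonpos_of_nonneg_of_nonpos (Real.exp_pos (η / 2)).le h
    linarith
  have h₁' : p s ≤ (1 + η) * A := h₁.trans (mul_le_mul_of_nonneg_right he hA.le)
  have h₂' : A ≤ (1 + η) * p s := h₂.trans (mul_le_mul_of_nonneg_right he hps.le)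
  have hpA : p s ≤ 2 * A := by nlinarith
  have hAp : A / 2 ≤ p s := by nlinarith
  have hdiff : |p s - A| ≤ 2 * η * A := by
    rw [abs_le]; constructor <;> nlinarith
  set k := fun t => ρ (2 * t + l) with hk
  have hk0 : 0 ≤ k s := (hρ.mem_Icc _).1
  have hk1 : k s ≤ 1 := (hρ.mem_Icc _).2
  have hcd : ContDiffAt ℝ 2 k s :=
    ((hρ.smooth.of_le (by norm_cast)).comp (by fun_prop)).contDiffAt
  have hcq : ContDiffAt ℝ 2 (fun t => p t - A) s := hp.1.sub contDiffAt_const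
  have hfun : (fun t => (1 - k t) * A + k t * p t) = fun t => A + k t * (p t - A) := by
    funext t; ring
  obtain ⟨d₁, d₂⟩ := deriv_comp_affine hρ 2 l s
  have hdq : deriv (fun t => p t - A) = deriv p := by funext t; exact deriv_sub_const A
  have hlow : A / 2 ≤ A + k s * (p s - A) := by nlinarith
  have hd : deriv (fun t => A + k t * (p t - A)) = deriv fun t => k t * (p t - A) := by
    funext t; exact deriv_const_add _
  have hk' : |deriv k s| ≤ 2 * M := by
    rw [d₁, abs_mul, abs_two]; linarith [(hM (2 * s + l)).1]
  have hk'' : |deriv (deriv k) s| ≤ 4 * M := by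
    rw [d₂, abs_mul]; norm_num; linarith [(hM (2 * s + l)).2]
  have hp' : |deriv p s| ≤ 2 * η * A := hp.2.trans (by nlinarith)
  have hp'' : |deriv (deriv p) s| ≤ 2 * η * A := hp.3.trans (by nlinarith)
  have hηA : 0 ≤ η * A := mul_nonneg hη hA.le
  have hM0 : 0 ≤ M := by linarith
  have hMη : η * A ≤ M * (η * A) := le_mul_of_one_le_left hηA hM1
  have hfin : ∀ x, |x| ≤ 20 * M * (η * A) → |x| ≤ 40 * M * η *
      ((1 - ρ (2 * s + l)) * A + ρ (2 * s + l) * p s) := by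
    intro x hx
    refine hx.trans ?_
    have e : (1 - ρ (2 * s + l)) * A + ρ (2 * s + l) * p s = A + k s * (p s - A) := by
      rw [hk]; ring
    rw [e]
    have := mul_le_mul_of_nonneg_left hlow (by positivity : 0 ≤ 40 * M * η)
    linarith
  refine ⟨?_, ?_, ?_⟩
  · rw [hfun]; exact contDiffAt_const.add (hcd.mul hcq)
  · rw [hfun, hd, (eventually_deriv_mul hcd hcq).eq_of_nhds, hdq]
    refine hfin _ ((abs_add_le _ _).trans ?_)
    rw [abs_mul, abs_mul, abs_of_nonneg hk0]
    have e₁ := mul_le_mul hk' hdiff (abs_nonneg _) (by positivity)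
    have e₂ := mul_le_mul hk1 hp' (abs_nonneg _) zero_le_one
    linarith
  · rw [hfun, hd, deriv_deriv_mul hcd hcq, hdq]
    refine hfin _ ((abs_add_le _ _).trans (add_le_add_left (abs_add_le _ _) _) |>.trans ?_)
    rw [abs_mul, abs_mul, abs_mul, abs_mul, abs_of_nonneg hk0, abs_two]
    have e₁ := mul_le_mul hk'' hdiff (abs_nonneg _) (by positivity)
    have e₂ := mul_le_mul hk1 hp'' (abs_nonneg _) zero_le_one
    have e₃ := mul_le_mul hk' hp' (abs_nonneg _) (by positivity)
    linarith

end Slow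

section SlowModel

variable {V : Type*} [Fintype V] [DecidableEq V] {K : PreAbstractSimplicialComplex V} {m : ℕ}
  {ρ : ℝ → ℝ} {ς c C₀ : ℝ} {d : ℕ → ℝ}

/-- In the limit `κ = 0`, the model on the cone of the link of `σ` varies slowly along rays. -/
def SlowModel (h : SphereFamily K m) (ρ : ℝ → ℝ) (ς c : ℝ) (d : ℕ → ℝ) (σ : Face K) (η : ℝ) :
    Prop :=
  ∀ (z a : LC m σ) (s : ℝ), SlowAt η (fun t => model h ρ ς c d σ 0 (Real.exp t • z) a a) s

/-- In the limit `κ = 0`, the model on the cone of the link of `σ` is equivalent to the Euclidean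
metric, with constant `C`, near the vertex. -/
def EquivModel (h : SphereFamily K m) (ρ : ℝ → ℝ) (ς c : ℝ) (d : ℕ → ℝ) (σ : Face K) (C : ℝ) :
    Prop :=
  ∀ z : LC m σ, ‖z‖ ≤ c * wt ς m σ.1.card → ∀ a,
    C⁻¹ * ‖a‖ ^ 2 ≤ model h ρ ς c d σ 0 z a a ∧ model h ρ ς c d σ 0 z a a ≤ C * ‖a‖ ^ 2

/-- The differential of `(T1, T2)` and its inverse are bounded on the sphere where forcing takes place: the
points with `τ` as simplex of least dimension stay, by `le_cc_apply`, in a compact part of the star. -/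
lemma exists_norm_D_bound (S : SmoothSphere K m) (hP : Params ς c C₀) (σ τ : Face K) :
    ∃ C, 1 ≤ C ∧ ∀ z : LC m σ, ‖z‖ = wt ς m σ.1.card → LeastNear S.h ς c σ z τ → ∀ a,
      C⁻¹ * ‖a‖ ^ 2 ≤ ‖D1 S.h σ τ z a‖ ^ 2 + ‖D2 S.h σ τ z a‖ ^ 2 ∧
        ‖D1 S.h σ τ z a‖ ^ 2 + ‖D2 S.h σ τ z a‖ ^ 2 ≤ C * ‖a‖ ^ 2 := by
  by_cases hστ : σ.1 ⊂ τ.1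
  swap
  · exact ⟨1, le_rfl, fun z _ hτ => absurd hτ.1.1 hστ⟩
  set A : Set (LC m σ) := {z | ‖z‖ = wt ς m σ.1.card ∧
    ∀ v, v ∈ τ.1 → v ∉ σ.1 → wt ς m τ.1.card ≤ cc S.h σ z v} with hA
  have hAc : IsCompact A := by
    refine Metric.isCompact_of_isClosed_isBounded ?_ ?_
    · refine (isClosed_eq continuous_norm continuous_const).inter ?_
      have : {z : LC m σ | ∀ v, v ∈ τ.1 → v ∉ σ.1 → wt ς m τ.1.card ≤ cc S.h σ z v} =
          ⋂ v : V, {z | v ∈ τ.1 → v ∉ σ.1 → wt ς m τ.1.card ≤ cc S.h σ z v} := by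
        ext z; simp
      change IsClosed {z : LC m σ | ∀ v, v ∈ τ.1 → v ∉ σ.1 → wt ς m τ.1.card ≤ cc S.h σ z v}
      rw [this]
      refine isClosed_iInter fun v => ?_
      by_cases h : v ∈ τ.1 ∧ v ∉ σ.1
      · simp only [h.1, h.2, forall_const, not_false_eq_true]
        exact isClosed_le continuous_const
          ((EuclideanSpace.proj v).continuous.comp (continuous_cc S.h σ))
      · have : {z : LC m σ | v ∈ τ.1 → v ∉ σ.1 → wt ς m τ.1.card ≤ cc S.h σ z v} = Set.univ := by
          ext z; simp only [Set.mem_ofPred_eq, Set.mem_univ, iff_true]; tauto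
        rw [this]; exact isClosed_univ
    · exact (Metric.isBounded_sphere (x := (0 : LC m σ)) (r := wt ς m σ.1.card)).subset
        fun z hz => by simpa using hz.1
  have hAs : A ⊆ starDom S.h σ τ := fun z hz v hv hv' => (hP.wt_pos _ _).trans_le (hz.2 v hv hv')
  set G : LC m σ × LC m σ → ℝ := fun q => ‖D1 S.h σ τ q.1 q.2‖ ^ 2 + ‖D2 S.h σ τ q.1 q.2‖ ^ 2
    with hG
  have hcont : ContinuousOn G (A ×ˢ Metric.sphere 0 1) := by
    intro q hq
    have h₁ := (contDiffAt_D1 S hστ.1 (hAs hq.1)).continuousAt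
    have h₂ := (contDiffAt_D2 S hστ.1 (hAs hq.1)).continuousAt
    have h₃ : ContinuousAt (fun q : LC m σ × LC m σ => D1 S.h σ τ q.1 q.2) q :=
      (ContinuousAt.comp (f := Prod.fst) h₁ continuousAt_fst).clm_apply continuousAt_snd
    have h₄ : ContinuousAt (fun q : LC m σ × LC m σ => D2 S.h σ τ q.1 q.2) q :=
      (ContinuousAt.comp (f := Prod.fst) h₂ continuousAt_fst).clm_apply continuousAt_snd
    exact ((h₃.norm.pow 2).add (h₄.norm.pow 2)).continuousWithinAt
  have hpos : ∀ q ∈ A ×ˢ Metric.sphere (0 : LC m σ) 1, 0 < G q := by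
    intro q hq
    by_contra hle
    have h₁ := sq_nonneg ‖D1 S.h σ τ q.1 q.2‖
    have h₂ := sq_nonneg ‖D2 S.h σ τ q.1 q.2‖
    simp only [hG, not_lt] at hle
    have h₃ : ‖D1 S.h σ τ q.1 q.2‖ ^ 2 = 0 := by linarith
    have h₄ : ‖D2 S.h σ τ q.1 q.2‖ ^ 2 = 0 := by linarith
    have h₅ := eq_zero_of_D S hστ.1 (hAs hq.1) (a := q.2) (by simpa using h₃) (by simpa using h₄)
    have h₆ := hq.2
    rw [h₅] at h₆
    simp at h₆
  have hc := hAc.prod (isCompact_sphere (0 : LC m σ) 1)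
  obtain ⟨B₁, hB₁⟩ := hc.exists_bound_of_continuousOn hcont
  obtain ⟨B₂, hB₂⟩ := hc.exists_bound_of_continuousOn (hcont.inv₀ fun q hq => (hpos q hq).ne')
  refine ⟨max 1 (max B₁ B₂), le_max_left _ _, fun z hz hτ a => ?_⟩
  set C := max 1 (max B₁ B₂) with hC
  have hC0 : 0 < C := zero_lt_one.trans_le (le_max_left _ _)
  by_cases ha : a = 0
  · simp [ha]
  have hn : 0 < ‖a‖ := norm_pos_iff.mpr ha
  have hzA : z ∈ A := ⟨hz, fun v hv hv' => le_cc_apply hP (by rw [hz]; linarith [hP.wt_pos m σ.1.card])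
    (by linarith [hP.two_le]) (hτ.1.mono hP hP.le) hτ.2 hv hv'⟩
  have hq : (z, ‖a‖⁻¹ • a) ∈ A ×ˢ Metric.sphere (0 : LC m σ) 1 :=
    ⟨hzA, by simp [norm_smul, hn.ne']⟩
  have hGa : ‖D1 S.h σ τ z a‖ ^ 2 + ‖D2 S.h σ τ z a‖ ^ 2 = G (z, ‖a‖⁻¹ • a) * ‖a‖ ^ 2 := by
    simp only [hG, map_smul, norm_smul, norm_inv, norm_norm]
    field_simp
  have h₁ : G (z, ‖a‖⁻¹ • a) ≤ C := (le_abs_self _).trans ((hB₁ _ hq).trans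
    ((le_max_left _ _).trans (le_max_right _ _)))
  have h₂ : (G (z, ‖a‖⁻¹ • a))⁻¹ ≤ C := (le_abs_self _).trans ((hB₂ _ hq).trans
    ((le_max_right _ _).trans (le_max_right _ _)))
  rw [hGa]
  refine ⟨mul_le_mul_of_nonneg_right ?_ (sq_nonneg _), mul_le_mul_of_nonneg_right h₁ (sq_nonneg _)⟩
  exact inv_le_of_inv_le₀ (hpos _ hq) h₂

/-- In the limit `κ = 0` distances become logarithms of norms. -/
lemma cutArg_zero {z w : ℝ} (hz : 0 < z) (hw : 0 < w) : cutArg 0 z w = Real.log z - Real.log w := by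
  have h : ∀ x : ℝ, 0 < x → x + √(x ^ 2 + 0 ^ 2) = 2 * x := fun x hx => by
    rw [zero_pow two_ne_zero, add_zero, Real.sqrt_sq hx.le]; ring
  rw [cutArg, h z hz, h w hw, Real.log_mul two_ne_zero hz.ne', Real.log_mul two_ne_zero hw.ne']
  ring

/-- Hyperbolic forcing along a ray, in the limit `κ = 0`: both cut-offs are functions of the logarithmic
radius `t`. -/
lemma model_exp_smul (h : SphereFamily K m) (hP : Params ς c C₀) {σ : Face K}
    (hσ : σ.1.card + 1 ≤ m) {z : LC m σ} (hz : z ≠ 0) (a : LC m σ) (t : ℝ) :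
    model h ρ ς c d σ 0 (Real.exp t • z) a a =
      (1 - ρ (2 * ((t + (Real.log ‖z‖ - Real.log (wt ς m σ.1.card)) + d (m - σ.1.card + 1)) /
        d (m - σ.1.card + 1)))) * ‖a‖ ^ 2 +
      ρ (2 * ((t + (Real.log ‖z‖ - Real.log (wt ς m σ.1.card)) + d (m - σ.1.card + 1)) /
        d (m - σ.1.card + 1))) *
      ((1 - ρ (2 * (t + (Real.log ‖z‖ - Real.log (wt ς m σ.1.card))))) *
          patB h ρ ς c d σ 0 ((wt ς m σ.1.card / ‖z‖) • z) a a +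
        ρ (2 * (t + (Real.log ‖z‖ - Real.log (wt ς m σ.1.card)))) *
          patB h ρ ς c d σ 0 (Real.exp t • z) a a) := by
  have hn : 0 < ‖z‖ := norm_pos_iff.mpr hz
  have he := Real.exp_pos t
  have h₁ : ‖Real.exp t • z‖ = Real.exp t * ‖z‖ := by rw [norm_smul, Real.norm_of_nonneg he.le]
  have h₂ : (wt ς m σ.1.card / ‖Real.exp t • z‖) • Real.exp t • z =
      (wt ς m σ.1.card / ‖z‖) • z := by
    rw [h₁, smul_smul]; congr 1; field_simp
  have h₃ : cutArg 0 ‖Real.exp t • z‖ (wt ς m σ.1.card) =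
      t + (Real.log ‖z‖ - Real.log (wt ς m σ.1.card)) := by
    rw [h₁, cutArg_zero (by positivity) (hP.wt_pos _ _), Real.log_mul he.ne' hn.ne', Real.log_exp]
    ring
  rw [model_of_le h hσ, forceB, if_neg (smul_ne_zero he.ne' hz), h₂, h₃]
  simp only [Bil.add_ev, Bil.smul_ev, Bil.eucl_ev, real_inner_self_eq_norm_sq]

set_option maxHeartbeats 1000000 in
/-- For large `d` the model with `κ = 0` varies slowly along rays.  The constant `C` of the comparison with
the Euclidean metric does not depend on the rate `η`; this makes the induction possible, since how
large `d` has to be for `σ` depends on the constants for the larger simplices. -/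
theorem exists_slowModel (S : SmoothSphere K m) (hρ : IsCutoff ρ) (hP : Params ς c C₀) (n : ℕ) :
    ∀ σ : Face K, Fintype.card V - σ.1.card < n → ∃ C, 1 ≤ C ∧ ∀ η, 0 < η → η ≤ 1 →
      ∃ D, ∀ d : ℕ → ℝ, (∀ i ∈ Finset.Icc 2 (m + 1), D ≤ d i) →
        SlowModel S.h ρ ς c d σ η ∧ EquivModel S.h ρ ς c d σ C := by
  induction n with
  | zero => intro σ hσ; omega
  | succ n ih =>
  intro σ hσ
  by_cases hm : σ.1.card + 1 ≤ m
  swap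
  · refine ⟨1, le_rfl, fun η hη _ => ⟨0, fun d _ => ⟨fun z a s => ?_, fun z _ a => ?_⟩⟩⟩
    · simp only [model_of_not_le S.h hm, Bil.eucl_ev]
      exact slowAt_const hη.le (by rw [real_inner_self_eq_norm_sq]; positivity)
    · rw [model_of_not_le S.h hm, Bil.eucl_ev, real_inner_self_eq_norm_sq]; simp
  -- constants for the larger simplices
  have ih' : ∀ τ : Face K, ∃ C, 1 ≤ C ∧ (σ.1 ⊂ τ.1 → ∀ η, 0 < η → η ≤ 1 →
      ∃ D, ∀ d : ℕ → ℝ, (∀ i ∈ Finset.Icc 2 (m + 1), D ≤ d i) →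
        SlowModel S.h ρ ς c d τ η ∧ EquivModel S.h ρ ς c d τ C) := by
    intro τ
    by_cases hτ : σ.1 ⊂ τ.1
    · have h₁ := Finset.card_lt_card hτ
      have h₂ := Finset.card_le_univ τ.1
      obtain ⟨C, hC, h⟩ := ih τ (by omega)
      exact ⟨C, hC, fun _ => h⟩
    · exact ⟨1, le_rfl, fun h => absurd h hτ⟩
  choose Cτ hCτ hrec using ih'
  choose Bτ hBτ hbd using exists_norm_D_bound S hP σ
  obtain ⟨C₁, hC₁⟩ : ∃ C₁, ∀ τ, Cτ τ * Bτ τ ≤ C₁ := by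
    obtain ⟨C₁, h⟩ := (Set.finite_range fun τ => Cτ τ * Bτ τ).bddAbove
    exact ⟨C₁, fun τ => h ⟨τ, rfl⟩⟩
  have hC₁1 : 1 ≤ C₁ := by nlinarith [hC₁ σ, hCτ σ, hBτ σ]
  obtain ⟨M, hM1, hM⟩ := hρ.exists_bound
  have hc2 := hP.two_le
  refine ⟨c * C₁, by nlinarith, fun η hη hη1 => ?_⟩
  -- the rate for the larger simplices: the inner cut-off multiplies it by `40 M`, see `slowAt_cut`
  set η' := η / (40 * M) with hη'
  have hη'0 : 0 < η' := by positivity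
  have hη'η : 40 * M * η' = η := by rw [hη']; field_simp
  have hη'le : η' ≤ η := by nlinarith
  have hD : ∀ τ : Face K, ∃ D, σ.1 ⊂ τ.1 → ∀ d : ℕ → ℝ, (∀ i ∈ Finset.Icc 2 (m + 1), D ≤ d i) →
      SlowModel S.h ρ ς c d τ η' ∧ EquivModel S.h ρ ς c d τ (Cτ τ) := by
    intro τ
    by_cases hτ : σ.1 ⊂ τ.1
    · obtain ⟨D, h⟩ := hrec τ hτ η' hη'0 (hη'le.trans hη1)
      exact ⟨D, fun _ => h⟩
    · exact ⟨1, fun h => absurd h hτ⟩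
  choose Dτ hDτ using hD
  obtain ⟨D₁, hD₁⟩ : ∃ D₁, ∀ τ, Dτ τ ≤ D₁ := by
    obtain ⟨D₁, h⟩ := (Set.finite_range Dτ).bddAbove
    exact ⟨D₁, fun τ => h ⟨τ, rfl⟩⟩
  -- the third bound makes the outer cut-off slow enough, see `slowAt_transition` with `α = 2 / d`
  refine ⟨max D₁ (max 2 (2 * M * C₁ ^ 2 / η)), fun d hd => ?_⟩
  have hd₁ : ∀ i ∈ Finset.Icc 2 (m + 1), D₁ ≤ d i := fun i hi => (le_max_left _ _).trans (hd i hi)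
  have hd₂ : ∀ i ∈ Finset.Icc 2 (m + 1), 2 ≤ d i := fun i hi =>
    (le_max_left _ _).trans ((le_max_right _ _).trans (hd i hi))
  have hd₃ : ∀ i ∈ Finset.Icc 2 (m + 1), 2 * M * C₁ ^ 2 / η ≤ d i := fun i hi =>
    (le_max_right _ _).trans ((le_max_right _ _).trans (hd i hi))
  have hslow : ∀ τ : Face K, σ.1 ⊂ τ.1 → SlowModel S.h ρ ς c d τ η' := fun τ hτ =>
    (hDτ τ hτ d fun i hi => (hD₁ τ).trans (hd₁ i hi)).1
  have hequiv : ∀ τ : Face K, σ.1 ⊂ τ.1 → EquivModel S.h ρ ς c d τ (Cτ τ) := fun τ hτ =>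
    (hDτ τ hτ d fun i hi => (hD₁ τ).trans (hd₁ i hi)).2
  have hS : Small K m ς d 0 := by
    refine ⟨fun τ hτ => ?_, fun τ hτ => ?_⟩
    · linarith [hd₂ (m - τ.1.card + 1) (Finset.mem_Icc.mpr (by omega))]
    · rw [abs_zero]; exact mul_pos (Real.exp_pos _) (hP.wt_pos _ _)
  have hcone := isConeMetric_model (ς := ς) (c := c) (d := d) (κ := 0) S hρ hP _ σ
    (Nat.lt_succ_self _)
  have hconeP : ∀ z : LC m σ, wt ς m σ.1.card / 2 ≤ ‖z‖ →
      IsConeMetric z (patB S.h ρ ς c d σ 0 z) := fun z hz =>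
    isConeMetric_patB S hP (fun τ _ => isConeMetric_model S hρ hP _ τ (Nat.lt_succ_self _)) hz
  set w := wt ς m σ.1.card with hw
  have hw0 : 0 < w := hP.wt_pos _ _
  set δ := d (m - σ.1.card + 1) with hδ
  have hmem : m - σ.1.card + 1 ∈ Finset.Icc 2 (m + 1) := Finset.mem_Icc.mpr (by omega)
  have hδ2 : 2 ≤ δ := hd₂ _ hmem
  -- the patched metric
  have hpat : ∀ (z a : LC m σ) (s : ℝ), w / 2 < Real.exp s * ‖z‖ →
      SlowAt η' (fun t => patB S.h ρ ς c d σ 0 (Real.exp t • z) a a) s := by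
    intro z a s hs
    have hnorm : ‖Real.exp s • z‖ = Real.exp s * ‖z‖ := by
      rw [norm_smul, Real.norm_of_nonneg (Real.exp_pos s).le]
    obtain ⟨τ, hτ, hev⟩ := eventually_patB_eq S hρ hP hS (σ := σ) (z := Real.exp s • z)
      (by rw [hnorm]; exact hs)
    have hcont : ContinuousAt (fun t : ℝ => ((0 : ℝ), Real.exp t • z)) s := by fun_prop
    have hev' : (fun t => patB S.h ρ ς c d σ 0 (Real.exp t • z) a a) =ᶠ[nhds s] fun t =>
        ‖D1 S.h σ τ z a‖ ^ 2 + model S.h ρ ς c d τ 0 (Real.exp t • T2 S.h σ τ z)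
          (D2 S.h σ τ z a) (D2 S.h σ τ z a) := by
      filter_upwards [hcont.eventually hev] with t ht
      rw [ht, extB_ev, D1_smul S.h (Real.exp_pos t), D2_smul S.h (Real.exp_pos t),
        T2_smul S.h (Real.exp_pos t).le, real_inner_self_eq_norm_sq]
    exact ((hslow τ hτ.1.1 _ _ s).const_add hη'0.le (sq_nonneg _)).congr hev'
  -- the patched metric on the sphere where forcing takes place
  have hsph : ∀ z a : LC m σ, ‖z‖ = w → C₁⁻¹ * ‖a‖ ^ 2 ≤ patB S.h ρ ς c d σ 0 z a a ∧
      patB S.h ρ ς c d σ 0 z a a ≤ C₁ * ‖a‖ ^ 2 := by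
    intro z a hz
    have hz0 : z ≠ 0 := fun h => by rw [h, norm_zero] at hz; exact hw0.ne hz
    obtain ⟨τ, hτ, heq⟩ := patB_eq (ρ := ρ) (d := d) (κ := 0) S.h
      (exists_leastNear (h := S.h) (σ := σ) hP hz0 (C := c) (by linarith))
    have hdom := hτ.mem_starDom hP (by rw [hz]; linarith)
    obtain ⟨h₁, h₂⟩ := hbd τ z hz hτ a
    obtain ⟨h₃, h₄⟩ := hequiv τ hτ.1.1 (T2 S.h σ τ z)
      (by rw [norm_T2 S.h hτ.1.1.1 hdom]; exact hτ.1.2.2) (D2 S.h σ τ z a)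
    rw [heq, extB_ev, real_inner_self_eq_norm_sq]
    have hCi : (Cτ τ)⁻¹ ≤ 1 := inv_le_one_of_one_le₀ (hCτ τ)
    have hCp : 0 < Cτ τ := by linarith [hCτ τ]
    have hBp : 0 < Bτ τ := by linarith [hBτ τ]
    have s₁ := sq_nonneg ‖D1 S.h σ τ z a‖
    have s₂ := sq_nonneg ‖a‖
    constructor
    · have e₁ : C₁⁻¹ ≤ (Cτ τ)⁻¹ * (Bτ τ)⁻¹ := by
        rw [← mul_inv]; exact inv_anti₀ (by positivity) (hC₁ τ)
      have e₂ := mul_le_mul_of_nonneg_left h₁ (inv_pos.mpr hCp).le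
      nlinarith [mul_le_mul_of_nonneg_right e₁ s₂, mul_le_mul_of_nonneg_right hCi s₁]
    · have e₂ := mul_le_mul_of_nonneg_left h₂ hCp.le
      nlinarith [mul_le_mul_of_nonneg_right (hC₁ τ) s₂, mul_le_mul_of_nonneg_right (hCτ τ) s₁]
  have hrad : ∀ z : LC m σ, z ≠ 0 → ‖(w / ‖z‖) • z‖ = w := fun z hz => by
    have hn : 0 < ‖z‖ := norm_pos_iff.mpr hz
    rw [norm_smul, Real.norm_of_nonneg (by positivity), div_mul_cancel₀ _ hn.ne']
  have hexpl : ∀ z : LC m σ, z ≠ 0 → ∀ t,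
      Real.exp t * ‖z‖ = w * Real.exp (t + (Real.log ‖z‖ - Real.log w)) := fun z hz t => by
    have hn : 0 < ‖z‖ := norm_pos_iff.mpr hz
    rw [Real.exp_add, Real.exp_sub, Real.exp_log hn, Real.exp_log hw0]
    field_simp
  have hslowσ : SlowModel S.h ρ ς c d σ η := by
    intro z a s
    by_cases hz : z = 0
    · simp only [hz, smul_zero, model_of_le S.h hm, forceB, if_true, Bil.eucl_ev]
      exact slowAt_const hη.le (by rw [real_inner_self_eq_norm_sq]; positivity)
    by_cases ha : a = 0
    · simp only [ha, Bil.ev_zero_left]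
      exact slowAt_const hη.le le_rfl
    have hfun : (fun t => model S.h ρ ς c d σ 0 (Real.exp t • z) a a) = _ :=
      funext fun t => model_exp_smul S.h hP hm hz a t
    rw [hfun]
    obtain ⟨e₁, e₂⟩ := hsph _ a (hrad z hz)
    have hn : 0 < ‖z‖ := norm_pos_iff.mpr hz
    set l := Real.log ‖z‖ - Real.log w with hl
    set P₀ := patB S.h ρ ς c d σ 0 ((w / ‖z‖) • z) a a with hP₀
    by_cases hu : s + l < 0
    · -- inside the sphere of radius `w`: a transition from the Euclidean metric to the values of the
      -- patched metric on this sphere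
      have hα : 2 / δ * M * C₁ ^ 2 ≤ η := by
        have := hd₃ _ hmem
        rw [div_le_iff₀ hη] at this
        rw [div_mul_eq_mul_div, div_mul_eq_mul_div, div_le_iff₀ (by linarith)]
        linarith
      refine (slowAt_transition (α := 2 / δ) (β := 2 * ((l + δ) / δ)) hρ hM (by positivity)
        (by rw [div_le_one (by linarith)]; exact hδ2) (sq_nonneg ‖a‖) hC₁1 e₁ e₂ hα).congr ?_
      have hev : ∀ᶠ t in nhds s, t + l < 0 :=
        (continuous_id.add continuous_const).continuousAt.eventually_lt continuousAt_const hu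
      filter_upwards [hev] with t ht
      rw [hρ.eq_zero (t := 2 * (t + l)) (by linarith)]
      have : 2 * ((t + l + δ) / δ) = 2 / δ * t + 2 * ((l + δ) / δ) := by field_simp; ring
      rw [this]
      ring
    push Not at hu
    have hs2 : w / 2 < Real.exp s * ‖z‖ := by
      rw [hexpl z hz]
      nlinarith [Real.one_le_exp hu]
    set p := fun t => patB S.h ρ ς c d σ 0 (Real.exp t • z) a a with hp
    have hppos : ∀ t, w / 2 < Real.exp t * ‖z‖ → 0 < p t := fun t ht =>
      (hconeP _ (by rw [norm_smul, Real.norm_of_nonneg (Real.exp_pos t).le]; exact ht.le)).pos a ha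
    have hev : ∀ᶠ t in nhds s, -(1 / 2) < t + l := continuousAt_const.eventually_lt
      (continuous_id.add continuous_const).continuousAt (by change -(1 / 2) < s + l; linarith)
    have hχ : ∀ t, -(1 / 2) < t + l → ρ (2 * ((t + l + δ) / δ)) = 1 := fun t ht => by
      refine hρ.eq_one ?_
      have : 1 / 2 ≤ (t + l + δ) / δ := by rw [le_div_iff₀ (by linarith)]; linarith
      linarith
    by_cases hu1 : s + l ≤ 1 / 2
    · -- between the radii `w` and `e^{1/2} w`: a transition from these values to the patched metric
      have hP₀p : P₀ = p (-l) := by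
        simp only [hP₀, hp, hl]
        rw [neg_sub, Real.exp_sub, Real.exp_log hn, Real.exp_log hw0]
      have hseg := le_exp_mul (η := η') (f := p) (s := -l) (t := s) fun x hx => by
        rw [Set.uIcc_of_le (by linarith)] at hx
        have hx' : w / 2 < Real.exp x * ‖z‖ := by
          rw [hexpl z hz]
          nlinarith [Real.one_le_exp (show 0 ≤ x + l by linarith [hx.1])]
        exact ⟨hpat z a x hx', hppos x hx'⟩
      have habs : η' * |s - -l| ≤ η' / 2 := by
        rw [abs_of_nonneg (by linarith)]; nlinarith
      have hexp := Real.exp_le_exp.mpr habs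
      have hp0 : 0 < p (-l) := hppos _ (by
        rw [hexpl z hz, neg_add_cancel, Real.exp_zero]; linarith)
      have h := slowAt_cut (s := s) (l := 2 * l) hρ hM1 hM (hη'le.trans hη1) (hpat z a s hs2)
        (A := P₀) (by rw [hP₀p]; exact hp0)
        (by rw [hP₀p]; exact hseg.1.trans (mul_le_mul_of_nonneg_right hexp hp0.le))
        (by rw [hP₀p]; exact hseg.2.trans (mul_le_mul_of_nonneg_right hexp (hppos s hs2).le))
        hη'0.le
      rw [hη'η] at h
      refine h.congr ?_
      filter_upwards [hev] with t ht
      rw [hχ t ht, show 2 * (t + l) = 2 * t + 2 * l by ring]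
      ring
    · -- farther out the model is the patched metric
      push Not at hu1
      refine ((hpat z a s hs2).mono hη'le (hppos s hs2).le).congr ?_
      have hev2 : ∀ᶠ t in nhds s, 1 / 2 < t + l := continuousAt_const.eventually_lt
        (continuous_id.add continuous_const).continuousAt hu1
      filter_upwards [hev2] with t ht
      rw [hχ t (by linarith), hρ.eq_one (t := 2 * (t + l)) (by linarith)]
      ring
  refine ⟨hslowσ, ?_⟩
  -- the equivalence with the Euclidean metric
  have hball : ∀ z a : LC m σ, ‖z‖ ≤ w → C₁⁻¹ * ‖a‖ ^ 2 ≤ model S.h ρ ς c d σ 0 z a a ∧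
      model S.h ρ ς c d σ 0 z a a ≤ C₁ * ‖a‖ ^ 2 := by
    intro z a hz
    have hi : C₁⁻¹ ≤ 1 := inv_le_one_of_one_le₀ hC₁1
    have s₁ := sq_nonneg ‖a‖
    by_cases hz0 : z = 0
    · rw [model_of_le S.h hm, forceB, if_pos hz0, Bil.eucl_ev, real_inner_self_eq_norm_sq]
      constructor <;> nlinarith
    have h := model_exp_smul (ρ := ρ) (d := d) S.h hP hm hz0 a 0
    rw [Real.exp_zero, one_smul] at h
    have hle : Real.log ‖z‖ - Real.log w ≤ 0 :=
      sub_nonpos.mpr (Real.log_le_log (norm_pos_iff.mpr hz0) hz)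
    rw [h, hρ.eq_zero (t := 2 * (0 + (Real.log ‖z‖ - Real.log w))) (by linarith)]
    obtain ⟨e₁, e₂⟩ := hsph _ a (hrad z hz0)
    set x := ρ (2 * ((0 + (Real.log ‖z‖ - Real.log w) + δ) / δ)) with hx
    have hx0 : 0 ≤ x := (hρ.mem_Icc _).1
    have hx1 : 0 ≤ 1 - x := sub_nonneg.mpr (hρ.mem_Icc _).2
    have t₁ := mul_le_mul_of_nonneg_left e₁ hx0
    have t₂ := mul_le_mul_of_nonneg_left e₂ hx0
    have t₃ := mul_le_mul_of_nonneg_left (mul_le_mul_of_nonneg_right hi s₁) hx1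
    have t₄ := mul_le_mul_of_nonneg_left (mul_le_mul_of_nonneg_right hC₁1 s₁) hx1
    constructor <;> linarith
  intro z hz a
  have hcC : (c * C₁)⁻¹ ≤ C₁⁻¹ := inv_anti₀ (by linarith) (by nlinarith)
  have s₁ := sq_nonneg ‖a‖
  by_cases hzw : ‖z‖ ≤ w
  · obtain ⟨e₁, e₂⟩ := hball z a hzw
    have t₁ := mul_le_mul_of_nonneg_right hcC s₁
    have t₂ := mul_le_mul_of_nonneg_right (show C₁ ≤ c * C₁ by nlinarith) s₁
    exact ⟨t₁.trans e₁, e₂.trans t₂⟩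
  push Not at hzw
  have hz0 : z ≠ 0 := fun h => by rw [h, norm_zero] at hzw; linarith
  by_cases ha : a = 0
  · simp [ha]
  have hn : 0 < ‖z‖ := norm_pos_iff.mpr hz0
  -- for `w < ‖z‖ ≤ c w`, slow variation along the ray through `z` costs at most the factor `c`
  set t := Real.log (‖z‖ / w) with ht
  have ht0 : 0 ≤ t := Real.log_nonneg (by rw [one_le_div hw0]; exact hzw.le)
  have htc : t ≤ Real.log c := Real.log_le_log (by positivity) (by rwa [div_le_iff₀ hw0])
  have hseg := le_exp_mul (η := η)
    (f := fun t => model S.h ρ ς c d σ 0 (Real.exp t • (w / ‖z‖) • z) a a) (s := 0) (t := t)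
    fun x _ => ⟨hslowσ _ a x, (hcone _).pos a ha⟩
  have hez : Real.exp t • (w / ‖z‖) • z = z := by
    rw [ht, Real.exp_log (by positivity), smul_smul]
    convert one_smul ℝ z using 2
    field_simp
  simp only [Real.exp_zero, one_smul, hez, sub_zero] at hseg
  have hexp : Real.exp (η * |t|) ≤ c := by
    rw [abs_of_nonneg ht0, ← Real.exp_log (show 0 < c by linarith)]
    refine Real.exp_le_exp.mpr ?_
    nlinarith
  obtain ⟨e₁, e₂⟩ := hball _ a (hrad z hz0).le
  have p₁ := (hcone z).pos a ha
  have p₂ := (hcone ((w / ‖z‖) • z)).pos a ha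
  constructor
  · have := hseg.2.trans (mul_le_mul_of_nonneg_right hexp p₁.le)
    rw [mul_inv, mul_assoc, inv_mul_le_iff₀ (by linarith)]
    linarith
  · have := hseg.1.trans (mul_le_mul_of_nonneg_right hexp p₂.le)
    nlinarith

end SlowModel

/-! ### The coefficients of the metric in a radial chart -/

section Entry

variable {k n : ℕ} {Y : Type*} [NormedAddCommGroup Y] [InnerProductSpace ℝ Y]

/-- Gram–Schmidt for an abstract scalar product. -/
lemma exists_orthonormal_frame {X : Type*} [AddCommGroup X] [Module ℝ X] [FiniteDimensional ℝ X]
    (hk : Module.finrank ℝ X = k) (β : X →ₗ[ℝ] X →ₗ[ℝ] ℝ) (hs : ∀ a b, β a b = β b a)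
    (hp : ∀ a, a ≠ 0 → 0 < β a a) : ∃ L : E k →ₗ[ℝ] X, ∀ a b, β (L a) (L b) = inner ℝ a b := by
  let core : InnerProductSpace.Core ℝ X :=
    { inner := fun a b => β a b
      conj_inner_symm := fun a b => hs b a
      re_inner_nonneg := fun a => by
        by_cases ha : a = 0
        · simp [ha]
        · exact (hp a ha).le
      add_left := fun a b c => by simp
      smul_left := fun a b r => by simp
      definite := fun a ha => by
        by_contra h
        exact (hp a h).ne' ha }
  let _ : NormedAddCommGroup X := core.toNormedAddCommGroup
  let _ : InnerProductSpace ℝ X := InnerProductSpace.ofCore core.toCore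
  let b := (stdOrthonormalBasis ℝ X).reindex (finCongr hk)
  refine ⟨b.repr.symm.toLinearEquiv.toLinearMap, fun x y => ?_⟩
  have := b.repr.symm.inner_map_map x y
  exact this

/-- The factor by which `sinh` grows along a ray: `sinh (b + t) = chartS μ t · sinh b` for
`μ = 1 / sinh b`. -/
def chartS (μ t : ℝ) : ℝ := Real.cosh t + √(1 + μ ^ 2) * Real.sinh t

/-- The scalar product of the images of two vectors under the linear map `(B₁, B₂)`. -/
def frameInner (B₁ : E k →L[ℝ] Y) (B₂ : E k →L[ℝ] E n) (a b : E k) : ℝ :=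
  inner ℝ (B₁ a) (B₁ b) + inner ℝ (B₂ a) (B₂ b)

/-- The norm of `q + μ (B₁, B₂) x`, for a unit vector `q` orthogonal to the image of `(B₁, B₂)`. -/
def chartN (μ : ℝ) (B₁ : E k →L[ℝ] Y) (B₂ : E k →L[ℝ] E n) (x : E k) : ℝ :=
  √(1 + μ ^ 2 * frameInner B₁ B₂ x x)

/-- The parameters `(κ, μ, v, B₁, B₂)` of a radial chart: the scale `κ`, the inverse `μ` of the hyperbolic
sine of the distance from the origin to the center, the component `v` of the center normal to the
simplex, in units of `κ⁻¹`, and the tangential and normal components of a frame. -/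
abbrev ChartParam (k n : ℕ) (Y : Type*) [NormedAddCommGroup Y] [InnerProductSpace ℝ Y] : Type _ :=
  ℝ × ℝ × E n × (E k →L[ℝ] Y) × (E k →L[ℝ] E n)

/-- The coefficient of the metric in the directions `a`, `b` tangent to the spheres, in a radial
chart with parameters `(κ, μ, v, B₁, B₂)`, minus that of the model metric. -/
def chartEntry (F : ℝ → E n → Bil n) (a b : E k) (P : ChartParam k n Y) (q : E k × ℝ) : ℝ :=
  chartS P.2.1 q.2 ^ 2 *
    ((inner ℝ (P.2.2.2.1 a) (P.2.2.2.1 b) +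
        F P.1 ((chartS P.2.1 q.2 / chartN P.2.1 P.2.2.2.1 P.2.2.2.2 q.1) •
          (P.2.2.1 + P.1 • P.2.2.2.2 q.1)) (P.2.2.2.2 a) (P.2.2.2.2 b)) /
        chartN P.2.1 P.2.2.2.1 P.2.2.2.2 q.1 ^ 2 -
      P.2.1 ^ 2 * (frameInner P.2.2.2.1 P.2.2.2.2 q.1 a * frameInner P.2.2.2.1 P.2.2.2.2 q.1 b) /
        chartN P.2.1 P.2.2.2.1 P.2.2.2.2 q.1 ^ 4) -
    Real.exp (2 * q.2) * inner ℝ a b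

lemma frameInner_self_nonneg (B₁ : E k →L[ℝ] Y) (B₂ : E k →L[ℝ] E n) (a : E k) :
    0 ≤ frameInner B₁ B₂ a a := by
  rw [frameInner, real_inner_self_eq_norm_sq, real_inner_self_eq_norm_sq]; positivity

lemma one_le_chartN (μ : ℝ) (B₁ : E k →L[ℝ] Y) (B₂ : E k →L[ℝ] E n) (x : E k) :
    1 ≤ chartN μ B₁ B₂ x := by
  rw [chartN, Real.one_le_sqrt]
  have := mul_nonneg (sq_nonneg μ) (frameInner_self_nonneg B₁ B₂ x)
  linarith

lemma chartN_sq (μ : ℝ) (B₁ : E k →L[ℝ] Y) (B₂ : E k →L[ℝ] E n) (x : E k) :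
    chartN μ B₁ B₂ x ^ 2 = 1 + μ ^ 2 * frameInner B₁ B₂ x x := by
  rw [chartN, Real.sq_sqrt]
  have := mul_nonneg (sq_nonneg μ) (frameInner_self_nonneg B₁ B₂ x)
  linarith

lemma contDiff_chartS : ContDiff ℝ ∞ fun p : ℝ × ℝ => chartS p.1 p.2 := by
  unfold chartS
  refine (Real.contDiff_cosh.comp contDiff_snd).add (ContDiff.mul ?_
    (Real.contDiff_sinh.comp contDiff_snd))
  refine ContDiff.sqrt (by fun_prop) fun p => by positivity

variable {F : ℝ → E n → Bil n}

lemma contDiffAt_chartEntry [FiniteDimensional ℝ Y] (a b : E k) (P : ChartParam k n Y) (q : E k × ℝ)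
    (hF : ∀ v, ContDiffAt ℝ ∞ (fun p : ℝ × E n => F p.1 p.2) (P.1, v)) :
    ContDiffAt ℝ ∞ (fun p : ChartParam k n Y × (E k × ℝ) => chartEntry F a b p.1 p.2) (P, q) := by
  set T := ChartParam k n Y × (E k × ℝ)
  have hκ : ContDiff ℝ ∞ fun p : T => p.1.1 := by fun_prop
  have hμ : ContDiff ℝ ∞ fun p : T => p.1.2.1 := by fun_prop
  have hv : ContDiff ℝ ∞ fun p : T => p.1.2.2.1 := by fun_prop
  have hB₁ : ContDiff ℝ ∞ fun p : T => p.1.2.2.2.1 := by fun_prop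
  have hB₂ : ContDiff ℝ ∞ fun p : T => p.1.2.2.2.2 := by fun_prop
  have hx : ContDiff ℝ ∞ fun p : T => p.2.1 := by fun_prop
  have ht : ContDiff ℝ ∞ fun p : T => p.2.2 := by fun_prop
  have hS : ContDiff ℝ ∞ fun p : T => chartS p.1.2.1 p.2.2 := contDiff_chartS.comp (hμ.prodMk ht)
  have hfi : ∀ u w : T → E k, ContDiff ℝ ∞ u → ContDiff ℝ ∞ w →
      ContDiff ℝ ∞ fun p : T => frameInner p.1.2.2.2.1 p.1.2.2.2.2 (u p) (w p) := by
    intro u w hu hw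
    unfold frameInner
    exact ((hB₁.clm_apply hu).inner ℝ (hB₁.clm_apply hw)).add
      ((hB₂.clm_apply hu).inner ℝ (hB₂.clm_apply hw))
  have hN : ContDiff ℝ ∞ fun p : T => chartN p.1.2.1 p.1.2.2.2.1 p.1.2.2.2.2 p.2.1 := by
    unfold chartN
    refine ContDiff.sqrt (contDiff_const.add ((hμ.pow 2).mul (hfi _ _ hx hx))) fun p => ?_
    have := mul_nonneg (sq_nonneg p.1.2.1)
      (frameInner_self_nonneg p.1.2.2.2.1 p.1.2.2.2.2 p.2.1)
    linarith
  have hN0 : ∀ p : T, chartN p.1.2.1 p.1.2.2.2.1 p.1.2.2.2.2 p.2.1 ≠ 0 := fun p =>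
    (zero_lt_one.trans_le (one_le_chartN _ _ _ _)).ne'
  have hbase : ContDiff ℝ ∞ fun p : T =>
      (chartS p.1.2.1 p.2.2 / chartN p.1.2.1 p.1.2.2.2.1 p.1.2.2.2.2 p.2.1) •
        (p.1.2.2.1 + p.1.1 • p.1.2.2.2.2 p.2.1) :=
    (hS.div hN hN0).smul (hv.add (hκ.smul (hB₂.clm_apply hx)))
  have hFc : ContDiffAt ℝ ∞ (fun p : T => F p.1.1
      ((chartS p.1.2.1 p.2.2 / chartN p.1.2.1 p.1.2.2.2.1 p.1.2.2.2.2 p.2.1) •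
        (p.1.2.2.1 + p.1.1 • p.1.2.2.2.2 p.2.1))) (P, q) :=
    ContDiffAt.comp (P, q) (g := fun p : ℝ × E n => F p.1 p.2)
      (f := fun p : T => (p.1.1,
        (chartS p.1.2.1 p.2.2 / chartN p.1.2.1 p.1.2.2.2.1 p.1.2.2.2.2 p.2.1) •
          (p.1.2.2.1 + p.1.1 • p.1.2.2.2.2 p.2.1))) (hF _) (hκ.prodMk hbase).contDiffAt
  unfold chartEntry
  refine ((hS.contDiffAt.pow 2).mul (ContDiffAt.sub (ContDiffAt.div (ContDiffAt.add ?_ ?_)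
    (hN.contDiffAt.pow 2) (pow_ne_zero _ (hN0 _))) (ContDiffAt.div ?_ (hN.contDiffAt.pow 4)
      (pow_ne_zero _ (hN0 _))))).sub ?_
  · exact ((hB₁.clm_apply contDiff_const).inner ℝ (hB₁.clm_apply contDiff_const)).contDiffAt
  · exact Bil.contDiffAt_ev hFc (hB₂.clm_apply contDiff_const).contDiffAt
      (hB₂.clm_apply contDiff_const).contDiffAt
  · exact ((hμ.pow 2).mul ((hfi _ _ hx contDiff_const).mul (hfi _ _ hx contDiff_const))).contDiffAt
  · exact ((Real.contDiff_exp.comp (contDiff_const.mul ht)).mul contDiff_const).contDiffAt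

/-- The sum of the norms of the derivatives of order at most two with respect to the second
variable is continuous. -/
lemma continuousAt_jet {T X : Type*} [NormedAddCommGroup T] [NormedSpace ℝ T]
    [NormedAddCommGroup X] [NormedSpace ℝ X] {f : T → X → ℝ} {p : T × X}
    (hf : ∀ᶠ p in nhds p, ContDiffAt ℝ ∞ (Function.uncurry f) p) :
    ContinuousAt (fun p : T × X => ‖f p.1 p.2‖ + ‖fderiv ℝ (f p.1) p.2‖ +
      ‖fderiv ℝ (fderiv ℝ (f p.1)) p.2‖) p := by
  have h₀ := hf.self_of_nhds
  have hstep : ∀ p, ContDiffAt ℝ ∞ (Function.uncurry f) p →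
      ContDiffAt ℝ ∞ (fun p : T × X => fderiv ℝ (f p.1) p.2) p := fun p hp => by
    refine ContDiffAt.fderiv (f := fun (p : T × X) (x : X) => f p.1 x) (g := Prod.snd) (n := ∞)
      ?_ contDiffAt_snd (by simp)
    exact ContDiffAt.comp (g := Function.uncurry f)
      (f := fun r : (T × X) × X => (r.1.1, r.2)) _ hp (by fun_prop)
  have h₁ := hstep p h₀
  have h₂ : ContDiffAt ℝ ∞ (fun p : T × X => fderiv ℝ (fderiv ℝ (f p.1)) p.2) p := by
    refine ContDiffAt.fderiv (f := fun (p : T × X) (x : X) => fderiv ℝ (f p.1) x) (g := Prod.snd)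
      (n := ∞) ?_ contDiffAt_snd (by simp)
    exact ContDiffAt.comp (g := fun p : T × X => fderiv ℝ (f p.1) p.2)
      (f := fun r : (T × X) × X => (r.1.1, r.2)) _ h₁ (by fun_prop)
  exact (h₀.continuousAt.norm.add h₁.continuousAt.norm).add
    ((continuous_norm (E := X →L[ℝ] (X →L[ℝ] ℝ))).continuousAt.comp h₂.continuousAt)

/-- A uniform version of an estimate on the zero set of a function. -/
lemma exists_uniform_of_zero {T X : Type*} [TopologicalSpace T] [TopologicalSpace X] {A : Set T}
    {Q : Set X} (hA : IsCompact A) (hQ : IsCompact Q) (hc : IsClosed (A ×ˢ Q)) {J : T × X → ℝ}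
    (hJ : ContinuousOn J (A ×ˢ Q)) {θ : T → ℝ} (hθ : Continuous θ) (hθ0 : ∀ p ∈ A, 0 ≤ θ p) {ε : ℝ}
    (h : ∀ p ∈ A, θ p = 0 → ∀ q ∈ Q, J (p, q) < ε) :
    ∃ κ, 0 < κ ∧ ∀ p ∈ A, θ p < κ → ∀ q ∈ Q, J (p, q) < ε := by
  have hbad : IsCompact ((A ×ˢ Q) ∩ J ⁻¹' Set.Ici ε) :=
    (hA.prod hQ).of_isClosed_subset (hJ.preimage_isClosed_of_isClosed hc isClosed_Ici)
      Set.inter_subset_left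
  rcases Set.eq_empty_or_nonempty ((A ×ˢ Q) ∩ J ⁻¹' Set.Ici ε) with he | hne
  · refine ⟨1, one_pos, fun p hp _ q hq => ?_⟩
    by_contra hlt
    have : (p, q) ∈ (A ×ˢ Q) ∩ J ⁻¹' Set.Ici ε := ⟨⟨hp, hq⟩, not_lt.mp hlt⟩
    rw [he] at this
    exact this
  · obtain ⟨r, hr, hmin⟩ := hbad.exists_isMinOn hne (hθ.comp continuous_fst).continuousOn
    refine ⟨θ r.1, ?_, fun p hp hlt q hq => ?_⟩
    · refine lt_of_le_of_ne (hθ0 _ hr.1.1) fun h0 => ?_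
      exact absurd (h r.1 hr.1.1 h0.symm r.2 hr.1.2) (not_lt.mpr hr.2)
    · by_contra hge
      have := hmin (a := (p, q)) ⟨⟨hp, hq⟩, not_lt.mp hge⟩
      exact absurd this (not_le.mpr hlt)

/-- The coefficients of a positive family of forms that varies slowly: the off-diagonal ones are
controlled by polarization. -/
lemma slow_bilinear {G : ℝ → Bil n} {η T : ℝ} (hη0 : 0 ≤ η) (hη : η ≤ 1)
    (hsymm : ∀ t a b, G t a b = G t b a) (hpos : ∀ t a, a ≠ 0 → 0 < G t a a)
    (hslow : ∀ a s, SlowAt η (fun t => G t a a) s) {a b : E n} (ha : G 0 a a ≤ 1)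
    (hb : G 0 b b ≤ 1) : (∀ t, ContDiffAt ℝ 2 (fun t => G t a b) t) ∧ ∀ t, |t| ≤ T →
      |deriv (fun t => G t a b) t| ≤ η * Real.exp T ∧
      |deriv (deriv fun t => G t a b) t| ≤ η * Real.exp T := by
  set f := fun t => G t (a + b) (a + b) with hf
  set g := fun t => G t (a + (-1 : ℝ) • b) (a + (-1 : ℝ) • b) with hg
  have hfg : ∀ t, f t + g t = 2 * (G t a a + G t b b) := fun t => by
    simp only [hf, hg, Bil.ev_add_left, Bil.ev_add_right, Bil.ev_smul_left, Bil.ev_smul_right]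
    ring
  have hk : (fun t => G t a b) = fun t => (1 / 4 : ℝ) * (f t - g t) := by
    funext t
    simp only [hf, hg, Bil.ev_add_left, Bil.ev_add_right, Bil.ev_smul_left, Bil.ev_smul_right,
      hsymm t b a]
    ring
  have hgrow : ∀ c t, |t| ≤ T → G t c c ≤ Real.exp T * G 0 c c := by
    intro c t ht
    by_cases hc : c = 0
    · simp [hc]
    have h := (le_exp_mul (η := η) (s := 0) (t := t) (f := fun t => G t c c)
      fun x _ => ⟨hslow c x, hpos x c hc⟩).1
    refine h.trans (mul_le_mul_of_nonneg_right (Real.exp_le_exp.mpr ?_) (hpos 0 c hc).le)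
    rw [sub_zero]
    nlinarith [abs_nonneg t]
  have hcf : ∀ t, ContDiffAt ℝ 2 f t := fun t => (hslow _ t).1
  have hcg : ∀ t, ContDiffAt ℝ 2 g t := fun t => (hslow _ t).1
  have hd : deriv (fun t => (1 / 4 : ℝ) * (f t - g t)) =
      fun t => (1 / 4 : ℝ) * (deriv f t - deriv g t) := by
    funext t
    have h₁ := (hcf t).differentiableAt (by simp)
    have h₂ := (hcg t).differentiableAt (by simp)
    exact ((h₁.hasDerivAt.sub h₂.hasDerivAt).const_mul (1 / 4)).deriv
  have hd2 : ∀ t, deriv (fun t => (1 / 4 : ℝ) * (deriv f t - deriv g t)) t =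
      (1 / 4 : ℝ) * (deriv (deriv f) t - deriv (deriv g) t) := by
    intro t
    have h₁ := differentiableAt_deriv (hcf t)
    have h₂ := differentiableAt_deriv (hcg t)
    exact ((h₁.hasDerivAt.sub h₂.hasDerivAt).const_mul (1 / 4)).deriv
  have hbound : ∀ t, |t| ≤ T → ∀ x y : ℝ, |x| ≤ η * f t → |y| ≤ η * g t →
      |1 / 4 * (x - y)| ≤ η * Real.exp T := by
    intro t ht x y hx hy
    have h₁ := hgrow a t ht
    have h₂ := hgrow b t ht
    have hE := Real.exp_pos T
    have h₃ : f t + g t ≤ 4 * Real.exp T := by rw [hfg]; nlinarith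
    have h₄ : |x - y| ≤ η * (4 * Real.exp T) := by
      refine (abs_sub x y).trans ?_
      have := mul_le_mul_of_nonneg_left h₃ hη0
      linarith
    rw [abs_mul, abs_of_pos (by norm_num : (0 : ℝ) < 1 / 4)]
    linarith
  rw [hk]
  refine ⟨fun t => contDiffAt_const.mul ((hcf t).sub (hcg t)), fun t ht => ⟨?_, ?_⟩⟩
  · rw [hd]; exact hbound t ht _ _ (hslow _ t).2 (hslow _ t).2
  · rw [hd, hd2]; exact hbound t ht _ _ (hslow _ t).3 (hslow _ t).3

/-- A bound for the second order jet of `e^{2t} (k(t) - k(0))`. -/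
lemma jet_exp_mul_le {k : ℝ → ℝ} {δ T : ℝ} (hk : ∀ t, ContDiffAt ℝ 2 k t)
    (hd : ∀ t, |t| ≤ T → |deriv k t| ≤ δ ∧ |deriv (deriv k) t| ≤ δ) {t : ℝ} (ht : |t| ≤ T) :
    |Real.exp (2 * t) * (k t - k 0)| +
      |deriv (fun t => Real.exp (2 * t) * (k t - k 0)) t| +
      |deriv (deriv fun t => Real.exp (2 * t) * (k t - k 0)) t| ≤
    δ * (Real.exp (2 * T) * (7 * T + 6)) := by
  have hT : 0 ≤ T := (abs_nonneg t).trans ht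
  have hδ : 0 ≤ δ := (abs_nonneg _).trans (hd t ht).1
  have hlip : |k t - k 0| ≤ δ * T := by
    have h := Convex.norm_image_sub_le_of_norm_deriv_le (f := k) (s := Set.Icc (-T) T) (C := δ)
      (x := 0) (y := t) (fun x _ => (hk x).differentiableAt (by simp))
      (fun x hx => (hd x (abs_le.mpr hx)).1) (convex_Icc _ _) ⟨by linarith, hT⟩ (abs_le.mp ht)
    rw [sub_zero] at h
    exact h.trans (mul_le_mul_of_nonneg_left ht hδ)
  have hce : ∀ t, ContDiffAt ℝ 2 (fun t : ℝ => Real.exp (2 * t)) t := fun t => by fun_prop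
  have hck : ContDiffAt ℝ 2 (fun t => k t - k 0) t := (hk t).sub contDiffAt_const
  have hE : deriv (fun t : ℝ => Real.exp (2 * t)) = fun t => 2 * Real.exp (2 * t) := by
    funext t
    have := ((hasDerivAt_id t).const_mul (2 : ℝ)).exp
    rw [mul_comm]; simpa using this.deriv
  have hE2 : deriv (fun t : ℝ => 2 * Real.exp (2 * t)) t = 4 * Real.exp (2 * t) := by
    rw [deriv_const_mul _ ((hce t).differentiableAt (by simp)), hE]; ring
  have hdk : deriv (fun t => k t - k 0) = deriv k := by funext t; exact deriv_sub_const _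
  rw [(eventually_deriv_mul (hce t) hck).eq_of_nhds, deriv_deriv_mul (hce t) hck, hE, hE2, hdk]
  obtain ⟨h₁, h₂⟩ := hd t ht
  have hexp : Real.exp (2 * t) ≤ Real.exp (2 * T) :=
    Real.exp_le_exp.mpr (by linarith [le_abs_self t])
  have he := Real.exp_pos (2 * t)
  have e₀ : |Real.exp (2 * t) * (k t - k 0)| ≤ Real.exp (2 * T) * (δ * T) := by
    rw [abs_mul, abs_of_pos he]
    exact mul_le_mul hexp hlip (abs_nonneg _) (Real.exp_pos _).le
  have e₁ : |Real.exp (2 * t) * deriv k t| ≤ Real.exp (2 * T) * δ := by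
    rw [abs_mul, abs_of_pos he]
    exact mul_le_mul hexp h₁ (abs_nonneg _) (Real.exp_pos _).le
  have e₂ : |Real.exp (2 * t) * deriv (deriv k) t| ≤ Real.exp (2 * T) * δ := by
    rw [abs_mul, abs_of_pos he]
    exact mul_le_mul hexp h₂ (abs_nonneg _) (Real.exp_pos _).le
  have f₁ : |2 * Real.exp (2 * t) * (k t - k 0) + Real.exp (2 * t) * deriv k t| ≤
      2 * (Real.exp (2 * T) * (δ * T)) + Real.exp (2 * T) * δ := by
    refine (abs_add_le _ _).trans (add_le_add ?_ e₁)
    rw [mul_assoc, abs_mul, abs_two]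
    linarith
  have f₂ : |4 * Real.exp (2 * t) * (k t - k 0) + 2 * (2 * Real.exp (2 * t) * deriv k t) +
      Real.exp (2 * t) * deriv (deriv k) t| ≤
      4 * (Real.exp (2 * T) * (δ * T)) + 4 * (Real.exp (2 * T) * δ) + Real.exp (2 * T) * δ := by
    refine (abs_add_le _ _).trans (add_le_add ((abs_add_le _ _).trans (add_le_add ?_ ?_)) e₂)
    · rw [mul_assoc, abs_mul, abs_of_pos (by norm_num : (0 : ℝ) < 4)]
      linarith
    · rw [show 2 * (2 * Real.exp (2 * t) * deriv k t) = 4 * (Real.exp (2 * t) * deriv k t) by ring,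
        abs_mul, abs_of_pos (by norm_num : (0 : ℝ) < 4)]
      linarith
  refine (add_le_add (add_le_add e₀ f₁) f₂).trans (le_of_eq ?_)
  ring

lemma norm_jet_comp_snd_le {h : ℝ → ℝ} (hh : ∀ t, ContDiffAt ℝ 2 h t) (q : E k × ℝ) :
    ‖h q.2‖ + ‖fderiv ℝ (fun q : E k × ℝ => h q.2) q‖ +
      ‖fderiv ℝ (fderiv ℝ fun q : E k × ℝ => h q.2) q‖ ≤
    |h q.2| + |deriv h q.2| + |deriv (deriv h) q.2| := by
  set π := ContinuousLinearMap.snd ℝ (E k) ℝ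
  have hπ : ‖π‖ ≤ 1 := ContinuousLinearMap.norm_snd_le _ _ _
  have h₁ : fderiv ℝ (fun q : E k × ℝ => h q.2) = fun q => deriv h q.2 • π := by
    funext q
    have h₁ : HasFDerivAt (fun q : E k × ℝ => q.2) π q := hasFDerivAt_snd
    exact (((hh q.2).differentiableAt (by simp)).hasDerivAt.comp_hasFDerivAt q h₁).fderiv
  have h₂ : fderiv ℝ (fun q : E k × ℝ => deriv h q.2 • π) q =
      (deriv (deriv h) q.2 • π).smulRight π := by
    have h₁ : HasFDerivAt (fun q : E k × ℝ => q.2) π q := hasFDerivAt_snd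
    exact (((differentiableAt_deriv (hh q.2)).hasDerivAt.comp_hasFDerivAt q h₁).smul_const π).fderiv
  rw [h₁, h₂, ContinuousLinearMap.norm_smulRight_apply, norm_smul, norm_smul, Real.norm_eq_abs,
    Real.norm_eq_abs, Real.norm_eq_abs]
  have a₁ := abs_nonneg (deriv h q.2)
  have a₂ := abs_nonneg (deriv (deriv h) q.2)
  have p₀ := norm_nonneg π
  have e₁ : |deriv h q.2| * ‖π‖ ≤ |deriv h q.2| := mul_le_of_le_one_right a₁ hπ
  have e₂ : |deriv (deriv h) q.2| * ‖π‖ ≤ |deriv (deriv h) q.2| := mul_le_of_le_one_right a₂ hπ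
  have e₃ := mul_le_of_le_one_right (mul_nonneg a₂ p₀) hπ
  linarith

/-- Linear maps that are isometric for the extended metric are uniformly bounded. -/
lemma exists_frame_bound {κ₀ R : ℝ}
    (hF : ∀ κ ∈ Set.Icc 0 κ₀, ∀ v, ContDiffAt ℝ ∞ (fun p : ℝ × E n => F p.1 p.2) (κ, v))
    (hcone : ∀ κ v, IsConeMetric v (F κ v)) :
    ∃ C, 0 < C ∧ ∀ κ ∈ Set.Icc 0 κ₀, ∀ v, ‖v‖ ≤ R → ∀ (B₁ : E k →L[ℝ] Y) (B₂ : E k →L[ℝ] E n),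
      (∀ a b, inner ℝ (B₁ a) (B₁ b) + F κ v (B₂ a) (B₂ b) = inner ℝ a b) →
      ‖B₁‖ ≤ C ∧ ‖B₂‖ ≤ C := by
  have hc : IsCompact (Set.Icc 0 κ₀ ×ˢ Metric.closedBall (0 : E n) R ×ˢ Metric.sphere (0 : E n) 1) :=
    isCompact_Icc.prod ((isCompact_closedBall _ _).prod (isCompact_sphere _ _))
  have hpos : ∀ q ∈ Set.Icc 0 κ₀ ×ˢ Metric.closedBall (0 : E n) R ×ˢ Metric.sphere (0 : E n) 1,
      0 < F q.1 q.2.1 q.2.2 q.2.2 := fun q hq => (hcone _ _).pos _ fun h0 => by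
    have := hq.2.2
    rw [h0] at this
    simp at this
  obtain ⟨B, hB⟩ := hc.exists_bound_of_continuousOn
    (f := fun q : ℝ × E n × E n => (F q.1 q.2.1 q.2.2 q.2.2)⁻¹) (ContinuousOn.inv₀ (fun q hq => by
      refine ContinuousAt.continuousWithinAt ?_
      have h₁ : ContDiffAt ℝ ∞ (fun q : ℝ × E n × E n => F q.1 q.2.1) q :=
        ContDiffAt.comp q (g := fun p : ℝ × E n => F p.1 p.2)
          (f := fun q : ℝ × E n × E n => (q.1, q.2.1)) (hF _ hq.1 _) (by fun_prop)
      exact (Bil.contDiffAt_ev h₁ (u := fun q => q.2.2) (v := fun q => q.2.2) (by fun_prop)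
        (by fun_prop)).continuousAt) fun q hq => (hpos q hq).ne')
  have hC : 1 ≤ max 1 B := le_max_left _ _
  refine ⟨max 1 B, by linarith, fun κ hκ v hv B₁ B₂ hiso => ?_⟩
  have hnn : ∀ w, 0 ≤ F κ v w w := fun w => by
    by_cases hw : w = 0
    · simp [hw]
    · exact ((hcone κ v).pos w hw).le
  have hself : ∀ a, ‖B₁ a‖ ^ 2 + F κ v (B₂ a) (B₂ a) = ‖a‖ ^ 2 := fun a => by
    rw [← real_inner_self_eq_norm_sq, hiso, real_inner_self_eq_norm_sq]
  constructor
  · refine ContinuousLinearMap.opNorm_le_bound _ (by linarith) fun a => ?_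
    have h₁ : ‖B₁ a‖ ≤ ‖a‖ := abs_le_of_sq_le_sq' (by linarith [hself a, hnn (B₂ a)])
      (norm_nonneg a) |>.2
    nlinarith [norm_nonneg a]
  · refine ContinuousLinearMap.opNorm_le_bound _ (by linarith) fun a => ?_
    by_cases hw : B₂ a = 0
    · rw [hw, norm_zero]; positivity
    have hn : 0 < ‖B₂ a‖ := norm_pos_iff.mpr hw
    have hq : (κ, v, ‖B₂ a‖⁻¹ • B₂ a) ∈
        Set.Icc 0 κ₀ ×ˢ Metric.closedBall (0 : E n) R ×ˢ Metric.sphere (0 : E n) 1 :=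
      ⟨hκ, by simpa using hv, by simp [norm_smul, hn.ne']⟩
    have h₁ := (le_abs_self _).trans ((hB _ hq).trans (le_max_right 1 B))
    have h₂ := hpos _ hq
    simp only [Bil.ev_smul_left, Bil.ev_smul_right] at h₁ h₂
    rw [inv_le_iff_one_le_mul₀ h₂] at h₁
    have h₃ : ‖B₂ a‖ ^ 2 ≤ max 1 B * F κ v (B₂ a) (B₂ a) := by
      have := mul_le_mul_of_nonneg_right h₁ (sq_nonneg ‖B₂ a‖)
      field_simp at this
      linarith
    have h₄ : F κ v (B₂ a) (B₂ a) ≤ ‖a‖ ^ 2 := by nlinarith [hself a, sq_nonneg ‖B₁ a‖]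
    refine abs_le_of_sq_le_sq' ?_ (by positivity) |>.2
    nlinarith [mul_le_mul_of_nonneg_left h₄ (show 0 ≤ max 1 B by linarith),
      mul_nonneg (sub_nonneg.mpr hC) (mul_nonneg (show 0 ≤ max 1 B by linarith) (sq_nonneg ‖a‖))]

/-- The factor in the estimate of the coefficients on a chart of height `T`. -/
def jetConst (T : ℝ) : ℝ := Real.exp T * (Real.exp (2 * T) * (7 * T + 6))

/-- In a radial chart far from the origin, the coefficients are close to those of the model metric,
if the family `F` varies slowly in the limit `κ = 0`.  For `κ = μ = 0` the coefficient is
`e^{2t} (k(t) - k(0))` with `k(t)` the value of `F 0 (e^t v)` on two frame vectors; the frame being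
orthonormal is what makes `k(0)` cancel the model metric.  The frames and the centers form a compact
set, which gives the uniform bound. -/
theorem exists_chartEntry_bound [FiniteDimensional ℝ Y] {κ₀ R T η ε : ℝ}
    (hF : ∀ κ ∈ Set.Icc 0 κ₀, ∀ v, ContDiffAt ℝ ∞ (fun p : ℝ × E n => F p.1 p.2) (κ, v))
    (hF' : ∀ κ ∈ Set.Icc 0 κ₀, ∀ᶠ κ' in nhds κ, ∀ v,
      ContDiffAt ℝ ∞ (fun p : ℝ × E n => F p.1 p.2) (κ', v))
    (hcone : ∀ κ v, IsConeMetric v (F κ v)) (hη0 : 0 ≤ η) (hη : η ≤ 1)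
    (hslow : ∀ (v a : E n) (s : ℝ), SlowAt η (fun t => F 0 (Real.exp t • v) a a) s)
    (hε : η * jetConst T < ε) (a b : E k) (ha : ‖a‖ ≤ 1) (hb : ‖b‖ ≤ 1) :
    ∃ κ₁, 0 < κ₁ ∧ ∀ κ ∈ Set.Icc 0 κ₀, ∀ μ ∈ Set.Icc (0 : ℝ) 1, κ + μ < κ₁ → ∀ v, ‖v‖ ≤ R →
      ∀ (B₁ : E k →L[ℝ] Y) (B₂ : E k →L[ℝ] E n),
      (∀ a b, inner ℝ (B₁ a) (B₁ b) + F κ v (B₂ a) (B₂ b) = inner ℝ a b) →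
      ∀ x t, ‖x‖ ≤ 1 → |t| ≤ T →
        ‖chartEntry F a b (κ, μ, v, B₁, B₂) (x, t)‖ +
          ‖fderiv ℝ (chartEntry F a b (κ, μ, v, B₁, B₂)) (x, t)‖ +
          ‖fderiv ℝ (fderiv ℝ (chartEntry F a b (κ, μ, v, B₁, B₂))) (x, t)‖ < ε := by
  obtain ⟨C, hC, hbound⟩ := exists_frame_bound (k := k) (Y := Y) (κ₀ := κ₀) (R := R) hF hcone
  have := FiniteDimensional.proper_real (E k →L[ℝ] Y)
  have := FiniteDimensional.proper_real (E k →L[ℝ] E n)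
  set box : Set (ChartParam k n Y) := Set.Icc 0 κ₀ ×ˢ Set.Icc 0 1 ×ˢ Metric.closedBall 0 R ×ˢ
    Metric.closedBall 0 C ×ˢ Metric.closedBall 0 C with hbox
  have hboxc : IsCompact box := isCompact_Icc.prod (isCompact_Icc.prod
    ((isCompact_closedBall _ _).prod ((isCompact_closedBall _ _).prod (isCompact_closedBall _ _))))
  set A : Set (ChartParam k n Y) := {P ∈ box | ∀ a b, inner ℝ (P.2.2.2.1 a) (P.2.2.2.1 b) +
    F P.1 P.2.2.1 (P.2.2.2.2 a) (P.2.2.2.2 b) = inner ℝ a b} with hA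
  have hAc : IsCompact A := by
    refine hboxc.of_isClosed_subset ?_ fun P hP => hP.1
    have : A = box ∩ ⋂ a : E k, ⋂ b : E k, box ∩ (fun P : ChartParam k n Y =>
        inner ℝ (P.2.2.2.1 a) (P.2.2.2.1 b) +
          F P.1 P.2.2.1 (P.2.2.2.2 a) (P.2.2.2.2 b)) ⁻¹' {inner ℝ a b} := by
      ext P
      simp only [hA, Set.mem_ofPred_eq, Set.mem_inter_iff, Set.mem_iInter, Set.mem_preimage,
        Set.mem_singleton_iff]
      exact ⟨fun h => ⟨h.1, fun a b => ⟨h.1, h.2 a b⟩⟩, fun h => ⟨h.1, fun a b => (h.2 a b).2⟩⟩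
    rw [this]
    refine hboxc.isClosed.inter (isClosed_iInter fun a => isClosed_iInter fun b => ?_)
    refine ContinuousOn.preimage_isClosed_of_isClosed (fun P hP => ?_) hboxc.isClosed
      isClosed_singleton
    refine ContinuousAt.continuousWithinAt ?_
    have h₁ : ContDiffAt ℝ ∞ (fun P : ChartParam k n Y => F P.1 P.2.2.1) P :=
      ContDiffAt.comp P (g := fun p : ℝ × E n => F p.1 p.2)
        (f := fun P : ChartParam k n Y => (P.1, P.2.2.1)) (hF _ hP.1 _) (by fun_prop)
    have h₂ : ContDiffAt ℝ ∞ (fun P : ChartParam k n Y => F P.1 P.2.2.1 (P.2.2.2.2 a)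
        (P.2.2.2.2 b)) P := Bil.contDiffAt_ev h₁ (by fun_prop) (by fun_prop)
    exact ContinuousAt.add (by fun_prop) h₂.continuousAt
  set Q : Set (E k × ℝ) := Metric.closedBall 0 1 ×ˢ Set.Icc (-T) T with hQ
  have hQc : IsCompact Q := (isCompact_closedBall _ _).prod isCompact_Icc
  set J : ChartParam k n Y × (E k × ℝ) → ℝ := fun p => ‖chartEntry F a b p.1 p.2‖ +
    ‖fderiv ℝ (chartEntry F a b p.1) p.2‖ + ‖fderiv ℝ (fderiv ℝ (chartEntry F a b p.1)) p.2‖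
    with hJ
  have hJc : ContinuousOn J (A ×ˢ Q) := fun p hp => by
    refine ContinuousAt.continuousWithinAt (continuousAt_jet (f := chartEntry F a b) ?_)
    have hev : ∀ᶠ p' : ChartParam k n Y × (E k × ℝ) in nhds p, ∀ v,
        ContDiffAt ℝ ∞ (fun p : ℝ × E n => F p.1 p.2) (p'.1.1, v) :=
      (continuous_fst.comp continuous_fst).continuousAt.eventually (hF' _ hp.1.1.1)
    filter_upwards [hev] with p' hp'
    exact contDiffAt_chartEntry a b p'.1 p'.2 hp'
  have hJ0 : ∀ P ∈ A, P.1 + P.2.1 = 0 → ∀ q ∈ Q, J (P, q) < ε := fun P hP hP0 q hq => by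
    obtain ⟨κ, μ, v, B₁, B₂⟩ := P
    obtain ⟨⟨hκ, hμ, -⟩, hiso⟩ := hP
    dsimp only at hP0 hκ hμ hiso
    obtain rfl : κ = 0 := by linarith [hκ.1, hμ.1]
    obtain rfl : μ = 0 := by linarith [hμ.1]
    have hle : ∀ a : E k, ‖a‖ ≤ 1 → F 0 v (B₂ a) (B₂ a) ≤ 1 := fun a ha => by
      have h₁ := hiso a a
      rw [real_inner_self_eq_norm_sq, real_inner_self_eq_norm_sq] at h₁
      nlinarith [sq_nonneg ‖B₁ a‖, norm_nonneg a]
    obtain ⟨hk, hd⟩ := slow_bilinear (T := T) (G := fun t => F 0 (Real.exp t • v)) hη0 hη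
      (fun t => (hcone _ _).symm) (fun t => (hcone _ _).pos) (hslow v) (a := B₂ a) (b := B₂ b)
      (by simpa using hle a ha) (by simpa using hle b hb)
    set kf : ℝ → ℝ := fun t => F 0 (Real.exp t • v) (B₂ a) (B₂ b) with hkf
    have hfun : chartEntry F a b (0, 0, v, B₁, B₂) =
        fun q : E k × ℝ => (fun t => Real.exp (2 * t) * (kf t - kf 0)) q.2 := by
      funext q
      have hS : chartS 0 q.2 = Real.exp q.2 := by
        simp [chartS, Real.cosh_add_sinh]
      have hN : chartN 0 B₁ B₂ q.1 = 1 := by simp [chartN]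
      simp only [chartEntry, hS, hN, hkf]
      rw [show inner ℝ (B₁ a) (B₁ b) = inner ℝ a b - F 0 v (B₂ a) (B₂ b) by
        rw [← hiso a b]; ring, show Real.exp (2 * q.2) = Real.exp q.2 ^ 2 by
        rw [← Real.exp_nat_mul]; norm_num]
      simp
      ring
    simp only [hJ]
    rw [hfun]
    refine (norm_jet_comp_snd_le (fun t => ?_) q).trans_lt
      ((jet_exp_mul_le hk hd (abs_le.mpr hq.2)).trans_lt ?_)
    · exact ContDiffAt.mul (by fun_prop) ((hk t).sub contDiffAt_const)
    · rw [mul_assoc]; exact hε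
  obtain ⟨κ₁, hκ₁, h⟩ := exists_uniform_of_zero hAc hQc (hAc.prod hQc).isClosed hJc
    (θ := fun P => P.1 + P.2.1) (by fun_prop) (fun P hP => add_nonneg hP.1.1.1 hP.1.2.1.1) hJ0
  refine ⟨κ₁, hκ₁, fun κ hκ μ hμ hlt v hv B₁ B₂ hiso x t hx ht => ?_⟩
  obtain ⟨h₁, h₂⟩ := hbound κ hκ v hv B₁ B₂ hiso
  exact h (κ, μ, v, B₁, B₂) ⟨⟨hκ, hμ, by simpa using hv, by simpa using h₁, by simpa using h₂⟩,
    hiso⟩ hlt (x, t) ⟨by simpa using hx, abs_le.mp ht⟩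

end Entry

/-! ### Radial charts -/

section Chart

variable {V : Type*} [Fintype V] [DecidableEq V] {K : PreAbstractSimplicialComplex V} {m k : ℕ}

/-- The data of a radial chart, in normal coordinates along the simplex `τ`: the direction
`(q₁, q₂)` of its center, at distance `b` from the origin, and linear maps `B₁`, `B₂` that send the
coordinates of the chart to vectors orthogonal to this direction.  The conditions `fix_q` and `fix_B`
say that the tangential vectors only have coordinates in `τ` and off `σ`; by `pos`, the points
of the chart lie over the open star of `τ`. -/
structure ChartFrame (k : ℕ) (σ τ : Face K) (m : ℕ) where
  b : ℝ
  q₁ : EV V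
  q₂ : LC m τ
  B₁ : E k →L[ℝ] EV V
  B₂ : E k →L[ℝ] LC m τ
  b_pos : 0 < b
  unit : ‖q₁‖ ^ 2 + ‖q₂‖ ^ 2 = 1
  orth : ∀ a, inner ℝ q₁ (B₁ a) + inner ℝ q₂ (B₂ a) = 0
  inj : ∀ a, B₁ a = 0 → B₂ a = 0 → a = 0
  fix_q : off σ.1 (part τ.1 q₁) = q₁
  fix_B : ∀ a, off σ.1 (part τ.1 (B₁ a)) = B₁ a
  pos : ∀ x, ‖x‖ < 1 → ∀ v ∈ τ.1, v ∉ σ.1 → 0 < (q₁ + (Real.sinh b)⁻¹ • B₁ x) v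

namespace ChartFrame

variable {σ τ : Face K} (C : ChartFrame k σ τ m)

/-- The inverse of the hyperbolic sine of the distance from the origin to the center. -/
def μ : ℝ := (Real.sinh C.b)⁻¹

/-- The norm of the vector `(y₁ x, y₂ x)`. -/
def N (x : E k) : ℝ := chartN C.μ C.B₁ C.B₂ x

/-- The tangential component of the direction with coordinate `x`, before normalization. -/
def y₁ (x : E k) : EV V := C.q₁ + C.μ • C.B₁ x

/-- The normal component of the direction with coordinate `x`, before normalization. -/
def y₂ (x : E k) : LC m τ := C.q₂ + C.μ • C.B₂ x

/-- The direction with coordinate `x`, as a unit vector. -/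
def dir (h : SphereFamily K m) (x : E k) : LC m σ :=
  Tinv h σ τ ((C.N x)⁻¹ • C.y₁ x, (C.N x)⁻¹ • C.y₂ x)

/-- The radial chart. -/
def chart (h : SphereFamily K m) (q : E k × ℝ) : LC m σ := (q.2 + C.b) • C.dir h q.1

lemma μ_pos : 0 < C.μ := inv_pos.mpr (Real.sinh_pos_iff.mpr C.b_pos)

lemma N_pos (x : E k) : 0 < C.N x := zero_lt_one.trans_le (one_le_chartN _ _ _ _)

lemma N_sq (x : E k) : C.N x ^ 2 = 1 + C.μ ^ 2 * frameInner C.B₁ C.B₂ x x := chartN_sq _ _ _ _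

/-- `(q₁, q₂)` being orthogonal to the frame, only the term of first order in `μ` remains. -/
lemma inner_y (x a : E k) : inner ℝ (C.y₁ x) (C.B₁ a) + inner ℝ (C.y₂ x) (C.B₂ a) =
    C.μ * frameInner C.B₁ C.B₂ x a := by
  simp only [y₁, y₂, frameInner, inner_add_left, real_inner_smul_left]
  linarith [C.orth a]

lemma inner_y_q (x : E k) : inner ℝ (C.y₁ x) C.q₁ + inner ℝ (C.y₂ x) C.q₂ = 1 := by
  simp only [y₁, y₂, inner_add_left, real_inner_smul_left, real_inner_self_eq_norm_sq]
  have h := C.orth x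
  rw [real_inner_comm, real_inner_comm (C.B₂ x)] at h
  linear_combination C.unit + C.μ * h

lemma inner_y_y (x : E k) : inner ℝ (C.y₁ x) (C.y₁ x) + inner ℝ (C.y₂ x) (C.y₂ x) = C.N x ^ 2 := by
  have h₁ : inner ℝ (C.B₁ x) C.q₁ = inner ℝ C.q₁ (C.B₁ x) := real_inner_comm _ _
  have h₂ : inner ℝ (C.B₂ x) C.q₂ = inner ℝ C.q₂ (C.B₂ x) := real_inner_comm _ _
  have h₃ := C.unit
  rw [← real_inner_self_eq_norm_sq, ← real_inner_self_eq_norm_sq] at h₃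
  simp only [N_sq, y₁, y₂, frameInner, inner_add_left, inner_add_right, real_inner_smul_left,
    real_inner_smul_right]
  linear_combination h₃ + 2 * C.μ * C.orth x + C.μ * h₁ + C.μ * h₂

lemma fix_y (x : E k) : off σ.1 (part τ.1 (C.y₁ x)) = C.y₁ x := by
  have h₁ := C.fix_q
  have h₂ := C.fix_B x
  rw [← offL_apply, ← partL_apply] at h₁ h₂ ⊢
  rw [y₁, map_add, map_add, map_smul, map_smul, h₁, h₂]

lemma mem_dom {x : E k} (hx : ‖x‖ < 1) : ∀ v ∈ τ.1, v ∉ σ.1 →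
    0 < ((C.N x)⁻¹ • C.y₁ x, (C.N x)⁻¹ • C.y₂ x).1 v := fun v hv hv' =>
  mul_pos (inv_pos.mpr (C.N_pos x)) (C.pos x hx v hv hv')

variable (S : SmoothSphere K m) (hστ : σ.1 ⊆ τ.1)
include hστ

lemma dir_mem (h : SphereFamily K m) {x : E k} (hx : ‖x‖ < 1) : C.dir h x ∈ starDom h σ τ :=
  Tinv_mem_starDom h hστ (C.mem_dom hx)

lemma T1_dir (h : SphereFamily K m) {x : E k} (hx : ‖x‖ < 1) :
    T1 h σ τ (C.dir h x) = (C.N x)⁻¹ • C.y₁ x := by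
  rw [dir, T1_Tinv h hστ (C.mem_dom hx), part_smul, off_smul, fix_y]

lemma T2_dir (h : SphereFamily K m) {x : E k} (hx : ‖x‖ < 1) :
    T2 h σ τ (C.dir h x) = (C.N x)⁻¹ • C.y₂ x := T2_Tinv h hστ (C.mem_dom hx)

lemma norm_dir (h : SphereFamily K m) {x : E k} (hx : ‖x‖ < 1) : ‖C.dir h x‖ = 1 := by
  have h₁ := norm_sq_T1_add_norm_sq_T2 h hστ (C.dir_mem hστ h hx)
  have hN := C.N_pos x
  rw [C.T1_dir hστ h hx, C.T2_dir hστ h hx, norm_smul, norm_smul, mul_pow, mul_pow, ← mul_add,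
    ← real_inner_self_eq_norm_sq (C.y₁ x), ← real_inner_self_eq_norm_sq (C.y₂ x), C.inner_y_y,
    Real.norm_of_nonneg (by positivity), ← mul_pow, inv_mul_cancel₀ hN.ne', one_pow] at h₁
  exact (pow_eq_one_iff_of_nonneg (norm_nonneg _) two_ne_zero).mp h₁.symm

omit hστ in
lemma contDiff_N : ContDiff ℝ ∞ C.N := by
  unfold N chartN frameInner
  refine ContDiff.sqrt (contDiff_const.add (contDiff_const.mul
    ((ContDiff.inner ℝ C.B₁.contDiff C.B₁.contDiff).add
      (ContDiff.inner ℝ C.B₂.contDiff C.B₂.contDiff)))) fun x => ?_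
  have := mul_nonneg (sq_nonneg C.μ) (frameInner_self_nonneg C.B₁ C.B₂ x)
  unfold frameInner at this
  linarith

lemma contDiffAt_chart {q : E k × ℝ} (hq : ‖q.1‖ < 1) : ContDiffAt ℝ ∞ (C.chart S.h) q := by
  have hN : ContDiff ℝ ∞ fun x => (C.N x)⁻¹ := C.contDiff_N.inv fun x => (C.N_pos x).ne'
  have h₁ : ContDiff ℝ ∞ fun x => ((C.N x)⁻¹ • C.y₁ x, (C.N x)⁻¹ • C.y₂ x) := by
    unfold y₁ y₂
    exact (hN.smul (by fun_prop)).prodMk (hN.smul (by fun_prop))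
  have ho : IsOpen {q : EV V × LC m τ | ∀ v ∈ τ.1, v ∉ σ.1 → 0 < q.1 v} := by
    have : {q : EV V × LC m τ | ∀ v ∈ τ.1, v ∉ σ.1 → 0 < q.1 v} =
        ⋂ v : V, {q | v ∈ τ.1 → v ∉ σ.1 → 0 < q.1 v} := by ext; simp
    rw [this]
    refine isOpen_iInter_of_finite fun v => ?_
    by_cases hv : v ∈ τ.1 ∧ v ∉ σ.1
    · simp only [hv.1, hv.2, forall_const, not_false_eq_true]
      exact isOpen_lt continuous_const
        ((EuclideanSpace.proj v).continuous.comp continuous_fst)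
    · convert isOpen_univ
      ext q
      simp only [Set.mem_ofPred_eq, Set.mem_univ, iff_true]
      tauto
  have h₂ : ContDiffAt ℝ ∞ (C.dir S.h) q.1 :=
    ContDiffAt.comp (g := Tinv S.h σ τ) q.1
      ((contDiffOn_Tinv S hστ).contDiffAt (ho.mem_nhds (C.mem_dom hq))) h₁.contDiffAt
  exact ContDiffAt.smul (contDiffAt_snd.add contDiffAt_const) (ContDiffAt.comp (g := C.dir S.h) q h₂ contDiffAt_fst)

/-- The radial coordinate is the norm, and the direction determines `x` because `(q₁, q₂)` is orthogonal to
the frame. -/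
lemma injOn_chart (h : SphereFamily K m) {T : ℝ} (hT : T ≤ C.b) :
    Set.InjOn (C.chart h) (Metric.ball 0 1 ×ˢ Set.Ioo (-T) T) := by
  rintro ⟨x, t⟩ ⟨hx, ht⟩ ⟨x', t'⟩ ⟨hx', ht'⟩ heq
  simp only [chart] at heq hx hx' ht ht'
  rw [mem_ball_zero_iff] at hx hx'
  have hn := congrArg norm heq
  have ht0 : 0 < t + C.b := by linarith [ht.1]
  have ht0' : 0 < t' + C.b := by linarith [ht'.1]
  rw [norm_smul, norm_smul, C.norm_dir hστ h hx, C.norm_dir hστ h hx', mul_one, mul_one,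
    Real.norm_of_nonneg ht0.le, Real.norm_of_nonneg ht0'.le] at hn
  obtain rfl : t = t' := by linarith
  have hdir := smul_right_injective _ ht0.ne' heq
  have h₁ := congrArg (T1 h σ τ) hdir
  have h₂ := congrArg (T2 h σ τ) hdir
  rw [C.T1_dir hστ h hx, C.T1_dir hστ h hx'] at h₁
  rw [C.T2_dir hστ h hx, C.T2_dir hστ h hx'] at h₂
  have hN : (C.N x)⁻¹ = (C.N x')⁻¹ := by
    have e₁ := C.inner_y_q x
    have e₂ := C.inner_y_q x'
    have e₃ := congrArg (fun v => inner ℝ v C.q₁) h₁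
    have e₄ := congrArg (fun v => inner ℝ v C.q₂) h₂
    simp only [real_inner_smul_left] at e₃ e₄
    linear_combination (C.N x')⁻¹ * e₂ - (C.N x)⁻¹ * e₁ + e₃ + e₄
  rw [hN] at h₁ h₂
  have hN0 : (C.N x')⁻¹ ≠ 0 := (inv_pos.mpr (C.N_pos x')).ne'
  have h₃ := smul_right_injective _ hN0 h₁
  have h₄ := smul_right_injective _ hN0 h₂
  have h₅ := smul_right_injective _ C.μ_pos.ne' (add_left_cancel h₃)
  have h₆ := smul_right_injective _ C.μ_pos.ne' (add_left_cancel h₄)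
  have := C.inj (x - x') (by rw [map_sub, sub_eq_zero]; exact h₅)
    (by rw [map_sub, sub_eq_zero]; exact h₆)
  rw [sub_eq_zero.mp this]

end ChartFrame

end Chart

/-! ### The metric in a radial chart -/

section ChartDeriv

variable {V : Type*} [Fintype V] [DecidableEq V] {K : PreAbstractSimplicialComplex V} {m k : ℕ}

namespace ChartFrame

variable {σ τ : Face K} (C : ChartFrame k σ τ m)

/-- The derivative of the normalized tangential component of the direction. -/
def du₁ (x a : E k) : EV V :=
  ((C.N x)⁻¹ * C.μ) • C.B₁ a - (C.μ ^ 2 * frameInner C.B₁ C.B₂ x a / C.N x ^ 3) • C.y₁ x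

/-- The derivative of the normalized normal component of the direction. -/
def du₂ (x a : E k) : LC m τ :=
  ((C.N x)⁻¹ * C.μ) • C.B₂ a - (C.μ ^ 2 * frameInner C.B₁ C.B₂ x a / C.N x ^ 3) • C.y₂ x

lemma hasFDerivAt_N_inv (x : E k) : ∃ L : E k →L[ℝ] ℝ, HasFDerivAt (fun x => (C.N x)⁻¹) L x ∧
    ∀ a, L a = -(C.μ ^ 2 * frameInner C.B₁ C.B₂ x a / C.N x ^ 3) := by
  have hN := C.N_pos x
  have hf₀ := HasFDerivAt.add (C.B₁.hasFDerivAt (x := x)).norm_sq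
    (C.B₂.hasFDerivAt (x := x)).norm_sq
  have hf := hf₀.congr_of_eventuallyEq (f₁ := fun x => frameInner C.B₁ C.B₂ x x)
    (Filter.Eventually.of_forall fun x => by
      simp [frameInner])
  have h1 : 1 + C.μ ^ 2 * frameInner C.B₁ C.B₂ x x ≠ 0 := by
    rw [← N_sq]; positivity
  have hs : HasFDerivAt C.N _ x := ((hf.const_mul (C.μ ^ 2)).const_add 1).sqrt h1
  refine ⟨_, (hasDerivAt_inv hN.ne').comp_hasFDerivAt x hs, fun a => ?_⟩
  have hsum : (2 • (innerSL ℝ) (C.B₁ x) ∘SL C.B₁ + 2 • (innerSL ℝ) (C.B₂ x) ∘SL C.B₂) a =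
      2 * frameInner C.B₁ C.B₂ x a := by
    simp [frameInner]; ring
  refine (congrArg (fun z => -(C.N x ^ 2)⁻¹ * (1 / (2 * C.N x) * (C.μ ^ 2 * z))) hsum).trans ?_
  field_simp

variable (S : SmoothSphere K m) (hστ : σ.1 ⊆ τ.1)

lemma hasFDerivAt_y {Z : Type*} [NormedAddCommGroup Z] [NormedSpace ℝ Z] (q₀ : Z)
    (B : E k →L[ℝ] Z) (x : E k) (t : ℝ) : ∃ L : E k × ℝ →L[ℝ] Z,
      HasFDerivAt (fun q : E k × ℝ => Real.sinh (q.2 + C.b) • (C.N q.1)⁻¹ • (q₀ + C.μ • B q.1)) L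
        (x, t) ∧ ∀ a s, L (a, s) = Real.sinh (t + C.b) • (((C.N x)⁻¹ * C.μ) • B a -
          (C.μ ^ 2 * frameInner C.B₁ C.B₂ x a / C.N x ^ 3) • (q₀ + C.μ • B x)) +
        (Real.cosh (t + C.b) * s) • (C.N x)⁻¹ • (q₀ + C.μ • B x) := by
  obtain ⟨L, hL, hLa⟩ := C.hasFDerivAt_N_inv x
  have h₁ : HasFDerivAt (fun x => q₀ + C.μ • B x) (C.μ • B) x :=
    (B.hasFDerivAt.const_smul C.μ).const_add q₀
  have h₂ : HasFDerivAt (fun q : E k × ℝ => (C.N q.1)⁻¹ • (q₀ + C.μ • B q.1)) _ (x, t) :=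
    (hL.smul h₁).comp (g := fun x => (C.N x)⁻¹ • (q₀ + C.μ • B x)) (x, t) hasFDerivAt_fst
  have h₃ : HasFDerivAt (fun q : E k × ℝ => Real.sinh (q.2 + C.b)) _ (x, t) :=
    HasDerivAt.comp_hasFDerivAt (h₂ := Real.sinh) (f := fun q : E k × ℝ => q.2 + C.b) (x, t)
      (Real.hasDerivAt_sinh (t + C.b)) ((hasFDerivAt_snd (𝕜 := ℝ) (E := E k) (F := ℝ) (p := (x, t))).add_const C.b)
  refine ⟨_, h₃.smul h₂, fun a s => ?_⟩
  simp [hLa, smul_smul, sub_eq_add_neg, neg_smul]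
  abel

/-- The direction is a unit vector, hence orthogonal to its derivatives. -/
lemma inner_u_du (x a : E k) : inner ℝ ((C.N x)⁻¹ • C.y₁ x) (C.du₁ x a) +
    inner ℝ ((C.N x)⁻¹ • C.y₂ x) (C.du₂ x a) = 0 := by
  have h₁ := C.inner_y x a
  have h₂ := C.inner_y_y x
  have hN := (C.N_pos x).ne'
  simp only [du₁, du₂, inner_sub_right, real_inner_smul_left, real_inner_smul_right]
  have : C.μ ^ 2 * frameInner C.B₁ C.B₂ x a / C.N x ^ 3 * C.N x ^ 2 =
      C.μ ^ 2 * frameInner C.B₁ C.B₂ x a * (C.N x)⁻¹ := by field_simp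
  linear_combination (C.N x)⁻¹ ^ 2 * C.μ * h₁ -
    (C.N x)⁻¹ * (C.μ ^ 2 * frameInner C.B₁ C.B₂ x a / C.N x ^ 3) * h₂ - (C.N x)⁻¹ * this

lemma eq_zero_of_du {x a : E k} (h₁ : C.du₁ x a = 0) (h₂ : C.du₂ x a = 0) : a = 0 := by
  have hN := C.N_pos x
  have hμ := C.μ_pos
  have hq := C.inner_y_q x
  have ho := C.orth a
  have e₁ := congrArg (fun v => inner ℝ C.q₁ v) h₁
  have e₂ := congrArg (fun v => inner ℝ C.q₂ v) h₂
  simp only [du₁, du₂, inner_sub_right, real_inner_smul_right, inner_zero_right] at e₁ e₂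
  rw [real_inner_comm, real_inner_comm C.q₂] at hq
  have h0 : C.μ ^ 2 * frameInner C.B₁ C.B₂ x a / C.N x ^ 3 = 0 := by
    linear_combination -e₁ - e₂ + (C.N x)⁻¹ * C.μ * ho -
      C.μ ^ 2 * frameInner C.B₁ C.B₂ x a / C.N x ^ 3 * hq
  rw [du₁, h0, zero_smul, sub_zero] at h₁
  rw [du₂, h0, zero_smul, sub_zero] at h₂
  have hne : (C.N x)⁻¹ * C.μ ≠ 0 := by positivity
  exact C.inj a ((smul_eq_zero_iff_right hne).mp h₁) ((smul_eq_zero_iff_right hne).mp h₂)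

/-- By the addition theorem and `cosh b = √(1 + sinh² b)`. -/
lemma sinh_add (t : ℝ) : Real.sinh (t + C.b) * C.μ = chartS C.μ t := by
  have hb := Real.sinh_pos_iff.mpr C.b_pos
  have h₁ : √(1 + C.μ ^ 2) = Real.cosh C.b * C.μ := by
    rw [show 1 + C.μ ^ 2 = (Real.cosh C.b * C.μ) ^ 2 by
      rw [mul_pow, Real.cosh_sq, μ]; field_simp]
    exact Real.sqrt_sq (mul_pos (Real.cosh_pos _) C.μ_pos).le
  rw [chartS, h₁, Real.sinh_add]
  have : Real.sinh C.b * C.μ = 1 := by rw [μ]; field_simp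
  linear_combination Real.cosh t * this

include hστ

lemma rescale_chart (h : SphereFamily K m) {q : E k × ℝ} (hx : ‖q.1‖ < 1) (ht : 0 < q.2 + C.b) :
    rescale Real.sinh (C.chart h q) = Real.sinh (q.2 + C.b) • C.dir h q.1 := by
  rw [chart, rescale_smul _ ht, C.norm_dir hστ h hx, mul_one, div_one]

lemma T1_rescale_chart (h : SphereFamily K m) {q : E k × ℝ} (hx : ‖q.1‖ < 1)
    (ht : 0 < q.2 + C.b) : T1 h σ τ (rescale Real.sinh (C.chart h q)) =
      Real.sinh (q.2 + C.b) • (C.N q.1)⁻¹ • C.y₁ q.1 := by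
  rw [C.rescale_chart hστ h hx ht, T1_smul h (Real.sinh_pos_iff.mpr ht).le, C.T1_dir hστ h hx]

lemma T2_rescale_chart (h : SphereFamily K m) {q : E k × ℝ} (hx : ‖q.1‖ < 1)
    (ht : 0 < q.2 + C.b) : T2 h σ τ (rescale Real.sinh (C.chart h q)) =
      Real.sinh (q.2 + C.b) • (C.N q.1)⁻¹ • C.y₂ q.1 := by
  rw [C.rescale_chart hστ h hx ht, T2_smul h (Real.sinh_pos_iff.mpr ht).le, C.T2_dir hστ h hx]

lemma rescale_chart_mem (h : SphereFamily K m) {q : E k × ℝ} (hx : ‖q.1‖ < 1)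
    (ht : 0 < q.2 + C.b) : rescale Real.sinh (C.chart h q) ∈ starDom h σ τ := by
  rw [C.rescale_chart hστ h hx ht]
  exact (smul_mem_starDom h (Real.sinh_pos_iff.mpr ht)).mpr (C.dir_mem hστ h hx)

lemma chart_ne_zero (h : SphereFamily K m) {q : E k × ℝ} (hx : ‖q.1‖ < 1)
    (ht : 0 < q.2 + C.b) : C.chart h q ≠ 0 := by
  refine smul_ne_zero ht.ne' fun h0 => ?_
  have := C.norm_dir hστ h hx
  rw [h0, norm_zero] at this
  exact zero_ne_one this

/-- The derivatives of the normal coordinates, in hyperboloid coordinates, of a point of the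
chart. -/
lemma D_chart {x : E k} {t : ℝ} (hx : ‖x‖ < 1) (ht : 0 < t + C.b) (a : E k) (s : ℝ) :
    let p := C.chart S.h (x, t)
    let A := radialMap p (Real.sinh ‖p‖ / ‖p‖) (Real.cosh ‖p‖)
      (fderiv ℝ (C.chart S.h) (x, t) (a, s))
    D1 S.h σ τ (rescale Real.sinh p) A = Real.sinh (t + C.b) • C.du₁ x a +
        (Real.cosh (t + C.b) * s) • (C.N x)⁻¹ • C.y₁ x ∧
      D2 S.h σ τ (rescale Real.sinh p) A = Real.sinh (t + C.b) • C.du₂ x a +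
        (Real.cosh (t + C.b) * s) • (C.N x)⁻¹ • C.y₂ x := by
  intro p A
  have hp0 : p ≠ 0 := C.chart_ne_zero hστ S.h (q := (x, t)) hx ht
  have hmem : rescale Real.sinh p ∈ starDom S.h σ τ :=
    C.rescale_chart_mem hστ S.h (q := (x, t)) hx ht
  have hc : HasFDerivAt (C.chart S.h) (fderiv ℝ (C.chart S.h) (x, t)) (x, t) :=
    ((C.contDiffAt_chart S hστ (q := (x, t)) hx).differentiableAt (by simp)).hasFDerivAt
  have hr := (hasFDerivAt_sinh hp0).comp (x, t) hc
  have hev : ∀ᶠ q : E k × ℝ in nhds (x, t), ‖q.1‖ < 1 ∧ 0 < q.2 + C.b := by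
    refine Filter.Eventually.and ?_ ?_
    · exact (continuous_fst.norm).continuousAt.eventually_lt continuousAt_const hx
    · exact continuousAt_const.eventually_lt
        (continuous_snd.add continuous_const).continuousAt ht
  constructor
  · obtain ⟨L, hL, hLa⟩ := C.hasFDerivAt_y C.q₁ C.B₁ x t
    have h₁ := (hasFDerivAt_T1 S hστ hmem).comp (x, t) hr
    have h₂ := h₁.congr_of_eventuallyEq (f₁ := fun q : E k × ℝ =>
        Real.sinh (q.2 + C.b) • (C.N q.1)⁻¹ • (C.q₁ + C.μ • C.B₁ q.1)) (by
      filter_upwards [hev] with q hq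
      exact (C.T1_rescale_chart hστ S.h hq.1 hq.2).symm)
    exact (congrArg (fun L => L (a, s)) (h₂.unique hL)).trans (hLa a s)
  · obtain ⟨L, hL, hLa⟩ := C.hasFDerivAt_y C.q₂ C.B₂ x t
    have h₁ := (hasFDerivAt_T2 S hστ hmem).comp (x, t) hr
    have h₂ := h₁.congr_of_eventuallyEq (f₁ := fun q : E k × ℝ =>
        Real.sinh (q.2 + C.b) • (C.N q.1)⁻¹ • (C.q₂ + C.μ • C.B₂ q.1)) (by
      filter_upwards [hev] with q hq
      exact (C.T2_rescale_chart hστ S.h hq.1 hq.2).symm)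
    exact (congrArg (fun L => L (a, s)) (h₂.unique hL)).trans (hLa a s)

/-- The chart is an immersion: the radial component determines `s`, and the frame determines `a`. -/
lemma injective_fderiv_chart {x : E k} {t : ℝ} (hx : ‖x‖ < 1) (ht : 0 < t + C.b) :
    Function.Injective (fderiv ℝ (C.chart S.h) (x, t)) := by
  rw [injective_iff_map_eq_zero]
  rintro ⟨a, s⟩ h0
  obtain ⟨h₁, h₂⟩ := C.D_chart S hστ hx ht a s
  rw [h0, map_zero, map_zero] at h₁ h₂
  have hu := C.inner_u_du x a
  have hyy := C.inner_y_y x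
  have hN := C.N_pos x
  have e₁ := congrArg (fun v => inner ℝ ((C.N x)⁻¹ • C.y₁ x) v) h₁
  have e₂ := congrArg (fun v => inner ℝ ((C.N x)⁻¹ • C.y₂ x) v) h₂
  simp only [inner_zero_right, inner_add_right, real_inner_smul_right, real_inner_smul_left]
    at e₁ e₂ hu
  have hs : Real.cosh (t + C.b) * s = 0 := by
    have h3 : (C.N x)⁻¹ ^ 2 * C.N x ^ 2 = 1 := by field_simp
    linear_combination -e₁ - e₂ - Real.sinh (t + C.b) * hu -
      Real.cosh (t + C.b) * s * (C.N x)⁻¹ ^ 2 * hyy - Real.cosh (t + C.b) * s * h3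
  rw [hs, zero_smul, add_zero] at h₁ h₂
  have hsh : Real.sinh (t + C.b) ≠ 0 := (Real.sinh_pos_iff.mpr ht).ne'
  have ha := C.eq_zero_of_du ((smul_eq_zero_iff_right hsh).mp h₁.symm)
    ((smul_eq_zero_iff_right hsh).mp h₂.symm)
  have hs' : s = 0 := (mul_eq_zero_iff_left (Real.cosh_pos _).ne').mp hs
  rw [ha, hs']; rfl

/-- The coefficients of an extended metric in a radial chart. -/
lemma pullback_chart {x : E k} {t : ℝ} (hx : ‖x‖ < 1) (ht : 0 < t + C.b)
    {β : LC m σ → Bil (m + 1 - σ.1.card)} {γ : Bil (m + 1 - τ.1.card)}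
    (hβ : β (rescale Real.sinh (C.chart S.h (x, t))) =
      extB S.h σ τ (rescale Real.sinh (C.chart S.h (x, t))) γ)
    (hγ : IsConeMetric (Real.sinh (t + C.b) • (C.N x)⁻¹ • C.y₂ x) γ) (a a' : E k) (s s' : ℝ) :
    pullback (C.chart S.h) (polarOf β) (x, t) (a, s) (a', s') = s * s' + chartS C.μ t ^ 2 *
      ((inner ℝ (C.B₁ a) (C.B₁ a') + γ (C.B₂ a) (C.B₂ a')) / C.N x ^ 2 -
        C.μ ^ 2 * (frameInner C.B₁ C.B₂ x a * frameInner C.B₁ C.B₂ x a') / C.N x ^ 4) := by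
  have hsh : 0 < Real.sinh (t + C.b) := Real.sinh_pos_iff.mpr ht
  have hmem := C.rescale_chart_mem hστ S.h (q := (x, t)) hx ht
  have hT1 := C.T1_rescale_chart hστ S.h (q := (x, t)) hx ht
  have hT2 := C.T2_rescale_chart hστ S.h (q := (x, t)) hx ht
  obtain ⟨d₁, d₂⟩ := C.D_chart S hστ hx ht a s
  obtain ⟨d₁', d₂'⟩ := C.D_chart S hστ hx ht a' s'
  dsimp only at d₁ d₂ d₁' d₂' hT1 hT2
  have hnorm : ‖rescale Real.sinh (C.chart S.h (x, t))‖ = Real.sinh (t + C.b) := by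
    rw [C.rescale_chart hστ S.h (q := (x, t)) hx ht, norm_smul, C.norm_dir hστ S.h hx, mul_one,
      Real.norm_of_nonneg hsh.le]
  have hp0 := C.chart_ne_zero hστ S.h (q := (x, t)) hx ht
  rw [pullback, ← polarOf_eq_hypB hp0 (by
    rw [hβ]; exact IsConeMetric.extB S hστ hmem (by rw [hT2]; exact hγ)), hypB, hβ, extB_ev,
    ← inner_T_D S hστ hmem, ← inner_T_D S hστ hmem, d₁, d₂, d₁', d₂', hT1, hT2, hnorm]
  have hN := C.N_pos x
  have hyy := C.inner_y_y x
  have hch : 1 + Real.sinh (t + C.b) ^ 2 = Real.cosh (t + C.b) ^ 2 := by rw [Real.cosh_sq]; ring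
  -- the radial component
  have hrad : ∀ a s, inner ℝ (Real.sinh (t + C.b) • (C.N x)⁻¹ • C.y₁ x)
        (Real.sinh (t + C.b) • C.du₁ x a + (Real.cosh (t + C.b) * s) • (C.N x)⁻¹ • C.y₁ x) +
      inner ℝ (Real.sinh (t + C.b) • (C.N x)⁻¹ • C.y₂ x)
        (Real.sinh (t + C.b) • C.du₂ x a + (Real.cosh (t + C.b) * s) • (C.N x)⁻¹ • C.y₂ x) =
      Real.sinh (t + C.b) * Real.cosh (t + C.b) * s := by
    intro a s
    have hu := C.inner_u_du x a
    simp only [inner_add_right, real_inner_smul_left, real_inner_smul_right] at hu ⊢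
    have h3 : (C.N x)⁻¹ ^ 2 * C.N x ^ 2 = 1 := by field_simp
    linear_combination Real.sinh (t + C.b) ^ 2 * hu +
      Real.sinh (t + C.b) * Real.cosh (t + C.b) * s * ((C.N x)⁻¹ ^ 2 * hyy + h3)
  have hquot : Real.sinh (t + C.b) * Real.cosh (t + C.b) * s *
      (Real.sinh (t + C.b) * Real.cosh (t + C.b) * s') / Real.cosh (t + C.b) ^ 2 =
      Real.sinh (t + C.b) ^ 2 * (s * s') := by
    have := (Real.cosh_pos (t + C.b)).ne'
    field_simp
  rw [hrad, hrad, hch, hquot, ← C.sinh_add t]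
  have hg : ∀ b, γ (C.y₂ x) b = inner ℝ (C.y₂ x) b := fun b => by
    have h := hγ.gauss b
    rw [smul_smul, Bil.ev_smul_left, real_inner_smul_left] at h
    exact mul_left_cancel₀ (mul_pos hsh (inv_pos.mpr hN)).ne' h
  have hg' : ∀ b, γ b (C.y₂ x) = inner ℝ (C.y₂ x) b := fun b => by rw [hγ.symm, hg]
  have hc1 : ∀ b, inner ℝ (C.B₁ b) (C.y₁ x) = inner ℝ (C.y₁ x) (C.B₁ b) := fun b =>
    real_inner_comm _ _
  have hy := C.inner_y x a
  have hy' := C.inner_y x a'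
  simp only [du₁, du₂, sub_eq_add_neg, ← neg_smul, inner_add_left, inner_add_right,
    real_inner_smul_left, real_inner_smul_right, Bil.ev_add_left, Bil.ev_add_right,
    Bil.ev_smul_left, Bil.ev_smul_right, hg, hg', hc1]
  rw [← eq_sub_iff_add_eq] at hy hy' hyy
  rw [hy, hy', hyy]
  have hcs : Real.cosh (t + C.b) ^ 2 = 1 + Real.sinh (t + C.b) ^ 2 := hch.symm
  field_simp
  ring_nf
  simp only [hcs]
  ring

end ChartFrame

end ChartDeriv

/-! ### Frames and estimates for radial charts -/

section ChartExistence

variable {V : Type*} [Fintype V] [DecidableEq V] {K : PreAbstractSimplicialComplex V} {m k : ℕ}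

lemma T2_self (h : SphereFamily K m) (σ : Face K) (z : LC m σ) : T2 h σ σ z = z := by
  rw [T2, off_cc, ci_cc]

lemma T1_self (h : SphereFamily K m) (σ : Face K) (z : LC m σ) : T1 h σ σ z = 0 := by
  ext v
  rw [T1, part_apply]
  split_ifs with hv
  · exact cc_apply_of_mem h σ z hv
  · rfl

lemma extB_self (h : SphereFamily K m) (σ : Face K) (z : LC m σ) (β : Bil (m + 1 - σ.1.card)) :
    extB h σ σ z β = β := by
  have h₁ : D1 h σ σ z = 0 := by
    rw [D1, show T1 h σ σ = fun _ => 0 from funext (T1_self h σ)]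
    simp
  have h₂ : D2 h σ σ z = ContinuousLinearMap.id ℝ _ := by
    rw [D2, show T2 h σ σ = id from funext (T2_self h σ)]
    exact fderiv_id
  refine Bil.ext fun a b => ?_
  rw [extB_ev, h₁, h₂]
  simp

/-- An orthonormal frame of the orthogonal complement of `z`, for an extended metric. -/
lemma exists_frame (S : SmoothSphere K m) {σ τ : Face K} (hστ : σ.1 ⊆ τ.1)
    (hk : m + 1 - σ.1.card = k + 1) {z : LC m σ} (hz0 : z ≠ 0) (hz : z ∈ starDom S.h σ τ)
    {γ : Bil (m + 1 - τ.1.card)} (hγ : IsConeMetric (T2 S.h σ τ z) γ) :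
    ∃ (B₁ : E k →L[ℝ] EV V) (B₂ : E k →L[ℝ] LC m τ),
      (∀ a b, inner ℝ (B₁ a) (B₁ b) + γ (B₂ a) (B₂ b) = inner ℝ a b) ∧
      (∀ a, inner ℝ (T1 S.h σ τ z) (B₁ a) + inner ℝ (T2 S.h σ τ z) (B₂ a) = 0) ∧
      ∀ a, off σ.1 (part τ.1 (B₁ a)) = B₁ a := by
  have hcone := hγ.extB S hστ hz
  have : Fact (Module.finrank ℝ (LC m σ) = k + 1) := ⟨by rw [finrank_euclideanSpace_fin, hk]⟩
  let W := (ℝ ∙ z)ᗮ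
  have hW : Module.finrank ℝ W = k := Submodule.finrank_orthogonal_span_singleton hz0
  let β : W →ₗ[ℝ] W →ₗ[ℝ] ℝ := LinearMap.mk₂ ℝ
    (fun a b => extB S.h σ τ z γ (a : LC m σ) (b : LC m σ))
    (fun a b c => by simp only [Submodule.coe_add, Bil.ev_add_left])
    (fun s a b => by simp only [Submodule.coe_smul, Bil.ev_smul_left, smul_eq_mul])
    (fun a b c => by simp only [Submodule.coe_add, Bil.ev_add_right])
    (fun s a b => by simp only [Submodule.coe_smul, Bil.ev_smul_right, smul_eq_mul])
  obtain ⟨L, hL⟩ := exists_orthonormal_frame hW β (fun a b => hcone.symm _ _)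
    (fun a ha => hcone.pos _ (by simpa using ha))
  let L' : E k →L[ℝ] LC m σ := LinearMap.toContinuousLinearMap (W.subtype ∘ₗ L)
  have hL' : ∀ a, L' a = (L a : LC m σ) := fun a => rfl
  refine ⟨(D1 S.h σ τ z).comp L', (D2 S.h σ τ z).comp L', fun a b => ?_, fun a => ?_, fun a => ?_⟩
  · have h₁ := hL a b
    change extB S.h σ τ z γ (L a : LC m σ) (L b : LC m σ) = inner ℝ a b at h₁
    rw [extB_ev] at h₁
    exact h₁
  · have h₁ : inner ℝ z (L a : LC m σ) = 0 := Submodule.mem_orthogonal_singleton_iff_inner_right.mp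
      (L a).2
    rw [ContinuousLinearMap.comp_apply, ContinuousLinearMap.comp_apply, inner_T_D S hστ hz, hL']
    exact h₁
  · have hpart : ∀ z : LC m σ, off σ.1 (part τ.1 (T1 S.h σ τ z)) = T1 S.h σ τ z := fun z => by
      ext v
      simp only [T1, off_apply, part_apply]
      split_ifs with h₁ h₂ <;> first | rfl | (rw [cc_apply_of_mem S.h σ z h₁])
    have h₁ := ((offL σ.1).comp (partL τ.1)).hasFDerivAt.comp z (hasFDerivAt_T1 S hστ hz)
    have h₂ := h₁.congr_of_eventuallyEq (f₁ := T1 S.h σ τ)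
      (Filter.Eventually.of_forall fun z => (hpart z).symm)
    exact congrArg (fun L => L (L' a)) (h₂.unique (hasFDerivAt_T1 S hστ hz))

/-- Far from the origin, `sinh` grows along rays like the exponential function. -/
lemma abs_chartS_sub_exp_le {μ t T : ℝ} (hμ : 0 ≤ μ) (ht : |t| ≤ T) :
    |chartS μ t - Real.exp t| ≤ μ * Real.exp T := by
  have h₁ : 1 ≤ √(1 + μ ^ 2) := Real.one_le_sqrt.mpr (by nlinarith [sq_nonneg μ])
  have h₂ : √(1 + μ ^ 2) ≤ 1 + μ := Real.sqrt_le_iff.mpr ⟨by linarith, by nlinarith⟩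
  have h₃ : chartS μ t - Real.exp t = (√(1 + μ ^ 2) - 1) * Real.sinh t := by
    rw [chartS, ← Real.cosh_add_sinh]; ring
  have h₄ : |Real.sinh t| ≤ Real.exp T := by
    have e₁ := Real.exp_le_exp.mpr ((le_abs_self t).trans ht)
    have e₂ := Real.exp_le_exp.mpr ((neg_le_abs t).trans ht)
    rw [Real.sinh_eq, abs_le]
    constructor <;> linarith [Real.exp_pos t, Real.exp_pos (-t)]
  rw [h₃, abs_mul, abs_of_nonneg (by linarith)]
  exact mul_le_mul (by linarith) h₄ (abs_nonneg _) hμ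

lemma chartN_le {n : ℕ} {Y : Type*} [NormedAddCommGroup Y] [InnerProductSpace ℝ Y] {μ b : ℝ}
    (hμ : 0 ≤ μ) {B₁ : E k →L[ℝ] Y} {B₂ : E k →L[ℝ] E n} (h₁ : ‖B₁‖ ≤ b) (h₂ : ‖B₂‖ ≤ b) {x : E k}
    (hx : ‖x‖ ≤ 1) : chartN μ B₁ B₂ x ≤ 1 + 2 * (μ * b) := by
  have hb : 0 ≤ b := (norm_nonneg _).trans h₁
  have e₁ : ‖B₁ x‖ ≤ b := (B₁.le_opNorm x).trans (by nlinarith [norm_nonneg B₁, norm_nonneg x])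
  have e₂ : ‖B₂ x‖ ≤ b := (B₂.le_opNorm x).trans (by nlinarith [norm_nonneg B₂, norm_nonneg x])
  rw [chartN, frameInner, real_inner_self_eq_norm_sq, real_inner_self_eq_norm_sq,
    Real.sqrt_le_iff]
  refine ⟨by positivity, ?_⟩
  have e₃ : ‖B₁ x‖ ^ 2 ≤ b ^ 2 := pow_le_pow_left₀ (norm_nonneg _) e₁ 2
  have e₄ : ‖B₂ x‖ ^ 2 ≤ b ^ 2 := pow_le_pow_left₀ (norm_nonneg _) e₂ 2
  nlinarith [mul_le_mul_of_nonneg_left (add_le_add e₃ e₄) (sq_nonneg μ), mul_nonneg hμ hb,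
    sq_nonneg (μ * b)]

/-- The distance to the cone of a face `τ'` of `τ`, by Pythagoras, from the normal coordinates along `τ`. -/
lemma norm_off_sq_of_subset {τ τ' : Finset V} (hτ : τ' ⊆ τ) (w : EV V) :
    ‖off τ' w‖ ^ 2 = ‖off τ' (part τ w)‖ ^ 2 + ‖off τ w‖ ^ 2 := by
  rw [← norm_sq_part_add_norm_sq_off τ (off τ' w), off_off hτ]
  congr 3
  ext v
  simp only [part_apply, off_apply]
  split_ifs <;> rfl

/-- The distance to the cone of a face changes little under small changes of the normal
coordinates.  The factor `7 / 10` is a lower bound for `1 / √2`: one of the two orthogonal components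
of `off τ' w` has at least that share of the norm. -/
lemma lt_norm_off {τ τ' : Finset V} (hτ : τ' ⊆ τ) {w w' e₁ : EV V} {l δ D s : ℝ} (hl : 0 < l)
    (h₁ : part τ w' = l • (part τ w + e₁)) (he₁ : ‖e₁‖ ≤ δ) (h₂ : l * (‖off τ w‖ - δ) ≤ ‖off τ w'‖)
    (hD : D ≤ ‖off τ' w‖) (hD0 : 0 ≤ D) (hs : s < l * (7 / 10 * D - δ)) : s < ‖off τ' w'‖ := by
  refine hs.trans_le ?_
  have e₀ := norm_off_sq_of_subset hτ w
  have e₀' := norm_off_sq_of_subset hτ w'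
  set A := ‖off τ' (part τ w)‖
  set B := ‖off τ w‖
  have hA : 0 ≤ A := norm_nonneg _
  have hB : 0 ≤ B := norm_nonneg _
  have hW' : 0 ≤ ‖off τ' w'‖ := norm_nonneg _
  rcases le_total A B with hAB | hAB
  · have hB7 : 7 / 10 * D ≤ B := by nlinarith
    have h₃ : ‖off τ w'‖ ≤ ‖off τ' w'‖ := by nlinarith [sq_nonneg ‖off τ' (part τ w')‖]
    exact (mul_le_mul_of_nonneg_left (by linarith) hl.le).trans (h₂.trans h₃)
  · have hA7 : 7 / 10 * D ≤ A := by nlinarith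
    have h₃ : l * (A - δ) ≤ ‖off τ' (part τ w')‖ := by
      rw [h₁, off_smul, norm_smul, Real.norm_of_nonneg hl.le]
      refine mul_le_mul_of_nonneg_left ?_ hl.le
      have h₄ : off τ' (part τ w + e₁) = off τ' (part τ w) + off τ' e₁ := by
        rw [← offL_apply, map_add, offL_apply, offL_apply]
      rw [h₄]
      have h₅ := norm_sub_le (off τ' (part τ w) + off τ' e₁) (off τ' e₁)
      rw [add_sub_cancel_right] at h₅
      linarith [(norm_off_le τ' e₁).trans he₁]
    have h₆ : ‖off τ' (part τ w')‖ ≤ ‖off τ' w'‖ := by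
      nlinarith [sq_nonneg ‖off τ w'‖, norm_nonneg (off τ' (part τ w'))]
    exact (mul_le_mul_of_nonneg_left (by linarith) hl.le).trans (h₃.trans h₆)

/-- The `C²` norm of a matrix-valued function whose entries have small jets. -/
lemma C2norm_lt {X ι : Type*} [NormedAddCommGroup X] [NormedSpace ℝ X] [Fintype ι] {U : Set X}
    (hU : IsOpen U) {f : X → ι → ι → ℝ} {g : ι → ι → X → ℝ} (hfg : ∀ q ∈ U, ∀ i j, f q i j = g i j q)
    {ε : ℝ} (hε : 0 < ε) (hg : ∀ i j, ∀ q ∈ U, ContDiffAt ℝ 2 (g i j) q)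
    (hjet : ∀ i j, ∀ q ∈ U, ‖g i j q‖ + ‖fderiv ℝ (g i j) q‖ +
      ‖fderiv ℝ (fderiv ℝ (g i j)) q‖ < ε / 2) : C2norm U f < ENNReal.ofReal ε := by
  have hcd : ∀ q ∈ U, ContDiffAt ℝ 2 f q := fun q hq => by
    refine ContDiffAt.congr_of_eventuallyEq (f := fun q i j => g i j q)
      (contDiffAt_pi.mpr fun i => contDiffAt_pi.mpr fun j => hg i j q hq) ?_
    filter_upwards [hU.mem_nhds hq] with q' hq'
    funext i j
    exact hfg q' hq' i j
  have hle : C2norm U f ≤ ENNReal.ofReal (ε / 2) := by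
    refine iSup₂_le fun q hq => iSup₂_le fun i hi => ?_
    have hi2 : i ≤ 2 := hi
    rw [← ofReal_norm]
    refine ENNReal.ofReal_le_ofReal ?_
    refine ContinuousMultilinearMap.opNorm_le_bound (by linarith) fun v => ?_
    refine (pi_norm_le_iff_of_nonneg (by positivity)).mpr fun a =>
      (pi_norm_le_iff_of_nonneg (by positivity)).mpr fun b => ?_
    let π : (ι → ι → ℝ) →L[ℝ] ℝ :=
      (ContinuousLinearMap.proj b).comp (ContinuousLinearMap.proj (R := ℝ) (φ := fun _ : ι => ι → ℝ) a)
    have h₁ := ContinuousLinearMap.iteratedFDeriv_comp_left π (hcd q hq) (i := i)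
      (by exact_mod_cast hi2)
    have h₂ : π ∘ f =ᶠ[nhds q] g a b := by
      filter_upwards [hU.mem_nhds hq] with q' hq' using hfg q' hq' a b
    have h₃ : iteratedFDeriv ℝ i f q v a b = iteratedFDeriv ℝ i (g a b) q v := by
      rw [← (Filter.EventuallyEq.iteratedFDeriv ℝ h₂ i).self_of_nhds, h₁]; rfl
    rw [h₃]
    refine (ContinuousMultilinearMap.le_opNorm _ v).trans
      (mul_le_mul_of_nonneg_right ?_ (Finset.prod_nonneg fun _ _ => norm_nonneg _))
    have hj := hjet a b q hq
    have n₀ := norm_nonneg (g a b q)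
    have n₁ := norm_nonneg (fderiv ℝ (g a b) q)
    have n₂ := norm_nonneg (fderiv ℝ (fderiv ℝ (g a b)) q)
    interval_cases i
    · rw [norm_iteratedFDeriv_zero]; linarith
    · rw [← norm_iteratedFDeriv_fderiv, norm_iteratedFDeriv_zero]; linarith
    · rw [← norm_iteratedFDeriv_fderiv, ← norm_iteratedFDeriv_fderiv, norm_iteratedFDeriv_zero]
      linarith
  exact hle.trans_lt ((ENNReal.ofReal_lt_ofReal_iff hε).mpr (by linarith))

end ChartExistence

/-! ### A criterion for radially close charts -/

section RadialChart

variable {V : Type*} [Fintype V] [DecidableEq V] {K : PreAbstractSimplicialComplex V} {m : ℕ}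

/-- The deviation of the coefficients from those of the model metric: only the entries in the
directions of the ball are not zero. -/
def entryMatrix {k n : ℕ} {Y : Type*} [NormedAddCommGroup Y] [InnerProductSpace ℝ Y]
    (F : ℝ → E n → Bil n) (P : ChartParam k n Y) : Fin k ⊕ Unit → Fin k ⊕ Unit → E k × ℝ → ℝ
  | Sum.inl i, Sum.inl j => chartEntry F (EuclideanSpace.single i 1) (EuclideanSpace.single j 1) P
  | _, _ => fun _ => 0

/-- A criterion for the chart of a frame to be radially close to hyperbolic: the metric is the
hyperbolic extension of a family `F κ` of metrics, scaled by `κ`, with small jets of the entries. -/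
lemma isRadialChart_chart (S : SmoothSphere K m) {τ : Face K} (C : ChartFrame m (Face.empty K) τ m)
    {ξ ε κ : ℝ} (hε : 0 < ε) (hκ : 0 < κ) (hb : 1 + ξ ≤ C.b)
    {F : ℝ → LC m τ → Bil (m + 1 - τ.1.card)}
    (hF : ∀ v, ContDiffAt ℝ ∞ (fun p : ℝ × LC m τ => F p.1 p.2) (κ, v))
    (hcone : ∀ v, IsConeMetric v (F κ v)) {β : E (m + 1) → Bil (m + 1)}
    (hβ : ∀ q ∈ modelSpace m ξ, β (rescale Real.sinh (C.chart S.h q)) =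
      extB S.h (Face.empty K) τ (rescale Real.sinh (C.chart S.h q))
        (F κ (κ • T2 S.h (Face.empty K) τ (rescale Real.sinh (C.chart S.h q)))))
    (hjet : ∀ i j : Fin m, ∀ q ∈ modelSpace m ξ,
      ‖chartEntry F (EuclideanSpace.single i 1) (EuclideanSpace.single j 1)
          (κ, C.μ, (κ * Real.sinh C.b) • C.q₂, C.B₁, C.B₂) q‖ +
        ‖fderiv ℝ (chartEntry F (EuclideanSpace.single i 1) (EuclideanSpace.single j 1)
          (κ, C.μ, (κ * Real.sinh C.b) • C.q₂, C.B₁, C.B₂)) q‖ +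
        ‖fderiv ℝ (fderiv ℝ (chartEntry F (EuclideanSpace.single i 1) (EuclideanSpace.single j 1)
          (κ, C.μ, (κ * Real.sinh C.b) • C.q₂, C.B₁, C.B₂))) q‖ < ε / 2) :
    IsRadialChart (k := m) (polarOf β) ε ξ (C.chart S.h (0, 0)) (C.chart S.h) := by
  have hστ : (Face.empty K).1 ⊆ τ.1 := Finset.empty_subset _
  have hmem : ∀ q ∈ modelSpace m ξ, ‖q.1‖ < 1 ∧ 0 < q.2 + C.b := fun q hq =>
    ⟨by simpa using hq.1, by linarith [hq.2.1]⟩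
  have hopen : IsOpen (modelSpace m ξ) := Metric.isOpen_ball.prod isOpen_Ioo
  have hsh := Real.sinh_pos_iff.mpr C.b_pos
  refine ⟨fun q hq => (C.contDiffAt_chart S hστ (hmem q hq).1).contDiffWithinAt,
    C.injOn_chart hστ S.h hb, ?_, rfl, ⟨C.b, C.dir S.h, fun q hq =>
      ⟨C.norm_dir hστ S.h (hmem q hq).1, (hmem q hq).2, rfl⟩⟩, ?_⟩
  · rintro ⟨x, t⟩ hq
    exact C.injective_fderiv_chart S hστ (hmem _ hq).1 (hmem _ hq).2
  · refine C2norm_lt hopen (g := entryMatrix F (κ, C.μ, (κ * Real.sinh C.b) • C.q₂, C.B₁, C.B₂))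
      ?_ hε ?_ ?_
    · rintro ⟨x, t⟩ hq i j
      obtain ⟨hx, ht⟩ := hmem _ hq
      have hT2 := C.T2_rescale_chart hστ S.h (q := (x, t)) hx ht
      have hpt : κ • T2 S.h (Face.empty K) τ (rescale Real.sinh (C.chart S.h (x, t))) =
          (chartS C.μ t / chartN C.μ C.B₁ C.B₂ x) • ((κ * Real.sinh C.b) • C.q₂ + κ • C.B₂ x) := by
        have hμ : Real.sinh C.b * C.μ = 1 := mul_inv_cancel₀ hsh.ne'
        rw [hT2, ChartFrame.y₂, ← C.sinh_add]
        simp only [smul_add, smul_smul, ChartFrame.N]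
        congr 2
        · linear_combination (-κ * Real.sinh (t + C.b) / chartN C.μ C.B₁ C.B₂ x) * hμ
        · ring
      have hp := fun a a' s s' => C.pullback_chart S hστ hx ht (hβ (x, t) hq)
        (IsConeMetric.smul hκ.ne' (by rw [← hT2]; exact hcone _)) a a' s s'
      rcases i with i | i <;> rcases j with j | j <;>
        refine (congrArg (fun z => z - _) (hp _ _ _ _)).trans ?_
      · simp only [modelBasis, modelMetric, hpt, entryMatrix, chartEntry, ChartFrame.N, coeffs]
        ring
      all_goals
        simp [modelBasis, modelMetric, entryMatrix, coeffs, frameInner]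
    · rintro (i | i) (j | j) q hq
      · have h := contDiffAt_chartEntry (EuclideanSpace.single i (1 : ℝ))
          (EuclideanSpace.single j (1 : ℝ)) (κ, C.μ, (κ * Real.sinh C.b) • C.q₂, C.B₁, C.B₂) q hF
        have h₂ : ContDiffAt ℝ ∞ (fun q => ((κ, C.μ, (κ * Real.sinh C.b) • C.q₂, C.B₁, C.B₂), q)) q :=
          contDiffAt_const.prodMk contDiffAt_id
        exact (h.comp q h₂).of_le (by norm_cast)
      all_goals exact contDiffAt_const
    · rintro (i | i) (j | j) q hq
      · exact hjet i j q hq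
      all_goals
        have h0 : ∀ q : E m × ℝ, fderiv ℝ (fun _ : E m × ℝ => (0 : ℝ)) q = 0 := fun q =>
          fderiv_const_apply 0
        have h1 : fderiv ℝ (fun _ : E m × ℝ => (0 : ℝ)) = fun _ => 0 := funext h0
        have h2 : ‖fderiv ℝ (fderiv ℝ fun _ : E m × ℝ => (0 : ℝ)) q‖ = 0 := by
          rw [h1, fderiv_const_apply]
          exact norm_zero (E := E m × ℝ →L[ℝ] (E m × ℝ →L[ℝ] ℝ))
        change ‖(0 : ℝ)‖ + ‖fderiv ℝ (fun _ : E m × ℝ => (0 : ℝ)) q‖ +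
          ‖fderiv ℝ (fderiv ℝ fun _ : E m × ℝ => (0 : ℝ)) q‖ < ε / 2
        rw [h2, h0, norm_zero, norm_zero]
        linarith
end RadialChart

/-! ### Existence of radial charts -/

section Existence

variable {V : Type*} [Fintype V] [DecidableEq V] {K : PreAbstractSimplicialComplex V} {m k : ℕ}

/-- The frame of a chart centered at `p`, where `κ * rescale sinh p` is the point of the model that
corresponds to `p`.  By `hpos`, this point is so far from the boundary of the star of `τ` that the whole
chart stays over the open star. -/
lemma exists_chartFrame (S : SmoothSphere K m) {σ τ : Face K} (hστ : σ.1 ⊆ τ.1)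
    (hk : m + 1 - σ.1.card = k + 1) {κ : ℝ} (hκ : 0 < κ) {p : LC m σ} (hp : p ≠ 0)
    (hz : κ • rescale Real.sinh p ∈ starDom S.h σ τ) {γ : Bil (m + 1 - τ.1.card)}
    (hγ : IsConeMetric (T2 S.h σ τ (κ • rescale Real.sinh p)) γ) {b : ℝ}
    (hb : ∀ (B₁ : E k →L[ℝ] EV V) (B₂ : E k →L[ℝ] LC m τ),
      (∀ a a', inner ℝ (B₁ a) (B₁ a') + γ (B₂ a) (B₂ a') = inner ℝ a a') → ‖B₁‖ ≤ b ∧ ‖B₂‖ ≤ b)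
    (hpos : ∀ v ∈ τ.1, v ∉ σ.1 → κ * b < cc S.h σ (κ • rescale Real.sinh p) v) :
    ∃ C : ChartFrame k σ τ m, C.b = ‖p‖ ∧
      (κ * Real.sinh C.b) • C.q₁ = T1 S.h σ τ (κ • rescale Real.sinh p) ∧
      (κ * Real.sinh C.b) • C.q₂ = T2 S.h σ τ (κ • rescale Real.sinh p) ∧
      (∀ a a', inner ℝ (C.B₁ a) (C.B₁ a') + γ (C.B₂ a) (C.B₂ a') = inner ℝ a a') ∧
      C.chart S.h (0, 0) = p := by
  have hp0 : 0 < ‖p‖ := norm_pos_iff.mpr hp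
  have hsh : 0 < Real.sinh ‖p‖ := Real.sinh_pos_iff.mpr hp0
  set Z := κ • rescale Real.sinh p with hZ
  have hZn : ‖Z‖ = κ * Real.sinh ‖p‖ := by
    rw [hZ, norm_smul, Real.norm_of_nonneg hκ.le, norm_rescale_sinh]
  have hZ0 : 0 < ‖Z‖ := by rw [hZn]; positivity
  have hZne : Z ≠ 0 := norm_pos_iff.mp hZ0
  obtain ⟨B₁, B₂, hiso, horth, hfix⟩ := exists_frame S hστ hk hZne hz hγ
  obtain ⟨hB₁, hB₂⟩ := hb B₁ B₂ hiso
  have hT := norm_sq_T1_add_norm_sq_T2 S.h hστ hz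
  have hfixT : off σ.1 (part τ.1 (T1 S.h σ τ Z)) = T1 S.h σ τ Z := by
    ext v
    have h0 : v ∈ σ.1 → cc S.h σ Z v = 0 := fun hv => by
      rw [← off_cc S.h σ Z, off_apply, if_pos hv]
    by_cases hv : v ∈ σ.1 <;> by_cases hv' : v ∈ τ.1 <;>
      simp [T1, off_apply, part_apply, hv, hv', h0]
  let C : ChartFrame k σ τ m :=
    { b := ‖p‖
      q₁ := ‖Z‖⁻¹ • T1 S.h σ τ Z
      q₂ := ‖Z‖⁻¹ • T2 S.h σ τ Z
      B₁ := B₁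
      B₂ := B₂
      b_pos := hp0
      unit := by
        rw [norm_smul (‖Z‖⁻¹) (T1 S.h σ τ Z), norm_smul (‖Z‖⁻¹) (T2 S.h σ τ Z), mul_pow, mul_pow,
          ← mul_add, hT, norm_inv, norm_norm]
        field_simp
      orth := fun a => by
        rw [real_inner_smul_left, real_inner_smul_left, ← mul_add, horth, mul_zero]
      inj := fun a h₁ h₂ => by
        have h := hiso a a
        rw [h₁, h₂, inner_zero_left, Bil.ev_zero_left, add_zero] at h
        exact inner_self_eq_zero.mp h.symm
      fix_q := by rw [part_smul, off_smul, hfixT]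
      fix_B := hfix
      pos := fun x hx v hv hv' => by
        have h₁ : ‖B₁ x‖ ≤ b := (B₁.le_opNorm x).trans (by
          nlinarith [norm_nonneg B₁, norm_nonneg x])
        have h₂ : -b ≤ (B₁ x) v := by
          have := (PiLp.norm_apply_le (B₁ x) v).trans h₁
          rw [Real.norm_eq_abs] at this
          linarith [neg_abs_le ((B₁ x) v)]
        have h₃ : (T1 S.h σ τ Z) v = cc S.h σ Z v := by rw [T1, part_apply, if_pos hv]
        have h₄ := hpos v hv hv'
        have h₅ : (‖Z‖⁻¹ • T1 S.h σ τ Z + (Real.sinh ‖p‖)⁻¹ • B₁ x) v =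
            ‖Z‖⁻¹ * (cc S.h σ Z v + κ * (B₁ x) v) := by
          rw [PiLp.add_apply, PiLp.smul_apply, PiLp.smul_apply, h₃, hZn]
          simp only [smul_eq_mul]
          field_simp
        rw [h₅]
        exact mul_pos (inv_pos.mpr hZ0) (by nlinarith) }
  have hone : κ * Real.sinh ‖p‖ * ‖Z‖⁻¹ = 1 := by rw [← hZn]; exact mul_inv_cancel₀ hZ0.ne'
  refine ⟨C, rfl, ?_, ?_, hiso, ?_⟩
  · rw [smul_smul, hone, one_smul]
  · rw [smul_smul, hone, one_smul]
  · have hN : C.N 0 = 1 := by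
      have := C.N_sq 0
      simp only [frameInner, map_zero, inner_zero_left] at this
      have h := C.N_pos 0
      nlinarith
    have hmem : ‖Z‖⁻¹ • Z ∈ starDom S.h σ τ := (smul_mem_starDom S.h (inv_pos.mpr hZ0)).mpr hz
    have h₁ : C.dir S.h 0 = ‖Z‖⁻¹ • Z := by
      rw [ChartFrame.dir, hN, ChartFrame.y₁, ChartFrame.y₂, map_zero, map_zero, smul_zero, smul_zero,
        add_zero, add_zero, inv_one, one_smul, one_smul]
      change Tinv S.h σ τ (‖Z‖⁻¹ • T1 S.h σ τ Z, ‖Z‖⁻¹ • T2 S.h σ τ Z) = _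
      rw [← T1_smul S.h (inv_nonneg.mpr hZ0.le), ← T2_smul S.h (inv_nonneg.mpr hZ0.le)]
      exact Tinv_T S.h hστ hmem
    rw [ChartFrame.chart, h₁, zero_add]
    change ‖p‖ • ‖Z‖⁻¹ • Z = p
    rw [hZn, hZ, rescale, smul_smul, smul_smul, smul_smul]
    convert one_smul ℝ p using 2
    field_simp

/-- A normal coordinate of the chart, in units of `κ⁻¹`, is that of the center, moved by at most `κ ‖w‖` and
stretched. -/
lemma ChartFrame.smul_direction {σ τ : Face K} (C : ChartFrame k σ τ m) (κ : ℝ) (q : E k × ℝ)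
    {Z : Type*} [NormedAddCommGroup Z] [NormedSpace ℝ Z] (u w : Z) :
    κ • Real.sinh (q.2 + C.b) • (C.N q.1)⁻¹ • (u + C.μ • w) =
      (chartS C.μ q.2 / C.N q.1) • ((κ * Real.sinh C.b) • u + κ • w) := by
  have hμ : Real.sinh C.b * C.μ = 1 := mul_inv_cancel₀ (Real.sinh_pos_iff.mpr C.b_pos).ne'
  rw [← C.sinh_add]
  simp only [smul_add, smul_smul]
  congr 2
  · linear_combination (-κ * Real.sinh (q.2 + C.b) / C.N q.1) * hμ
  · ring

/-- The scaled chart in normal coordinates. -/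
lemma ChartFrame.smul_rescale_chart {σ τ : Face K} (C : ChartFrame k σ τ m) (hστ : σ.1 ⊆ τ.1)
    (h : SphereFamily K m) {κ : ℝ} (hκ : 0 < κ) {q : E k × ℝ} (hx : ‖q.1‖ < 1)
    (ht : 0 < q.2 + C.b) :
    T1 h σ τ (κ • rescale Real.sinh (C.chart h q)) = (chartS C.μ q.2 / C.N q.1) •
      ((κ * Real.sinh C.b) • C.q₁ + κ • C.B₁ q.1) ∧
    T2 h σ τ (κ • rescale Real.sinh (C.chart h q)) = (chartS C.μ q.2 / C.N q.1) •
      ((κ * Real.sinh C.b) • C.q₂ + κ • C.B₂ q.1) ∧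
    ‖κ • rescale Real.sinh (C.chart h q)‖ = chartS C.μ q.2 * (κ * Real.sinh C.b) := by
  have hμ : Real.sinh C.b * C.μ = 1 := mul_inv_cancel₀ (Real.sinh_pos_iff.mpr C.b_pos).ne'
  refine ⟨?_, ?_, ?_⟩
  · rw [T1_smul h hκ.le, C.T1_rescale_chart hστ h hx ht]
    exact C.smul_direction κ q C.q₁ (C.B₁ q.1)
  · rw [T2_smul h hκ.le, C.T2_rescale_chart hστ h hx ht]
    exact C.smul_direction κ q C.q₂ (C.B₂ q.1)
  · rw [C.rescale_chart hστ h hx ht, norm_smul, norm_smul, C.norm_dir hστ h hx, mul_one,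
      Real.norm_of_nonneg hκ.le, Real.norm_of_nonneg (Real.sinh_nonneg_iff.mpr ht.le), ← C.sinh_add]
    linear_combination (-κ * Real.sinh (q.2 + C.b)) * hμ

end Existence

section Stable

variable {V : Type*} [Fintype V] [DecidableEq V] {K : PreAbstractSimplicialComplex V} {m : ℕ}
  {ρ : ℝ → ℝ} {ς c C₀ : ℝ} {d : ℕ → ℝ} {κ : ℝ}

/-- The model is a hyperbolic extension along a simplex of least dimension near `w`, not only at
`w` but also at the points `z` whose components along this simplex and normal to it are nearly
proportional to those of `w`. -/
lemma model_eq_extB_of_near (S : SmoothSphere K m) (hρ : IsCutoff ρ) (hP : Params ς c C₀)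
    (hS : Small K m ς d κ) {σ τ : Face K} {w z : LC m σ} {C l δ : ℝ} {e₁ : EV V} {e₂ : LC m τ}
    (hw : Near S.h ς C σ w τ) (hmin : ∀ τ', Near S.h ς C σ w τ' → τ.1.card ≤ τ'.1.card)
    (hwd : w ∈ starDom S.h σ τ) (hz : z ∈ starDom S.h σ τ) (hz0 : z ≠ 0) (hl : 0 < l)
    (h₁ : T1 S.h σ τ z = l • (T1 S.h σ τ w + e₁)) (h₂ : T2 S.h σ τ z = l • (T2 S.h σ τ w + e₂))
    (he₁ : ‖e₁‖ ≤ δ) (he₂ : ‖e₂‖ ≤ δ) (hδ : δ ≤ wt ς m (m + 1) / 20)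
    (hC : 0 ≤ C) (hlo : Real.exp 1 < l * (7 / 10 * C - 1 / 20)) (hup : l * (C + 1 / 20) ≤ C₀)
    (hfar : σ.1.card + 1 ≤ m → Real.exp 1 * wt ς m σ.1.card ≤ ‖z‖) :
    model S.h ρ ς c d σ κ z = extB S.h σ τ z (model S.h ρ ς c d τ κ (T2 S.h σ τ z)) := by
  obtain ⟨hστ, hK, hn⟩ := hw
  have hδ' : ∀ τ' : Face K, δ ≤ wt ς m τ'.1.card / 20 := fun τ' => by
    have : τ'.1.card ≤ m + 1 := by
      rcases τ'.2 with h | h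
      · rw [h]; simp
      · exact S.card_le _ h
    linarith [hP.wt_anti m this]
  refine (eq_extB S hρ hP hS _ σ le_rfl τ z hz ?_ ?_).2 hfar
  · refine ⟨hστ, supp_union_mem_of_starDom S.h hστ.1 hz hz0, ?_⟩
    rw [← norm_T2 S.h hστ.1 hz, h₂, norm_smul, Real.norm_of_nonneg hl.le]
    have hT := norm_add_le (T2 S.h σ τ w) e₂
    rw [norm_T2 S.h hστ.1 hwd] at hT
    have hwt := hP.wt_pos m τ.1.card
    calc l * ‖T2 S.h σ τ w + e₂‖ ≤ l * ((C + 1 / 20) * wt ς m τ.1.card) :=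
          mul_le_mul_of_nonneg_left (by linarith [hδ' τ]) hl.le
      _ ≤ C₀ * wt ς m τ.1.card := by nlinarith
  · rintro τ' hτ' - ⟨hστ', -, hle⟩
    have hK' : supp (cc S.h σ w) ∪ τ'.1 ∈ K :=
      (K.isRelLowerSet_faces hK).2 (Finset.union_subset_union_right hτ'.1)
        ((Finset.card_pos.mp (Nat.zero_lt_of_lt (Finset.card_lt_card hστ'))).mono
          Finset.subset_union_right)
    have hD : C * wt ς m τ'.1.card ≤ ‖off τ'.1 (cc S.h σ w)‖ := by
      by_contra! hlt
      exact absurd (hmin τ' ⟨hστ', hK', hlt.le⟩) (not_le.mpr (Finset.card_lt_card hτ'))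
    have hwt := hP.wt_pos m τ'.1.card
    refine absurd (lt_norm_off hτ'.1 hl (w := cc S.h σ w) (w' := cc S.h σ z) h₁ he₁ ?_ hD
      (by positivity) (s := Real.exp 1 * wt ς m τ'.1.card) ?_) (not_lt.mpr hle)
    · rw [← norm_T2 S.h hστ.1 hwd, ← norm_T2 S.h hστ.1 hz, h₂, norm_smul, Real.norm_of_nonneg hl.le]
      refine mul_le_mul_of_nonneg_left ?_ hl.le
      have := norm_sub_le (T2 S.h σ τ w + e₂) e₂
      rw [add_sub_cancel_right] at this
      linarith
    · calc Real.exp 1 * wt ς m τ'.1.card < l * (7 / 10 * C - 1 / 20) * wt ς m τ'.1.card := by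
            gcongr
        _ ≤ l * (7 / 10 * (C * wt ς m τ'.1.card) - δ) := by
            rw [mul_assoc]
            exact mul_le_mul_of_nonneg_left (by linarith [hδ' τ']) hl.le

end Stable

/-- Bounds for the ratio by which the points of a chart with excess `T - 1` are stretched. -/
lemma chart_ratio_bounds {μ t T N : ℝ} (hμ : 0 ≤ μ) (hμT : μ ≤ Real.exp (-(2 * T)) / 10)
    (ht : |t| ≤ T) (hN : 1 ≤ N) (hN' : N ≤ 11 / 10) :
    9 / 10 * Real.exp (-T) ≤ chartS μ t ∧ 4 / 5 * Real.exp (-T) ≤ chartS μ t / N ∧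
      chartS μ t / N ≤ 11 / 10 * Real.exp T := by
  have h₁ := abs_le.mp (abs_chartS_sub_exp_le hμ ht)
  have h₂ : μ * Real.exp T ≤ Real.exp (-T) / 10 := by
    have : Real.exp (-(2 * T)) * Real.exp T = Real.exp (-T) := by rw [← Real.exp_add]; ring_nf
    nlinarith [Real.exp_pos T]
  obtain ⟨h₃, h₄⟩ := abs_le.mp ht
  have h₅ : Real.exp (-T) ≤ Real.exp t := Real.exp_le_exp.mpr h₃
  have h₆ : Real.exp t ≤ Real.exp T := Real.exp_le_exp.mpr h₄
  have h₇ : Real.exp (-T) ≤ Real.exp T := h₅.trans h₆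
  have hN0 : 0 < N := by linarith
  have hE := Real.exp_pos (-T)
  refine ⟨by linarith, ?_, ?_⟩
  · rw [le_div_iff₀ hN0]; nlinarith
  · rw [div_le_iff₀ hN0]; nlinarith

lemma ten_le_exp {ξ : ℝ} (hξ : 0 < ξ) : 10 ≤ Real.exp (ξ + 3) := by
  have h : Real.exp 1 ^ 3 ≤ Real.exp (ξ + 3) := by
    rw [← Real.exp_nat_mul]; exact Real.exp_le_exp.mpr (by norm_num; linarith)
  refine le_trans ?_ h
  exact le_trans (by norm_num : (10 : ℝ) ≤ (27 / 10) ^ 3)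
    (pow_le_pow_left₀ (by norm_num) (by linarith [Real.exp_one_gt_d9]) 3)

/-- The factor `exp (ξ + 3)` for the widths beats the stretching by charts of excess at most `ξ`,
and what it becomes after stretching is within the range in which extensions are controlled. -/
lemma width_bounds {ξ ξ' l c : ℝ} (hξ : 0 < ξ) (hle : ξ' ≤ ξ) (hc : Real.exp (4 + ξ) ≤ c)
    (hl : 4 / 5 * Real.exp (-(1 + ξ')) ≤ l) (hl' : l ≤ 11 / 10 * Real.exp (1 + ξ')) :
    Real.exp 1 < l * (7 / 10 * Real.exp (ξ + 3) - 1 / 20) ∧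
      l * (Real.exp (ξ + 3) + 1 / 20) ≤ c * Real.exp (ξ + 4) ∧
      Real.exp 1 ≤ 9 / 10 * Real.exp (-(1 + ξ')) * Real.exp (ξ + 3) := by
  have h10 := ten_le_exp hξ
  have he1 := Real.exp_one_gt_d9
  have hE := Real.exp_pos (-(1 + ξ'))
  have hl0 : 0 ≤ l := by linarith
  have hprod : Real.exp 1 * Real.exp 1 ≤ Real.exp (-(1 + ξ')) * Real.exp (ξ + 3) := by
    rw [← Real.exp_add, ← Real.exp_add]
    exact Real.exp_le_exp.mpr (by linarith)
  have hprod' : 27 / 10 * Real.exp 1 ≤ Real.exp (-(1 + ξ')) * Real.exp (ξ + 3) :=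
    (mul_le_mul_of_nonneg_right (by linarith) (by linarith)).trans hprod
  refine ⟨?_, ?_, by linarith⟩
  · have : 4 / 5 * Real.exp (-(1 + ξ')) * (69 / 100 * Real.exp (ξ + 3)) ≤
        l * (7 / 10 * Real.exp (ξ + 3) - 1 / 20) :=
      mul_le_mul hl (by linarith) (by linarith) hl0
    linarith
  · have e : Real.exp (1 + ξ) * Real.exp (ξ + 3) * Real.exp 4 =
        Real.exp (4 + ξ) * Real.exp (ξ + 4) := by
      rw [← Real.exp_add, ← Real.exp_add, ← Real.exp_add]; ring_nf
    have e' : Real.exp (4 + ξ) * Real.exp (ξ + 4) ≤ c * Real.exp (ξ + 4) :=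
      mul_le_mul_of_nonneg_right hc (Real.exp_pos _).le
    have h4 : (5 : ℝ) ≤ Real.exp 4 := by linarith [Real.add_one_le_exp (4 : ℝ)]
    have hpos : 0 < Real.exp (1 + ξ) * Real.exp (ξ + 3) := by positivity
    have h5 : Real.exp (1 + ξ) * Real.exp (ξ + 3) * 5 ≤
        Real.exp (1 + ξ) * Real.exp (ξ + 3) * Real.exp 4 := mul_le_mul_of_nonneg_left h4 hpos.le
    have h6 : Real.exp (1 + ξ') ≤ Real.exp (1 + ξ) := Real.exp_le_exp.mpr (by linarith)
    have : l * (Real.exp (ξ + 3) + 1 / 20) ≤ 11 / 10 * Real.exp (1 + ξ) * (2 * Real.exp (ξ + 3)) :=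
      mul_le_mul (by linarith) (by linarith) (by positivity) (by positivity)
    linarith

lemma norm_smul_apply_le {X Y : Type*} [NormedAddCommGroup X] [NormedSpace ℝ X]
    [NormedAddCommGroup Y] [NormedSpace ℝ Y] {κ b : ℝ} (hκ : 0 ≤ κ) (hb : 0 ≤ b) {B : X →L[ℝ] Y}
    (hB : ‖B‖ ≤ b) {x : X} (hx : ‖x‖ ≤ 1) : ‖κ • B x‖ ≤ κ * b := by
  rw [norm_smul, Real.norm_of_nonneg hκ]
  refine mul_le_mul_of_nonneg_left ((B.le_opNorm x).trans ?_) hκ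
  exact (mul_le_mul hB hx (norm_nonneg x) hb).trans (mul_one b).le

section Existence

variable {V : Type*} [Fintype V] [DecidableEq V] {K : PreAbstractSimplicialComplex V} {m : ℕ}
  {ρ : ℝ → ℝ} {ς c : ℝ} {d : ℕ → ℝ} {κ : ℝ}

/-- The conditions on a scale `κ` under which there are charts of height `T` at all points where `μ` is
the inverse of the hyperbolic sine of the distance to the origin.  Here `b` bounds the frames that are
orthonormal for the model, and `jet_lt` bounds the coefficients in the charts with such frames.  The
radius `e^{ξ + 3} wt ς m 0` bounds the component of a center normal to the simplex to which its chart
is adapted. -/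
structure ChartScale (h : SphereFamily K m) (ρ : ℝ → ℝ) (ς c : ℝ) (d : ℕ → ℝ) (ξ T b ε κ μ : ℝ) :
    Prop where
  pos : 0 < κ
  small : Small K m ς d κ
  le_exp : μ ≤ Real.exp (-(2 * T)) / 10
  mul_le : μ * b ≤ 1 / 20
  mul_le_wt : κ * b ≤ wt ς m (m + 1) / 20
  frame_le : ∀ (τ : Face K) (v : LC m τ), ‖v‖ ≤ Real.exp (ξ + 3) * wt ς m 0 →
    ∀ (B₁ : E m →L[ℝ] EV V) (B₂ : E m →L[ℝ] LC m τ),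
      (∀ a a', inner ℝ (B₁ a) (B₁ a') + model h ρ ς c d τ κ v (B₂ a) (B₂ a') = inner ℝ a a') →
      ‖B₁‖ ≤ b ∧ ‖B₂‖ ≤ b
  jet_lt : ∀ (τ : Face K) (i j : Fin m) (v : LC m τ), ‖v‖ ≤ Real.exp (ξ + 3) * wt ς m 0 →
    ∀ (B₁ : E m →L[ℝ] EV V) (B₂ : E m →L[ℝ] LC m τ),
      (∀ a a', inner ℝ (B₁ a) (B₁ a') + model h ρ ς c d τ κ v (B₂ a) (B₂ a') = inner ℝ a a') →
      ∀ (x : E m) (t : ℝ), ‖x‖ ≤ 1 → |t| ≤ T →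
      ‖chartEntry (model h ρ ς c d τ) (EuclideanSpace.single i 1) (EuclideanSpace.single j 1)
          (κ, μ, v, B₁, B₂) (x, t)‖ +
        ‖fderiv ℝ (chartEntry (model h ρ ς c d τ) (EuclideanSpace.single i 1)
          (EuclideanSpace.single j 1) (κ, μ, v, B₁, B₂)) (x, t)‖ +
        ‖fderiv ℝ (fderiv ℝ (chartEntry (model h ρ ς c d τ) (EuclideanSpace.single i 1)
          (EuclideanSpace.single j 1) (κ, μ, v, B₁, B₂))) (x, t)‖ < ε / 2

/-- The bound for the widths is `C₀ = c e^{ξ + 4}`: for `c ≥ e^{4 + ξ}` it exceeds the widths that arise by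
stretching, and `c ς < e^{-(8 + ξ)}` gives `C₀ ς ≤ 1 / 4`. -/
lemma params_of_bounds {ξ : ℝ} (hξ : 0 < ξ) (hς : 0 < ς) (h₁ : c * ς < Real.exp (-(8 + ξ)))
    (h₂ : Real.exp (4 + ξ) ≤ c) : Params ς c (c * Real.exp (ξ + 4)) := by
  have hc : 0 < c := (Real.exp_pos _).trans_le h₂
  refine ⟨hς, (Real.exp_lt_exp.mpr (by linarith)).trans_le h₂, ?_, ?_⟩
  · nlinarith [Real.add_one_le_exp (ξ + 4)]
  · have h₃ : c * ς * Real.exp (ξ + 4) ≤ Real.exp (-4) := by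
      have : Real.exp (-(8 + ξ)) * Real.exp (ξ + 4) = Real.exp (-4) := by
        rw [← Real.exp_add]; ring_nf
      rw [← this]
      exact mul_le_mul_of_nonneg_right h₁.le (Real.exp_pos _).le
    have h₄ : Real.exp (-4) ≤ 1 / 4 := by
      rw [Real.exp_neg, one_div]
      exact inv_anti₀ (by norm_num) (by linarith [Real.add_one_le_exp (4 : ℝ)])
    linarith

/-- Every point far from the origin is the center of a chart.  The chart is adapted to a simplex of
least dimension such that the point is, in the scale given by `κ`, near the cone of this simplex;
if there is none, then the point is near the vertex in this scale. -/
lemma exists_isRadialChart (S : SmoothSphere K m) (hρ : IsCutoff ρ) {ξ ξ' ε b : ℝ} (hξ : 0 < ξ)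
    (hς : 0 < ς) (h₁ : c * ς < Real.exp (-(8 + ξ))) (h₂ : Real.exp (4 + ξ) ≤ c) (hξ' : 0 < ξ')
    (hle : ξ' ≤ ξ) (hε : 0 < ε) (hb : 0 ≤ b) {p : LC m (Face.empty K)} (hp : 1 + ξ' ≤ ‖p‖)
    (hs : ChartScale S.h ρ ς c d ξ (1 + ξ') b ε κ (Real.sinh ‖p‖)⁻¹) :
    ∃ φ, IsRadialChart (k := m) (polarOf fun x => model S.h ρ ς c d (Face.empty K) κ (κ • x)) ε ξ' p φ := by
  have hP := params_of_bounds hξ hς h₁ h₂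
  have hκ := hs.pos
  have hpn : 0 < ‖p‖ := by linarith
  have hp0 : p ≠ 0 := norm_pos_iff.mp hpn
  have hw0 := hP.wt_pos m 0
  have hexp3 := ten_le_exp hξ
  have hcone : ∀ (τ : Face K) v, IsConeMetric v (model S.h ρ ς c d τ κ v) := fun τ v =>
    isConeMetric_model S hρ hP _ τ (Nat.lt_succ_self _) v
  have hsmooth : ∀ (τ : Face K) v,
      ContDiffAt ℝ ∞ (fun p : ℝ × LC m τ => model S.h ρ ς c d τ p.1 p.2) (κ, v) := fun τ v =>
    contDiffAt_model S hρ hP _ τ (Nat.lt_succ_self _) κ hs.small v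
  have habs : ∀ q ∈ modelSpace m ξ', ‖q.1‖ < 1 ∧ |q.2| ≤ 1 + ξ' := fun q hq =>
    ⟨by simpa using hq.1, abs_le.mpr ⟨hq.2.1.le, hq.2.2.le⟩⟩
  set Z : LC m (Face.empty K) := κ • rescale Real.sinh p with hZ
  have hZn : ‖Z‖ = κ * Real.sinh ‖p‖ := by
    rw [hZ, norm_smul, Real.norm_of_nonneg hκ.le, norm_rescale_sinh]
  have hsh : 0 < Real.sinh ‖p‖ := Real.sinh_pos_iff.mpr hpn
  have hZ0 : Z ≠ 0 := norm_pos_iff.mp (by rw [hZn]; positivity)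
  -- it suffices to find a simplex along which the model is a hyperbolic extension
  suffices H : ∃ τ : Face K, Z ∈ starDom S.h (Face.empty K) τ ∧
      ‖T2 S.h (Face.empty K) τ Z‖ ≤ Real.exp (ξ + 3) * wt ς m 0 ∧
      (∀ v ∈ τ.1, κ * b < cc S.h (Face.empty K) Z v) ∧
      ∀ z ∈ starDom S.h (Face.empty K) τ, z ≠ 0 → ∀ l e₁ e₂, 4 / 5 * Real.exp (-(1 + ξ')) ≤ l →
        l ≤ 11 / 10 * Real.exp (1 + ξ') → ‖e₁‖ ≤ κ * b → ‖e₂‖ ≤ κ * b →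
        9 / 10 * Real.exp (-(1 + ξ')) * ‖Z‖ ≤ ‖z‖ →
        T1 S.h (Face.empty K) τ z = l • (T1 S.h (Face.empty K) τ Z + e₁) →
        T2 S.h (Face.empty K) τ z = l • (T2 S.h (Face.empty K) τ Z + e₂) →
        model S.h ρ ς c d (Face.empty K) κ z = extB S.h (Face.empty K) τ z
          (model S.h ρ ς c d τ κ (T2 S.h (Face.empty K) τ z)) by
    obtain ⟨τ, hZd, hZR, hpos, hext⟩ := H
    have hστ : (Face.empty K).1 ⊆ τ.1 := Finset.empty_subset _
    obtain ⟨C, hCb, hC₁, hC₂, hiso, hcen⟩ := exists_chartFrame S hστ (k := m) rfl hκ hp0 hZd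
      (hcone τ _) (hs.frame_le τ _ hZR) fun v hv _ => hpos v hv
    obtain ⟨hB₁, hB₂⟩ := hs.frame_le τ _ hZR _ _ hiso
    have hμ : C.μ = (Real.sinh ‖p‖)⁻¹ := by rw [ChartFrame.μ, hCb]
    refine ⟨C.chart S.h, ?_⟩
    have := isRadialChart_chart S C (ξ := ξ') hε hκ (by rw [hCb]; exact hp) (hsmooth τ) (hcone τ)
      (β := fun x => model S.h ρ ς c d (Face.empty K) κ (κ • x)) ?_ ?_
    · rwa [hcen] at this
    · intro q hq
      obtain ⟨hx, ht⟩ := habs q hq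
      have htb : 0 < q.2 + C.b := by linarith [hq.2.1]
      obtain ⟨e₁, e₂, e₃⟩ := C.smul_rescale_chart hστ S.h hκ hx htb
      obtain ⟨r₁, r₂, r₃⟩ := chart_ratio_bounds (N := C.N q.1) C.μ_pos.le (by rw [hμ]; exact hs.le_exp)
        ht (one_le_chartN _ _ _ _) ((chartN_le C.μ_pos.le hB₁ hB₂ hx.le).trans (by
          rw [hμ]; linarith [hs.mul_le]))
      rw [hC₁] at e₁
      rw [hC₂] at e₂
      have hmem := C.rescale_chart_mem hστ S.h hx htb
      have hne : κ • rescale Real.sinh (C.chart S.h q) ≠ 0 := by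
        rw [← norm_ne_zero_iff, e₃, hCb, ← hZn]
        exact (mul_pos ((by positivity : (0 : ℝ) < _).trans_le r₁) (norm_pos_iff.mpr hZ0)).ne'
      have := hext _ ((smul_mem_starDom S.h hκ).mpr hmem) hne _ _ _ r₂ r₃ (norm_smul_apply_le hκ.le hb hB₁ hx.le)
        (norm_smul_apply_le hκ.le hb hB₂ hx.le) (by
          rw [e₃, hCb, ← hZn]
          exact mul_le_mul_of_nonneg_right r₁ (norm_nonneg _)) e₁ e₂
      rw [extB_smul S.h hκ, T2_smul S.h hκ.le] at this
      exact this
    · intro i j q hq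
      obtain ⟨hx, ht⟩ := habs q hq
      rw [hC₂, hμ]
      exact hs.jet_lt τ i j _ hZR _ _ hiso q.1 q.2 hx.le ht
  rcases le_or_gt ‖Z‖ (Real.exp (ξ + 3) * wt ς m 0) with hcase | hcase
  · -- near the vertex, in the scale given by `κ`, the chart is adapted to the empty simplex
    refine ⟨Face.empty K, fun v hv => absurd hv (Finset.notMem_empty v), by rwa [T2_self],
      fun v hv => absurd hv (Finset.notMem_empty v), ?_⟩
    intro z _ _ _ _ _ _ _ _ _ _ _ _
    rw [extB_self, T2_self]
  · -- otherwise to a simplex of least dimension near `p`, with the widths enlarged by `e^{ξ + 3}`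
    obtain ⟨τ, hnear, hmin⟩ := exists_leastNear hP hZ0 (Real.exp_pos (ξ + 3)).le
    have hC₀ : Real.exp (ξ + 3) ≤ c * Real.exp (ξ + 4) := by
      have : Real.exp (ξ + 3) ≤ Real.exp (ξ + 4) := Real.exp_le_exp.mpr (by linarith)
      nlinarith [hP.two_le, Real.exp_pos (ξ + 4)]
    have hcardle : τ.1.card ≤ m + 1 := by
      rcases τ.2 with h | h
      · rw [h]; simp
      · exact S.card_le _ h
    have hwle := hP.wt_anti m hcardle
    have hwpos := hP.wt_pos m (m + 1)
    have hcc : ∀ v ∈ τ.1, wt ς m τ.1.card ≤ cc S.h (Face.empty K) Z v := fun v hv =>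
      le_cc_apply hP (show wt ς m 0 / 2 ≤ ‖Z‖ by nlinarith) (by linarith)
        ⟨hnear.1, hnear.2.1, hnear.2.2.trans (mul_le_mul_of_nonneg_right hC₀
          (hP.wt_pos m _).le)⟩ hmin hv (Finset.notMem_empty v)
    have hZd : Z ∈ starDom S.h (Face.empty K) τ := fun v hv _ =>
      (hP.wt_pos m _).trans_le (hcc v hv)
    refine ⟨τ, hZd, ?_, fun v hv => ?_, ?_⟩
    · rw [norm_T2 S.h (Finset.empty_subset _) hZd]
      exact hnear.2.2.trans (mul_le_mul_of_nonneg_left (hP.wt_anti m (Nat.zero_le _))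
        (Real.exp_pos _).le)
    · linarith [hcc v hv, hs.mul_le_wt]
    · intro z hz hz0 l e₁ e₂ hl hl' he₁ he₂ hzn h₁' h₂'
      obtain ⟨w₁, w₂, w₃⟩ := width_bounds hξ hle h₂ hl hl'
      refine model_eq_extB_of_near S hρ hP hs.small hnear hmin hZd hz hz0
        ((by positivity : (0 : ℝ) < _).trans_le hl) h₁' h₂' he₁ he₂ hs.mul_le_wt
        (Real.exp_pos _).le w₁ w₂ fun _ => ?_
      calc Real.exp 1 * wt ς m 0 ≤
            9 / 10 * Real.exp (-(1 + ξ')) * Real.exp (ξ + 3) * wt ς m 0 :=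
            mul_le_mul_of_nonneg_right w₃ hw0.le
        _ ≤ 9 / 10 * Real.exp (-(1 + ξ')) * ‖Z‖ := by
            rw [mul_assoc]
            exact mul_le_mul_of_nonneg_left hcase.le (by positivity)
        _ ≤ ‖z‖ := hzn

end Existence

/-! ### Uniform choice of the scale -/

section Scale

variable {V : Type*} [Fintype V] [DecidableEq V] {K : PreAbstractSimplicialComplex V} {m : ℕ}
  {ρ : ℝ → ℝ} {ς c C₀ : ℝ} {d : ℕ → ℝ}

/-- For cut-offs that are slow enough, all small scales allow charts that are close to hyperbolic.
The bound for the scale comes from the compactness of the set of all frames. -/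
lemma exists_chartScale (S : SmoothSphere K m) (hρ : IsCutoff ρ) (hP : Params ς c C₀)
    {ξ T η ε : ℝ} (hη0 : 0 ≤ η) (hη : η ≤ 1) (hηε : η * jetConst T < ε / 2)
    (hd : ∀ σ : Face K, σ.1.card + 1 ≤ m → 1 ≤ d (m - σ.1.card + 1))
    (hslow : ∀ τ : Face K, SlowModel S.h ρ ς c d τ η) :
    ∃ b κ₁ : ℝ, 0 ≤ b ∧ 0 < κ₁ ∧ ∀ κ μ, 0 < κ → κ < κ₁ → 0 < μ → μ < κ₁ →
      ChartScale S.h ρ ς c d ξ T b ε κ μ := by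
  have hsm0 : Small K m ς d 0 := ⟨hd, fun σ _ => by
    rw [abs_zero]; exact mul_pos (Real.exp_pos _) (hP.wt_pos m _)⟩
  -- the scales up to `κ₀`, `κ = 0` included, form a compact interval on which the model is smooth
  obtain ⟨κ₀', hκ₀', hball⟩ := Metric.eventually_nhds_iff.mp hsm0.eventually
  set κ₀ := κ₀' / 2 with hκ₀
  have hκ₀pos : 0 < κ₀ := by positivity
  have hsm : ∀ κ ∈ Set.Icc 0 κ₀, Small K m ς d κ := fun κ hκ => hball (by
    rw [Real.dist_eq, sub_zero, abs_of_nonneg hκ.1]; linarith [hκ.2])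
  have hF : ∀ (τ : Face K), ∀ κ ∈ Set.Icc 0 κ₀, ∀ v : LC m τ,
      ContDiffAt ℝ ∞ (fun p : ℝ × LC m τ => model S.h ρ ς c d τ p.1 p.2) (κ, v) :=
    fun τ κ hκ v => contDiffAt_model S hρ hP _ τ (Nat.lt_succ_self _) κ (hsm κ hκ) v
  have hF' : ∀ (τ : Face K), ∀ κ ∈ Set.Icc 0 κ₀, ∀ᶠ κ' in nhds κ, ∀ v : LC m τ,
      ContDiffAt ℝ ∞ (fun p : ℝ × LC m τ => model S.h ρ ς c d τ p.1 p.2) (κ', v) := by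
    intro τ κ hκ
    filter_upwards [(hsm κ hκ).eventually] with κ' hκ' v
    exact contDiffAt_model S hρ hP _ τ (Nat.lt_succ_self _) κ' hκ' v
  have hcone : ∀ (τ : Face K) κ v, IsConeMetric v (model S.h ρ ς c d τ κ v) := fun τ κ v =>
    isConeMetric_model S hρ hP _ τ (Nat.lt_succ_self _) v
  set R := Real.exp (ξ + 3) * wt ς m 0 with hR
  have hfr : ∀ τ : Face K, ∃ C > 0, ∀ κ ∈ Set.Icc 0 κ₀, ∀ v : LC m τ, ‖v‖ ≤ R →
      ∀ (B₁ : E m →L[ℝ] EV V) (B₂ : E m →L[ℝ] LC m τ), (∀ a a', inner ℝ (B₁ a) (B₁ a') +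
        model S.h ρ ς c d τ κ v (B₂ a) (B₂ a') = inner ℝ a a') → ‖B₁‖ ≤ C ∧ ‖B₂‖ ≤ C :=
    fun τ => exists_frame_bound (hF τ) (hcone τ)
  choose C hC0 hC using hfr
  obtain ⟨b, hb⟩ := Finite.exists_le C
  have hb0 : 0 ≤ b := (hC0 (Face.empty K)).le.trans (hb _)
  have hwt := hP.wt_pos m (m + 1)
  have hjet : ∀ τ : Face K, ∀ i j : Fin m, ∀ᶠ δ in nhdsWithin (0 : ℝ) (Set.Ioi 0),
      ∀ κ ∈ Set.Icc 0 κ₀, ∀ μ ∈ Set.Icc (0 : ℝ) 1, κ + μ < 2 * δ → ∀ v : LC m τ, ‖v‖ ≤ R →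
      ∀ (B₁ : E m →L[ℝ] EV V) (B₂ : E m →L[ℝ] LC m τ),
      (∀ a a', inner ℝ (B₁ a) (B₁ a') + model S.h ρ ς c d τ κ v (B₂ a) (B₂ a') = inner ℝ a a') →
      ∀ (x : E m) (t : ℝ), ‖x‖ ≤ 1 → |t| ≤ T →
      ‖chartEntry (model S.h ρ ς c d τ) (EuclideanSpace.single i 1) (EuclideanSpace.single j 1)
          (κ, μ, v, B₁, B₂) (x, t)‖ +
        ‖fderiv ℝ (chartEntry (model S.h ρ ς c d τ) (EuclideanSpace.single i 1)
          (EuclideanSpace.single j 1) (κ, μ, v, B₁, B₂)) (x, t)‖ +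
        ‖fderiv ℝ (fderiv ℝ (chartEntry (model S.h ρ ς c d τ) (EuclideanSpace.single i 1)
          (EuclideanSpace.single j 1) (κ, μ, v, B₁, B₂))) (x, t)‖ < ε / 2 := by
    intro τ i j
    obtain ⟨κ₁, hκ₁, h⟩ := exists_chartEntry_bound (Y := EV V) (k := m) (R := R) (hF τ) (hF' τ)
      (hcone τ) hη0 hη (hslow τ) hηε (EuclideanSpace.single i 1) (EuclideanSpace.single j 1)
      (by simp) (by simp)
    filter_upwards [Ioo_mem_nhdsGT (half_pos hκ₁)] with δ hδ κ hκ μ hμ hlt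
    exact h κ hκ μ hμ (by linarith [hδ.2])
  have hall := Filter.eventually_all.mpr fun τ => Filter.eventually_all.mpr fun i =>
    Filter.eventually_all.mpr fun j => hjet τ i j
  have hE := Real.exp_pos (-(2 * T))
  obtain ⟨δ, hδ, hδ0, hδ₁, hδ₂, hδ₃, hδ₄, hδ₅⟩ : ∃ δ : ℝ, (∀ τ : Face K, ∀ i j : Fin m, _) ∧
      0 < δ ∧ δ ≤ κ₀ ∧ δ ≤ 1 ∧ δ ≤ Real.exp (-(2 * T)) / 10 ∧ δ ≤ 1 / 20 / (b + 1) ∧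
      δ ≤ wt ς m (m + 1) / 20 / (b + 1) := by
    have hsmall : ∀ a : ℝ, 0 < a → ∀ᶠ δ in nhdsWithin (0 : ℝ) (Set.Ioi 0), δ ≤ a := fun a ha => by
      filter_upwards [Ioo_mem_nhdsGT ha] with δ hδ using hδ.2.le
    have hpos : ∀ᶠ δ in nhdsWithin (0 : ℝ) (Set.Ioi 0), 0 < δ := self_mem_nhdsWithin
    exact (hall.and (hpos.and ((hsmall _ hκ₀pos).and ((hsmall _ one_pos).and
      ((hsmall _ (by positivity)).and ((hsmall _ (by positivity)).and
        (hsmall _ (by positivity)))))))).exists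
  have hmulb : ∀ x a : ℝ, 0 < x → x < δ → δ ≤ a / (b + 1) → x * b ≤ a := fun x a hx hxδ ha => by
    rw [le_div_iff₀ (by linarith)] at ha
    nlinarith
  refine ⟨b, δ, hb0, hδ0, fun κ μ hκ hκδ hμ hμδ => ?_⟩
  have hκm : κ ∈ Set.Icc 0 κ₀ := ⟨hκ.le, by linarith⟩
  exact
    { pos := hκ
      small := hsm κ hκm
      le_exp := by linarith
      mul_le := hmulb μ _ hμ hμδ hδ₄
      mul_le_wt := hmulb κ _ hκ hκδ hδ₅
      frame_le := fun τ v hv B₁ B₂ hB => by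
        obtain ⟨h₁, h₂⟩ := hC τ κ hκm v hv B₁ B₂ hB
        exact ⟨h₁.trans (hb τ), h₂.trans (hb τ)⟩
      jet_lt := fun τ i j v hv B₁ B₂ hB x t hx ht =>
        hδ τ i j κ hκm μ ⟨hμ.le, by linarith⟩ (by linarith) v hv B₁ B₂ hB x t hx ht }

end Scale

/-! ### Smooth Riemannian metrics in polar coordinates -/

/-- The function `sinh √u / √u`, given by its power series. -/
def sinhcSqrt : ℝ → ℝ := FormalMultilinearSeries.ofScalarsSum fun n : ℕ => ((2 * n + 1).factorial : ℝ)⁻¹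

/-- The power series `∑ uⁿ / (2n + 1)!` converges everywhere. -/
lemma analyticAt_sinhcSqrt : AnalyticAt ℝ sinhcSqrt 0 := by
  have h : (FormalMultilinearSeries.ofScalars ℝ
      fun n : ℕ => ((2 * n + 1).factorial : ℝ)⁻¹).radius = ⊤ := by
    refine FormalMultilinearSeries.ofScalars_radius_eq_top_of_tendsto ℝ _
      (Filter.Eventually.of_forall fun n => by positivity) ?_
    refine squeeze_zero (fun n => by positivity) (fun n => ?_)
      (tendsto_one_div_add_atTop_nhds_zero_nat (𝕜 := ℝ))
    rw [Real.norm_of_nonneg (by positivity), Real.norm_of_nonneg (by positivity), Nat.succ_eq_add_one,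
      show 2 * (n + 1) + 1 = (2 * n + 1) + 1 + 1 by ring, Nat.factorial_succ, Nat.factorial_succ]
    have hf : (0 : ℝ) < ((2 * n + 1).factorial : ℝ) := by positivity
    push_cast
    rw [mul_inv, mul_inv, ← mul_assoc, mul_div_assoc, div_self (inv_ne_zero hf.ne'), mul_one,
      ← mul_inv, one_div]
    refine inv_anti₀ (by positivity) ?_
    have hn : (0 : ℝ) ≤ n := n.cast_nonneg
    nlinarith
  exact (FormalMultilinearSeries.hasFPowerSeriesOnBall (𝕜 := ℝ) (E := ℝ) (F := ℝ)
    (FormalMultilinearSeries.ofScalars ℝ fun n : ℕ => ((2 * n + 1).factorial : ℝ)⁻¹)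
    (by rw [h]; exact ENNReal.coe_lt_top)).analyticAt

lemma sinhcSqrt_sq {x : ℝ} (hx : x ≠ 0) : sinhcSqrt (x ^ 2) = Real.sinh x / x := by
  rw [sinhcSqrt, FormalMultilinearSeries.ofScalarsSum_eq_tsum]
  refine HasSum.tsum_eq ?_
  convert (Real.hasSum_sinh x).div_const x using 2 with n
  rw [smul_eq_mul]
  field_simp
  ring

lemma sinhcSqrt_zero : sinhcSqrt 0 = 1 := by
  rw [sinhcSqrt, FormalMultilinearSeries.ofScalarsSum_zero]; simp

/-- The hyperbolic metric is smooth at the origin in polar coordinates. -/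
lemma contDiffAt_hypPolar {n : ℕ} (a b : E n) :
    ContDiffAt ℝ ∞ (fun p => hypPolar p a b) (0 : E n) := by
  have hG : AnalyticAt ℝ (fun u => sinhcSqrt u ^ 2) 0 := analyticAt_sinhcSqrt.pow 2
  have hG' := hG
  obtain ⟨q, hq⟩ := hG'
  have hH : AnalyticAt ℝ (dslope (fun u => sinhcSqrt u ^ 2) 0) 0 :=
    ⟨_, hq.has_fpower_series_dslope_fslope⟩
  have hsq : ContDiffAt ℝ ∞ (fun p : E n => ‖p‖ ^ 2) 0 := (contDiff_norm_sq ℝ).contDiffAt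
  have h0 : ‖(0 : E n)‖ ^ 2 = 0 := by simp
  have c₁ : ContDiffAt ℝ ∞ (fun p : E n => sinhcSqrt (‖p‖ ^ 2) ^ 2) 0 :=
    ContDiffAt.comp (g := fun u => sinhcSqrt u ^ 2) (0 : E n) (by rw [h0]; exact hG.contDiffAt) hsq
  have c₂ : ContDiffAt ℝ ∞
      (fun p : E n => dslope (fun u => sinhcSqrt u ^ 2) 0 (‖p‖ ^ 2)) 0 :=
    ContDiffAt.comp (0 : E n) (by rw [h0]; exact hH.contDiffAt) hsq
  have c₃ : ∀ a : E n, ContDiffAt ℝ ∞ (fun p : E n => (inner ℝ p a : ℝ)) 0 := fun a =>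
    contDiffAt_id.inner ℝ contDiffAt_const
  refine ((c₁.mul (contDiffAt_const (c := (inner ℝ a b : ℝ)))).sub
    (c₂.mul ((c₃ a).mul (c₃ b)))).congr_of_eventuallyEq (Filter.Eventually.of_forall fun p => ?_)
  by_cases hp : p = 0
  · simp [hypPolar, hp, sinhcSqrt_zero]
  · have hn : ‖p‖ ≠ 0 := norm_ne_zero_iff.mpr hp
    simp only [hypPolar, if_neg hp, radialForm]
    rw [dslope_of_ne _ (pow_ne_zero 2 hn), slope_def_field, sinhcSqrt_zero, sinhcSqrt_sq hn]
    field_simp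
    ring

section Polar

variable {n : ℕ} {β : E n → Bil n}

/-- By the lemma of Gauss, `β - radialForm` is the value of `β` on the components orthogonal to `p`. -/
lemma polarOf_pos {p : E n} (hβ : IsConeMetric p (β (rescale Real.sinh p))) {a : E n} (ha : a ≠ 0) :
    0 < polarOf β p a a := by
  unfold polarOf
  split_ifs with hp
  · exact real_inner_self_pos.mpr ha
  have hn : 0 < ‖p‖ := norm_pos_iff.mpr hp
  have hs : 0 < Real.sinh ‖p‖ / ‖p‖ := div_pos (Real.sinh_pos_iff.mpr hn) hn
  set B := β (rescale Real.sinh p)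
  set l := (inner ℝ p a : ℝ) / ‖p‖ ^ 2 with hl
  have h₁ : B (a - l • p) (a - l • p) = B a a - radialForm p a a := by
    rw [sub_eq_add_neg, ← neg_smul]
    simp only [Bil.ev_add_left, Bil.ev_add_right, Bil.ev_smul_left, Bil.ev_smul_right, hβ.gauss,
      hβ.symm a p, real_inner_self_eq_norm_sq, radialForm, hl]
    field_simp
    ring
  have h₂ : radialForm p a a = l ^ 2 * ‖p‖ ^ 2 := by
    rw [radialForm, hl]; field_simp
  rw [← h₁]
  by_cases h0 : a - l • p = 0
  · have hl0 : l ≠ 0 := fun h => ha (by rw [h, zero_smul, sub_zero] at h0; exact h0)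
    rw [h0, Bil.ev_zero_left, h₂]
    positivity
  · have := hβ.pos _ h0
    rw [h₂]
    positivity

lemma polarOf_self (p b : E n) (hβ : IsConeMetric p (β (rescale Real.sinh p))) :
    polarOf β p p b = inner ℝ p b := by
  unfold polarOf
  split_ifs with hp
  · rfl
  · have hn : ‖p‖ ≠ 0 := norm_ne_zero_iff.mpr hp
    simp only [hβ.gauss, radialForm, real_inner_self_eq_norm_sq]
    field_simp
    ring

lemma contDiffAt_polarOf {p : E n} (hp : p ≠ 0) (hβ : ContDiffAt ℝ ∞ β (rescale Real.sinh p))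
    (a b : E n) : ContDiffAt ℝ ∞ (fun p => polarOf β p a b) p := by
  have hn : ‖p‖ ≠ 0 := norm_ne_zero_iff.mpr hp
  have hnorm : ContDiffAt ℝ ∞ (fun p : E n => ‖p‖) p := contDiffAt_norm ℝ hp
  have hs : ContDiffAt ℝ ∞ (fun p : E n => Real.sinh ‖p‖ / ‖p‖) p :=
    (Real.contDiff_sinh.contDiffAt.comp p hnorm).div hnorm hn
  have hr : ContDiffAt ℝ ∞ (fun p : E n => rescale Real.sinh p) p := hs.smul contDiffAt_id
  have hB : ContDiffAt ℝ ∞ (fun p : E n => β (rescale Real.sinh p) a b) p :=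
    Bil.contDiffAt_ev (hβ.comp p hr) contDiffAt_const contDiffAt_const
  have hi : ∀ a : E n, ContDiffAt ℝ ∞ (fun p : E n => (inner ℝ p a : ℝ)) p := fun a =>
    contDiffAt_id.inner ℝ contDiffAt_const
  have hR : ContDiffAt ℝ ∞ (fun p : E n => radialForm p a b) p :=
    ((hi a).mul (hi b)).div (hnorm.pow 2) (pow_ne_zero 2 hn)
  refine (((hs.pow 2).mul (hB.sub hR)).add hR).congr_of_eventuallyEq ?_
  filter_upwards [isOpen_ne.mem_nhds hp] with q hq
  rw [polarOf, if_neg hq]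

/-- A smooth family of Euclidean-like metrics that is Euclidean near the origin gives a Riemannian
metric in polar coordinates. -/
lemma isRiemannianMetric_polarOf (hcone : ∀ x, IsConeMetric x (β x)) (hsm : ContDiff ℝ ∞ β)
    {s : ℝ} (hs : 0 < s) (hhyp : ∀ p : E n, ‖p‖ < s → polarOf β p = hypPolar p) :
    IsRiemannianMetric (polarOf β) ∧ ∀ p b, polarOf β p p b = inner ℝ p b := by
  have hcone' : ∀ p, IsConeMetric p (β (rescale Real.sinh p)) := fun p => by
    by_cases hp : p = 0
    · have := hcone (rescale Real.sinh p)
      rwa [hp, rescale, smul_zero] at this ⊢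
    · have hn := norm_pos_iff.mpr hp
      exact IsConeMetric.smul (div_pos (Real.sinh_pos_iff.mpr hn) hn).ne' (hcone _)
  refine ⟨⟨fun p => ?_, fun p a b => ?_, fun p a ha => polarOf_pos (hcone' p) ha, fun a b => ?_⟩,
    fun p b => polarOf_self p b (hcone' p)⟩
  · refine ⟨LinearMap.mk₂ ℝ (polarOf β p) ?_ ?_ ?_ ?_, fun a b => rfl⟩ <;> intros <;>
      simp only [polarOf, radialForm, Bil.ev_add_left, Bil.ev_add_right, Bil.ev_smul_left,
        Bil.ev_smul_right, inner_add_left, inner_add_right, real_inner_smul_left,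
        real_inner_smul_right, smul_eq_mul] <;> split_ifs <;> ring
  · simp only [polarOf, radialForm, (hcone' p).symm a b, real_inner_comm a b]
    split_ifs <;> ring
  · rw [contDiff_iff_contDiffAt]
    intro p
    by_cases hp : p = 0
    · rw [hp]
      refine (contDiffAt_hypPolar a b).congr_of_eventuallyEq ?_
      filter_upwards [Metric.ball_mem_nhds (0 : E n) hs] with q hq
      rw [hhyp q (by simpa using hq)]
    · exact contDiffAt_polarOf hp hsm.contDiffAt a b

end Polar

/-! ### The smoothed metric near the vertex -/

section Final

variable {V : Type*} [Fintype V] [DecidableEq V] {K : PreAbstractSimplicialComplex V} {m : ℕ}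
  {ρ : ℝ → ℝ}

lemma le_rad {ς r : ℝ} (hς : 0 < ς) (hς₁ : ς < 1) (hr : 0 < r) (i : ℕ) : r ≤ rad ς r i := by
  rw [rad, ← Real.arsinh_sinh r, Real.sinh_arsinh]
  refine Real.arsinh_le_arsinh.mpr ?_
  rw [le_div_iff₀ (pow_pos hς i)]
  exact mul_le_of_le_one_right (Real.sinh_pos_iff.mpr hr).le (pow_le_one₀ hς.le hς₁.le)

/-- The smoothed metric is hyperbolic on the ball where the cut-off of the hyperbolic forcing
vanishes. -/
lemma smoothedMetric_eq_hypPolar (S : SmoothSphere K m) (hρ : IsCutoff ρ) {ξ ς c r : ℝ}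
    {d : ℕ → ℝ} (hd : 0 < d (m + 1)) {p : E (m + 1)} (hp : ‖p‖ < rad ς r (m - 1) - d (m + 1)) :
    smoothedMetric S ρ ξ ς c r d p = hypPolar p := by
  have h : ρ (2 * ((‖p‖ - (rad ς r (m - 1) - d (m + 1))) / d (m + 1))) = 0 :=
    hρ.eq_zero (mul_nonpos_of_nonneg_of_nonpos two_pos.le
      (div_nonpos_of_nonpos_of_nonneg (by linarith) hd.le))
  funext a b
  rw [smoothedMetric, smoothedLink, hypForcing]
  refine (congrArg (fun z => (1 - z) * hypPolar p a b + z * _) h).trans ?_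
  ring

end Final

end HypCone

end

theorem proposition8p4p2 {V : Type*} [Fintype V] [DecidableEq V]
    (ρ : ℝ → ℝ) (hρ : HypCone.IsCutoff ρ)
    (m : ℕ) (hm : 1 ≤ m) (K : PreAbstractSimplicialComplex V) (S : HypCone.SmoothSphere K m)
    (ξ ς c : ℝ) (hξ : 0 < ξ) (hς₀ : 0 < ς) (hς₁ : ς < 1) (hc : 1 < c)
    (h₁ : c * ς < Real.exp (-(8 + ξ))) (h₂ : Real.exp (4 + ξ) ≤ c) (h₃ : (m : ℝ) + 1 ≤ ξ)
    (ε : ℝ) (hε : 0 < ε) :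
    ∃ D : ℕ → ℝ, ∀ d : ℕ → ℝ, (∀ i ∈ Finset.Icc 2 (m + 1), D i ≤ d i) →
      ∃ R : ℕ → ℝ, ∀ r : ℝ, (∀ i ∈ Finset.Icc 2 (m + 1), R i ≤ r - d i) →
        HypCone.IsBallClose (HypCone.smoothedMetric S ρ ξ ς c r d)
          (HypCone.rad ς r (m - 1) - d (m + 1)) ε (ξ - m + 1 / m) := by
  open HypCone in
  have hP := params_of_bounds hξ hς₀ h₁ h₂
  have hm' : (1 : ℝ) ≤ m := by exact_mod_cast hm
  set ξ' : ℝ := ξ - m + 1 / m with hξ'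
  have hinv : 1 / (m : ℝ) ≤ 1 := by rw [div_le_one (by linarith)]; exact hm'
  have hinv0 : 0 < 1 / (m : ℝ) := by positivity
  have hξ'0 : 0 < ξ' := by rw [hξ']; linarith
  have hξ'le : ξ' ≤ ξ := by rw [hξ']; linarith
  -- the rate of change that the cut-offs of the models may have
  set J := jetConst (1 + ξ')
  obtain ⟨η, hη0, hη1, hηJ⟩ : ∃ η : ℝ, 0 < η ∧ η ≤ 1 ∧ η * J < ε / 2 := by
    refine ⟨min 1 (ε / 4 / (|J| + 1)), by positivity, min_le_left _ _, ?_⟩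
    have h : min 1 (ε / 4 / (|J| + 1)) * (|J| + 1) ≤ ε / 4 := by
      rw [← le_div_iff₀ (by positivity)]; exact min_le_right _ _
    have h0 : 0 < min 1 (ε / 4 / (|J| + 1)) := by positivity
    nlinarith [le_abs_self J]
  choose C hC1 hC using fun τ : Face K => exists_slowModel S hρ hP _ τ (Nat.lt_succ_self _)
  choose D hD using fun τ => hC τ η hη0 hη1
  obtain ⟨D₀, hD₀⟩ := Finite.exists_le D
  refine ⟨fun _ => max D₀ 1, fun d hd => ?_⟩
  have hslow : ∀ τ : Face K, SlowModel S.h ρ ς c d τ η := fun τ =>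
    (hD τ d fun i hi => (hD₀ τ).trans ((le_max_left _ _).trans (hd i hi))).1
  have hd1 : ∀ i ∈ Finset.Icc 2 (m + 1), 1 ≤ d i := fun i hi => (le_max_right _ _).trans (hd i hi)
  have hmem : ∀ σ : Face K, σ.1.card + 1 ≤ m → m - σ.1.card + 1 ∈ Finset.Icc 2 (m + 1) :=
    fun σ hσ => Finset.mem_Icc.mpr (by omega)
  obtain ⟨b, κ₁, hb, hκ₁, hscale⟩ := exists_chartScale S hρ hP (ξ := ξ) (T := 1 + ξ') hη0.le hη1 hηJ
    (fun σ hσ => hd1 _ (hmem σ hσ)) hslow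
  -- `s` bounds all the `d i`; distances of at least `M` from the origin give `1 / sinh t < κ₁`
  set s := ∑ i ∈ Finset.Icc 2 (m + 1), |d i| with hs
  have hs0 : 0 ≤ s := Finset.sum_nonneg fun i _ => abs_nonneg _
  have hds : ∀ i ∈ Finset.Icc 2 (m + 1), d i ≤ s := fun i hi =>
    (le_abs_self _).trans (Finset.single_le_sum (f := fun i => |d i|) (fun i _ => abs_nonneg _) hi)
  set M := 1 + ξ' + κ₁⁻¹ + 1 with hM
  have hκinv : 0 < κ₁⁻¹ := inv_pos.mpr hκ₁
  -- with these bounds, already `r ≥ s + M + 1 + ξ'`; so the centers of charts, at distance at least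
  -- `a - 1 - ξ'` from the origin, have distance at least `M` from it
  refine ⟨fun i => s + M + 1 + ξ' - d i, fun r hr => ?_⟩
  have hmm : m + 1 ∈ Finset.Icc 2 (m + 1) := Finset.mem_Icc.mpr (by omega)
  have hr' : s + M + 1 + ξ' ≤ r := by linarith [hr _ hmm]
  have hr0 : 0 < r := by linarith
  have hlt : ∀ t : ℝ, M ≤ t → 0 < (Real.sinh t)⁻¹ ∧ (Real.sinh t)⁻¹ < κ₁ := fun t ht => by
    have ht0 : 0 < t := by linarith
    have hsh : t ≤ Real.sinh t := Real.self_le_sinh_iff.mpr ht0.le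
    exact ⟨inv_pos.mpr (by linarith), inv_lt_of_inv_lt₀ hκ₁ (by linarith)⟩
  set κ := (Real.sinh r)⁻¹ with hκ
  obtain ⟨hκ0, hκlt⟩ := hlt r (by linarith)
  have hsmall := (hscale κ κ hκ0 hκlt hκ0 hκlt).small
  have hrad : ∀ i, r ≤ rad ς r i := le_rad hς₀ hς₁ hr0
  have heq : smoothedMetric S ρ ξ ς c r d =
      polarOf fun x : LC m (Face.empty K) => model S.h ρ ς c d (Face.empty K) κ (κ • x) :=
    smoothedLink_eq S hρ hP hξ hr0 hsmall
      (fun σ hσ => (hds _ (hmem σ hσ)).trans (le_trans (by linarith) (hrad _))) _ (Face.empty K)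
      (Nat.lt_succ_self _) (by simpa [Face.empty] using hm)
  have ha : M + 1 + ξ' ≤ rad ς r (m - 1) - d (m + 1) := by
    linarith [hrad (m - 1), hds _ hmm]
  have hhyp : ∀ p, ‖p‖ < rad ς r (m - 1) - d (m + 1) →
      smoothedMetric S ρ ξ ς c r d p = hypPolar p := fun p hp =>
    smoothedMetric_eq_hypPolar S hρ (zero_lt_one.trans_le (hd1 _ hmm)) hp
  have hmetric := isRiemannianMetric_polarOf (n := m + 1)
    (β := fun x => model S.h ρ ς c d (Face.empty K) κ (κ • x))
    (fun x => IsConeMetric.smul hκ0.ne'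
      (isConeMetric_model S hρ hP _ (Face.empty K) (Nat.lt_succ_self _) (κ • x)))
    (contDiff_iff_contDiffAt.mpr fun x => ContDiffAt.comp x
      (g := fun p : ℝ × LC m (Face.empty K) => model S.h ρ ς c d (Face.empty K) p.1 p.2)
      (f := fun x => (κ, κ • x))
      (contDiffAt_model S hρ hP _ (Face.empty K) (Nat.lt_succ_self _) κ hsmall (κ • x))
      (contDiffAt_const.prodMk (contDiffAt_id.const_smul κ)))
    (s := rad ς r (m - 1) - d (m + 1)) (by linarith)
    (fun p hp => (congrFun heq p).symm.trans (hhyp p hp))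
  refine ⟨heq ▸ hmetric.1, fun p b => (congrFun (congrFun (congrFun heq p) p) b).trans
    (hmetric.2 p b), hhyp, fun p hp => ?_⟩
  obtain ⟨hμ0, hμlt⟩ := hlt ‖p‖ (by linarith)
  have := exists_isRadialChart S hρ hξ hς₀ h₁ h₂ hξ'0 hξ'le hε hb (p := p)
    (show 1 + ξ' ≤ ‖p‖ by linarith) (hscale κ _ hκ0 hκlt hμ0 hμlt)
  rw [heq]
  exact this
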